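/- Let $\mathcal Q:\mathbb R\to\mathbb R$ be an even polynomial of degree $2n\ge 4$ with $\mathcal Q(0)=0$, $\mathcal Q(x)>0$ for $x\ne0$, and quadratic coefficient $1$. Let $F:\mathbb R\to\mathbb R$ be an even $C^2$ function for which there are $C,M>0$ and $\beta\in(0,1)$ with $$\sup_{0\le \ell\le 2}|F^{(\ell)}(w)|\le C(1+|w|)^M,\qquad |F''(w+h)-F''(w)|\le C|h|^\beta(1+|w|+|h|)^M\qquad (w,h\in\mathbb R).$$ Let $\theta:\mathbb R^2\to\mathbb R$ be measurable with $\theta(t,-x)=\theta(t,x)$, $|\theta(t,x)|\lesssim(1+\sqrt{|t|}+|x|)^{-4-\delta_0}$ for some $\delta_0>0$, and $\int_{\mathbb R^2}\theta=1$. Write $\mathbb T=\mathbb R/\mathbb Z$ and $\mathbb T/\varepsilon=\mathbb R/(\varepsilon^{-1}\mathbb Z)$. For $\varepsilon\in(0,1)$ let $\eta^{(\varepsilon)}$ be a Poisson point process on $\mathbb R\times(\mathbb T/\varepsilon)$ with Lebesgue intensity, let $\theta^{(\varepsilon)}(t,x)=\sum_{k\in\mathbb Z}\theta(t,x+k/\varepsilon)$,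 and set $$\widetilde\xi(t,x)=\int_{\mathbb R\times(\mathbb T/\varepsilon)}\theta^{(\varepsilon)}(t-s,x-y)\,\eta^{(\varepsilon)}(ds,dy)-1,\qquad \xi_\varepsilon(t,x)=\varepsilon^{-3/2}\,\widetilde\xi(t/\varepsilon^2,x/\varepsilon)\quad\text{on }\mathbb R\times\mathbb T.$$ Let $P_\varepsilon(t,x)=\mathbf 1_{t>0}\sum_{k\in\mathbb Z}e^{-t\varepsilon^{-2}\mathcal Q(-2\pi\varepsilon k)}e^{2\pi i kx}$ be the Green's function of $\partial_t-\mathcal L_\varepsilon$ on $\mathbb R\times\mathbb T$, where $\widehat{\mathcal L_\varepsilon f}(k)=-\varepsilon^{-2}\mathcal Q(-2\pi\varepsilon k)\widehat f(k)$, and let $\Psi_\varepsilon=P_\varepsilon'\ast\xi_\varepsilon$, where $'$ is the spatial derivative and $\ast$ the space-time convolution. Let $\eta$ be a Poisson point process on $\mathbb R^2$ with Lebesgue intensity, $\bar\xi(t,x)=\int_{\mathbb R^2}\theta(t-s,x-y)\,\eta(ds,dy)-1$, and let $P(t,x)=\mathbf 1_{t>0}\int_{\mathbb R}e^{-t\mathcal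 Q(-2\pi k)}e^{2\pi i kx}\,dk$ be the Green's function of $\partial_t-\mathcal L$ on $\mathbb R^2$, where $\widehat{\mathcal L f}(k)=-\mathcal Q(-2\pi k)\widehat f(k)$. Let $(P'\ast\bar\xi)(0)$ be the limit in $L^2$ of the random variables $\int_{(-T,0)\times\mathbb R}P'(-y)\,\bar\xi(y)\,dy$ as $T\to\infty$. Then all of these objects are well defined: each of the integrals defining $\widetilde\xi$, $\Psi_\varepsilon$ and $\bar\xi$ at a given point, and the integral over $(-T,0)\times\mathbb R$ for a given $T$, converges absolutely almost surely; the $L^2$ limit exists; and $F''(\sqrt\varepsilon\,\Psi_\varepsilon(z))$ and $F''\big((P'\ast\bar\xi)(0)\big)$ are integrable. The number $a_\varepsilon=\tfrac12\,\mathbb E\,F''(\sqrt\varepsilon\,\Psi_\varepsilon(z))$ does not depend on $z\in\mathbb R\times\mathbb T$, and $$\lim_{\varepsilon\to0}a_\varepsilon=a:=\tfrac12\,\mathbb E\,F''\big((P'\ast\bar\xi)(0)\big).$$ -/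

import Mathlib

open MeasureTheory ProbabilityTheory Filter Topology Set
open scoped ENNReal NNReal

noncomputable section

namespace KPZCoupling

/-- Assumption on the symbol `Q` of the smoothing operator `L = -Q(i∂ₓ)`. -/
structure SmoothingAssumption (Q : Polynomial ℝ) : Prop where
  eval_zero : Q.eval 0 = 0
  eval_pos : ∀ x : ℝ, x ≠ 0 → 0 < Q.eval x
  even : ∀ x : ℝ, Q.eval (-x) = Q.eval x
  degree : ∃ n : ℕ, 4 ≤ 2 * n ∧ Q.natDegree = 2 * n
  coeff_two : Q.coeff 2 = 1

/-- Assumption on the nonlinearity `F`. -/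
structure NonlinearityAssumption (F : ℝ → ℝ) : Prop where
  even : ∀ w, F (-w) = F w
  contDiff : ContDiff ℝ 2 F
  growth : ∃ C > (0 : ℝ), ∃ M > (0 : ℝ), ∃ β ∈ Ioo (0 : ℝ) 1,
    (∀ l ≤ 2, ∀ w : ℝ, |iteratedDeriv l F w| ≤ C * (1 + |w|) ^ M) ∧
    ∀ w h : ℝ, |iteratedDeriv 2 F (w + h) - iteratedDeriv 2 F w| ≤
      C * |h| ^ β * (1 + |w| + |h|) ^ M

/-- Assumption on the space-time mollifier `θ`, a function of `(t, x)`. -/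
structure MollifierAssumption (θ : ℝ × ℝ → ℝ) : Prop where
  measurable : Measurable θ
  symm : ∀ t x, θ (t, -x) = θ (t, x)
  decay : ∃ δ₀ > (0 : ℝ), ∃ C : ℝ, ∀ t x : ℝ,
    |θ (t, x)| ≤ C * (1 + (√|t| + |x|)) ^ (-4 - δ₀)
  integral_eq_one : ∫ p, θ p = 1

/-- `η` is a Poisson point process with intensity measure `μ`: a random σ-finite measure with
values in `{0, 1, …, ∞}` whose masses of measurable sets are Poisson distributed (with the
convention that a Poisson variable of infinite mean is a.s. infinite) and independent over
pairwise disjoint measurable sets. -/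
structure IsPoissonProcess {Ω E : Type*} [MeasurableSpace Ω] [MeasurableSpace E]
    (η : Ω → Measure E) (μ : Measure E) (Pr : Measure Ω) : Prop where
  measurable : Measurable η
  sigmaFinite : ∀ ω, SigmaFinite (η ω)
  counting : ∀ ω B, MeasurableSet B → ∃ n : ℕ∞, η ω B = (n : ℝ≥0∞)
  law : ∀ B, MeasurableSet B → μ B ≠ ∞ →
    Pr.map (fun ω => η ω B) = (poissonMeasure (μ B).toNNReal).map (fun n : ℕ => (n : ℝ≥0∞))
  law_top : ∀ B, MeasurableSet B → μ B = ∞ → ∀ᵐ ω ∂Pr, η ω B = ∞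
  indep : ∀ (n : ℕ) (B : Fin n → Set E), (∀ i, MeasurableSet (B i)) →
    Pairwise (fun i j => Disjoint (B i) (B j)) → iIndepFun (fun i ω => η ω (B i)) Pr

/-- The range `(0, 1)` of the scale parameter `ε`. -/
abbrev Scale : Type := Ioo (0 : ℝ) 1

instance (ε : Scale) : Fact (0 < 1 / (ε : ℝ)) := ⟨one_div_pos.2 ε.2.1⟩

/-- The space-time `ℝ × (𝕋 / ε)` on which the microscopic noise lives. -/
abbrev Micro (ε : Scale) : Type := ℝ × AddCircle (1 / (ε : ℝ))

/-- The space-time `ℝ × 𝕋`. -/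
abbrev Macro : Type := ℝ × UnitAddCircle

/-! ### The periodic setting -/

lemma periodic_periodization (ε : Scale) (g : ℝ → ℝ) :
    Function.Periodic (fun x : ℝ => ∑' k : ℤ, g (x + k / ε)) (1 / (ε : ℝ)) := by
  intro x
  dsimp only
  rw [← (Equiv.addRight (1 : ℤ)).tsum_eq (fun k : ℤ => g (x + k / ε))]
  refine tsum_congr fun k => ?_
  simp only [Equiv.coe_addRight, Int.cast_add, Int.cast_one]
  congr 1
  ring

/-- `θ^(ε)(t, x) = ∑_{k ∈ ℤ} θ(t, x + k/ε)`, as a function on `ℝ × (𝕋 / ε)`. -/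
def periodizedMollifier (θ : ℝ × ℝ → ℝ) (ε : Scale) (p : Micro ε) : ℝ :=
  (periodic_periodization ε fun x => θ (p.1, x)).lift p.2

/-- The microscopic noise `ξ̃(p) = ∫ θ^(ε)(p - u) η(du) - 1` on `ℝ × (𝕋 / ε)` driven by `η`. -/
def microNoise (θ : ℝ × ℝ → ℝ) (ε : Scale) (η : Measure (Micro ε)) (p : Micro ε) : ℝ :=
  (∫ u, periodizedMollifier θ ε (p - u) ∂η) - 1

/-- The dilation `x ↦ x / ε` from `𝕋` to `𝕋 / ε`. -/
def dilate (ε : Scale) : UnitAddCircle → AddCircle (1 / (ε : ℝ)) :=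
  AddCircle.equivAddCircle 1 (1 / (ε : ℝ)) one_ne_zero (one_div_pos.2 ε.2.1).ne'

/-- The rescaled noise `ξ_ε(t, x) = ε^(-3/2) ξ̃(t / ε², x / ε)` on `ℝ × 𝕋`. -/
def macroNoise (θ : ℝ × ℝ → ℝ) (ε : Scale) (η : Measure (Micro ε)) (p : Macro) : ℝ :=
  (ε : ℝ) ^ (-(3 / 2) : ℝ) * microNoise θ ε η (p.1 / (ε : ℝ) ^ 2, dilate ε p.2)

/-- The Green's function `P_ε` of `∂ₜ - L_ε` on `ℝ × 𝕋`, where `L_ε` is the Fourier multiplier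
`-ε⁻² Q(-2πεk)`: for `t > 0`, `P_ε(t, x) = ∑_k exp(-t ε⁻² Q(-2πεk)) e^{2πikx}`, and `P_ε` vanishes
for `t ≤ 0`. (The sum is real for even `Q`.) -/
def greenTorus (Q : Polynomial ℝ) (ε : Scale) (t : ℝ) (x : UnitAddCircle) : ℝ :=
  if 0 < t then
    (∑' k : ℤ, (Real.exp (-(t * ((ε : ℝ) ^ 2)⁻¹ * Q.eval (-(2 * Real.pi * ε * k)))) : ℂ) *
      fourier k x).re
  else 0

/-- The spatial derivative `P_ε'`. -/
def greenTorusDeriv (Q : Polynomial ℝ) (ε : Scale) (p : Macro) : ℝ :=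
  deriv (fun r : ℝ => greenTorus Q ε p.1 (p.2 + (r : UnitAddCircle))) 0

/-- The free field `Ψ_ε = P_ε' ∗ ξ_ε` (space-time convolution on `ℝ × 𝕋`). -/
def freeField (Q : Polynomial ℝ) (θ : ℝ × ℝ → ℝ) (ε : Scale) (η : Measure (Micro ε))
    (z : Macro) : ℝ :=
  ∫ y : Macro, greenTorusDeriv Q ε (z - y) * macroNoise θ ε η y

/-- `a_ε = ½ E F''(√ε Ψ_ε(z))`, computed at the space-time point `z`. -/
def couplingEps (Q : Polynomial ℝ) (F : ℝ → ℝ) (θ : ℝ × ℝ → ℝ) (ε : Scale)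
    {Ω : Type*} [MeasurableSpace Ω] (Pr : Measure Ω) (η : Ω → Measure (Micro ε)) (z : Macro) : ℝ :=
  1 / 2 * ∫ ω, iteratedDeriv 2 F (√(ε : ℝ) * freeField Q θ ε (η ω) z) ∂Pr

/-! ### The whole-space setting -/

/-- The noise `ξ̄(p) = ∫ θ(p - u) η(du) - 1` on `ℝ²` driven by `η`. -/
def wholeNoise (θ : ℝ × ℝ → ℝ) (η : Measure (ℝ × ℝ)) (p : ℝ × ℝ) : ℝ :=
  (∫ u, θ (p - u) ∂η) - 1

/-- The Green's function `P` of `∂ₜ - L` on `ℝ²`: for `t > 0`,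
`P(t, x) = ∫ exp(-t Q(-2πk)) e^{2πikx} dk`, and `P` vanishes for `t ≤ 0`. -/
def greenLine (Q : Polynomial ℝ) (t x : ℝ) : ℝ :=
  if 0 < t then
    (∫ k : ℝ, (Real.exp (-(t * Q.eval (-(2 * Real.pi * k)))) : ℂ) *
      Complex.exp (2 * Real.pi * Complex.I * k * x)).re
  else 0

/-- The spatial derivative `P'`. -/
def greenLineDeriv (Q : Polynomial ℝ) (p : ℝ × ℝ) : ℝ :=
  deriv (fun x : ℝ => greenLine Q p.1 x) p.2

/-- The integrand of `(P' ∗ ξ̄)(0) = ∫ P'(-y) ξ̄(y) dy`. -/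
def convIntegrand (Q : Polynomial ℝ) (θ : ℝ × ℝ → ℝ) (η : Measure (ℝ × ℝ)) (y : ℝ × ℝ) : ℝ :=
  greenLineDeriv Q (-y) * wholeNoise θ η y

/-- The part of the convolution `(P' ∗ ξ̄)(0)` coming from times in `(-T, 0)`. -/
def truncatedConv (Q : Polynomial ℝ) (θ : ℝ × ℝ → ℝ) (T : ℝ) (η : Measure (ℝ × ℝ)) : ℝ :=
  ∫ y in Ioo (-T) 0 ×ˢ univ, convIntegrand Q θ η y

/-- The random variable `X` is the space-time convolution `(P' ∗ ξ̄)(0)`. As `P'` is not integrable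
over `ℝ²` (it decays like the parabolic distance to the power `-2`), the time integral over
`(-∞, 0)` is an improper one, taken as a limit in `L²`. -/
structure IsConvAtZero (Q : Polynomial ℝ) (θ : ℝ × ℝ → ℝ) {Ω : Type*} [MeasurableSpace Ω]
    (Pr : Measure Ω) (η : Ω → Measure (ℝ × ℝ)) (X : Ω → ℝ) : Prop where
  memLp : MemLp X 2 Pr
  tendsto : Tendsto (fun T : ℝ => eLpNorm (fun ω => truncatedConv Q θ T (η ω) - X ω) 2 Pr)
    atTop (𝓝 0)

end KPZCoupling

end

open scoped FourierTransform

noncomputable section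

namespace KPZCoupling

/-! ### The exponential formula for Poisson processes -/

/-! Every random variable in question is a compensated Poisson integral `∫ k dη - ∫ k du`. Its
characteristic function is `exp` of `∫ (exp (iλk) - 1 - iλk) du`, so its law depends only on the
kernel `k`, through a functional whose integrand is quadratic in `k` near zero. The problem thus
reduces to deterministic convergence of kernels that are uniformly bounded and converge in `L²`; no
`L¹` control uniform in `ε` is needed.

Scaling to microscopic variables cancels all powers of `ε`: `freeField_eq` and
`IsPoissonProcess.ae_freeField` show that `√ε Ψ_ε(z)` is the compensated integral of a translated
and reflected `torusConv`, the mollified gradient of the heat kernel on `ℝ × (𝕋 / ε)`. Since the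
cumulant functional does not see translations and reflections, the law does not depend on `z`.

The torus kernel is the Fourier integral on the line with each frequency rounded down to the lattice
`ε ℤ`. Treating both cases as samplings `ρ` with `|ρ k - k| ≤ 1` gives bounds uniform in `ε`, and
turns convergence of Riemann sums into dominated convergence. The pointwise limit of the kernels is
`tendsto_specConv`. The `L²` norms are computed by Parseval in space and integration in time
(`IsSpectralKernel.integral_sq_liftConv`), and they converge by `tendsto_integral_specCov`. Pratt's
lemma, `tendsto_integral_of_tendsto_bound`, with the squares of the kernels as majorants, then
yields convergence of the cumulants (`tendsto_cumulant_torusConv`), hence convergence in law.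

On the line the kernel is square integrable, and it is shown to be integrable on bounded time
intervals only. Spatial decay comes from two integrations by parts in frequency
(`exists_abs_lineKernel_le`). The increments of the truncated convolutions are compensated integrals
of kernels with small `L²` norm, so they form a Cauchy family in `L²`
(`IsPoissonProcess.exists_isConvAtZero`). Any limit `X` inherits the exponential moments and the
limiting characteristic function (`IsConvAtZero.exists_hasPoissonLaw`).

To pass from convergence in law to convergence of `E F''`, uniform integrability is required. The
exponential formula at the real arguments `±1` bounds `E exp |X|` by the sup and `L²` norms of the
kernel, uniformly in `ε`, while `F''` grows polynomially; `tendsto_integral_of_tendsto_charFun`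
combines the two. -/

lemma integral_exp_mul_poissonMeasure (r : ℝ≥0) (c : ℂ) :
    ∫ n : ℕ, Complex.exp (c * n) ∂(poissonMeasure r) = Complex.exp (r * (Complex.exp c - 1)) := by
  have key : HasSum (fun n : ℕ => (Real.exp (-r) * r ^ n / n.factorial) • Complex.exp (c * n))
      (Complex.exp (r * (Complex.exp c - 1))) := by
    have h1 := (NormedSpace.expSeries_div_hasSum_exp ((r : ℂ) * Complex.exp c)).mul_left
      (Complex.exp (-r))
    rw [← Complex.exp_eq_exp_ℂ, ← Complex.exp_add] at h1
    have e1 : (fun n : ℕ => (Real.exp (-r) * r ^ n / n.factorial) • Complex.exp (c * n)) =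
        fun n : ℕ => Complex.exp (-r) * (((r : ℂ) * Complex.exp c) ^ n / n.factorial) := by
      funext n
      rw [mul_pow, ← Complex.exp_nat_mul, mul_comm c, Complex.real_smul]
      push_cast
      ring
    rw [e1, show (r : ℂ) * (Complex.exp c - 1) = -r + r * Complex.exp c by ring]
    exact h1
  have hint : Integrable (fun n : ℕ => Complex.exp (c * n)) (poissonMeasure r) := by
    rw [integrable_poissonMeasure_iff]
    refine (key.summable.norm).congr fun n => ?_
    rw [norm_smul, Real.norm_of_nonneg (by positivity)]
  exact (hasSum_integral_poissonMeasure hint).unique key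

/-- The factor `n` cancels one factor of `n!`; after the vanishing term `n = 0` is dropped and the
index shifted, `r` times the total mass remains. -/
lemma lintegral_poissonMeasure_natCast (r : ℝ≥0) :
    ∫⁻ n : ℕ, (n : ℝ≥0∞) ∂(poissonMeasure r) = r := by
  rw [poissonMeasure, lintegral_sum_measure]
  simp only [lintegral_smul_measure, lintegral_dirac, smul_eq_mul]
  rw [tsum_eq_zero_add' ENNReal.summable]
  simp only [Nat.cast_zero, mul_zero, zero_add]
  have h : ∀ n : ℕ, ENNReal.ofReal (Real.exp (-r) * r ^ (n + 1) / (n + 1).factorial) *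
      ((n + 1 : ℕ) : ℝ≥0∞) =
      r * ENNReal.ofReal (Real.exp (-r) * r ^ n / n.factorial) := by
    intro n
    rw [← ENNReal.ofReal_natCast, ← ENNReal.ofReal_mul (by positivity),
      ← ENNReal.ofReal_coe_nnreal, ← ENNReal.ofReal_mul (by positivity), Nat.factorial_succ]
    congr 1
    push_cast
    field_simp
    ring
  rw [tsum_congr h, ENNReal.tsum_mul_left,
    ← ENNReal.ofReal_tsum_of_nonneg (fun n => by positivity) (hasSum_one_poissonMeasure r).summable,
    (hasSum_one_poissonMeasure r).tsum_eq]
  simp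

lemma norm_exp_sub_one_le_mul_exp (z : ℂ) : ‖Complex.exp z - 1‖ ≤ ‖z‖ * Real.exp ‖z‖ := by
  simpa using Complex.norm_exp_sub_sum_le_norm_mul_exp z 1

lemma norm_exp_sub_one_sub_le_mul_exp (z : ℂ) :
    ‖Complex.exp z - 1 - z‖ ≤ ‖z‖ ^ 2 * Real.exp ‖z‖ := by
  have := Complex.norm_exp_sub_sum_le_norm_mul_exp z 2
  simpa [Finset.sum_range_succ, sub_add_eq_sub_sub] using this

section Poisson

variable {Ω E : Type*} [MeasurableSpace Ω] [MeasurableSpace E] {η : Ω → Measure E} {μ : Measure E}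
  {Pr : Measure Ω}

lemma IsPoissonProcess.measurable_apply (h : IsPoissonProcess η μ Pr) {B : Set E}
    (hB : MeasurableSet B) : Measurable fun ω => η ω B :=
  (Measure.measurable_coe hB).comp h.measurable

/-- Campbell's formula, for sets. -/
lemma IsPoissonProcess.bind_eq [IsProbabilityMeasure Pr] (h : IsPoissonProcess η μ Pr) :
    Pr.bind η = μ := by
  ext B hB
  rw [Measure.bind_apply hB h.measurable.aemeasurable]
  by_cases hμ : μ B = ∞
  · rw [lintegral_congr_ae (h.law_top B hB hμ), hμ]
    simp
  · rw [← lintegral_map (f := fun x => x) measurable_id (h.measurable_apply hB), h.law B hB hμ,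
      lintegral_map (f := fun x => x) measurable_id measurable_from_top, lintegral_poissonMeasure_natCast,
      ENNReal.coe_toNNReal hμ]

lemma IsPoissonProcess.lintegral_lintegral [IsProbabilityMeasure Pr]
    (h : IsPoissonProcess η μ Pr) {f : E → ℝ≥0∞} (hf : Measurable f) :
    ∫⁻ ω, ∫⁻ x, f x ∂(η ω) ∂Pr = ∫⁻ x, f x ∂μ := by
  rw [← Measure.lintegral_bind h.measurable.aemeasurable hf.aemeasurable, h.bind_eq]

lemma IsPoissonProcess.ae_lintegral_lt_top [IsProbabilityMeasure Pr]
    (h : IsPoissonProcess η μ Pr) {f : E → ℝ≥0∞} (hf : Measurable f) (hfi : ∫⁻ x, f x ∂μ ≠ ∞) :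
    ∀ᵐ ω ∂Pr, ∫⁻ x, f x ∂(η ω) < ∞ := by
  rw [← h.lintegral_lintegral hf] at hfi
  exact ae_lt_top ((Measure.measurable_lintegral hf).comp h.measurable) hfi

/-- By Campbell's formula the integral of `‖f‖` against the process has finite mean, hence is almost
surely finite. All almost sure absolute convergence statements rest on this. -/
lemma IsPoissonProcess.ae_integrable [IsProbabilityMeasure Pr]
    {F : Type*} [NormedAddCommGroup F] [MeasurableSpace F] [BorelSpace F]
    [SecondCountableTopology F]
    (h : IsPoissonProcess η μ Pr) {f : E → F} (hf : Measurable f) (hfi : Integrable f μ) :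
    ∀ᵐ ω ∂Pr, Integrable f (η ω) := by
  filter_upwards [h.ae_lintegral_lt_top hf.enorm hfi.2.ne] with ω hω
  exact ⟨hf.aestronglyMeasurable, hω⟩

/-- Lower integrals depend measurably on the measure, and the Bochner integral is the difference of
those of the positive and negative parts whenever `f` is integrable, which is an almost sure event.
-/
lemma IsPoissonProcess.aestronglyMeasurable_integral [IsProbabilityMeasure Pr]
    (h : IsPoissonProcess η μ Pr) {f : E → ℝ} (hf : Measurable f) (hfi : Integrable f μ) :
    AEStronglyMeasurable (fun ω => ∫ x, f x ∂(η ω)) Pr := by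
  have hm : ∀ g : E → ℝ≥0∞, Measurable g → Measurable fun ω => (∫⁻ x, g x ∂(η ω)).toReal :=
    fun g hg => ((Measure.measurable_lintegral hg).comp h.measurable).ennreal_toReal
  refine AEStronglyMeasurable.congr
    ((hm (fun x => ENNReal.ofReal (f x)) (by fun_prop)).sub
      (hm (fun x => ENNReal.ofReal (-f x)) (by fun_prop))).aestronglyMeasurable ?_
  filter_upwards [h.ae_integrable hf hfi] with ω hω
  exact (integral_eq_lintegral_pos_part_sub_lintegral_neg_part hω).symm

lemma IsPoissonProcess.integral_exp_mul_apply (h : IsPoissonProcess η μ Pr) {B : Set E}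
    (hB : MeasurableSet B) (hμ : μ B ≠ ∞) (c : ℂ) :
    ∫ ω, Complex.exp (c * (η ω B).toReal) ∂Pr = Complex.exp (μ.real B * (Complex.exp c - 1)) := by
  have hm : Measurable fun x : ℝ≥0∞ => Complex.exp (c * x.toReal) := by fun_prop
  rw [← integral_map (f := fun x : ℝ≥0∞ => Complex.exp (c * x.toReal))
    (h.measurable_apply hB).aemeasurable hm.aestronglyMeasurable, h.law B hB hμ,
    integral_map (by fun_prop) hm.aestronglyMeasurable]
  have := integral_exp_mul_poissonMeasure (μ B).toNNReal c
  rw [ENNReal.coe_toNNReal_eq_toReal] at this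
  simpa [Measure.real] using this

/-- The level sets of a simple function are disjoint, so their masses are independent Poisson
variables and the expectation factorises into one-variable Poisson transforms. -/
lemma IsPoissonProcess.integral_exp_simpleFunc [IsProbabilityMeasure Pr]
    (h : IsPoissonProcess η μ Pr) (f : SimpleFunc E ℂ) (hf : Integrable f μ) :
    ∫ ω, Complex.exp (∫ x, f x ∂(η ω)) ∂Pr =
      Complex.exp (∫ x, (Complex.exp (f x) - 1) ∂μ) := by
  classical
  -- The level set of `0` may have infinite intensity; it contributes to neither side and is
  -- removed.
  set s : Finset ℂ := f.range.filter (· ≠ 0) with hs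
  set e := s.equivFin.symm with he
  set c : Fin s.card → ℂ := fun i => (e i : ℂ) with hc
  have hc0 : ∀ i, c i ≠ 0 := fun i => (Finset.mem_filter.1 (e i).2).2
  set B : Fin s.card → Set E := fun i => f ⁻¹' {c i} with hBdef
  have hB : ∀ i, MeasurableSet (B i) := fun i => f.measurableSet_preimage _
  have hμB : ∀ i, μ (B i) ≠ ∞ := fun i => (SimpleFunc.integrable_iff.1 hf _ (hc0 i)).ne
  have hdisj : Pairwise fun i j => Disjoint (B i) (B j) := by
    intro i j hij
    refine Disjoint.preimage _ (Set.disjoint_singleton.2 fun hcc => hij ?_)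
    exact e.injective (Subtype.ext hcc)
  have hsum : ∀ (g : ℂ → ℂ), g 0 = 0 →
      ∀ ν : Measure E, ∑ x ∈ f.range, ν.real (f ⁻¹' {x}) • g x =
        ∑ i, (ν.real (B i) : ℂ) * g (c i) := by
    intro g hg ν
    rw [← Finset.sum_filter_add_sum_filter_not f.range (· ≠ 0)]
    rw [Finset.sum_eq_zero (s := f.range.filter fun x => ¬ x ≠ 0), add_zero]
    · rw [← hs, ← Finset.sum_coe_sort s, ← e.sum_comp]
      simp [hBdef, hc, Complex.real_smul]
    · intro x hx
      have : x = 0 := by simpa using (Finset.mem_filter.1 hx).2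
      simp [this, hg]
  have h1 : ∀ᵐ ω ∂Pr, Complex.exp (∫ x, f x ∂(η ω)) =
      ∏ i, Complex.exp (c i * ((η ω (B i)).toReal : ℂ)) := by
    filter_upwards [h.ae_integrable f.measurable hf] with ω hω
    rw [SimpleFunc.integral_eq_sum f hω, hsum (fun x => x) rfl, Complex.exp_sum]
    exact Finset.prod_congr rfl fun i _ => by rw [mul_comm]; rfl
  have hm : ∀ i, Measurable fun x : ℝ≥0∞ => Complex.exp (c i * x.toReal) := by
    intro i; fun_prop
  rw [integral_congr_ae h1, (h.indep _ B hB hdisj).integral_fun_prod_comp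
    (f := fun i (x : ℝ≥0∞) => Complex.exp (c i * x.toReal))
    (fun i => (h.measurable_apply (hB i)).aemeasurable) (fun i => (hm i).aestronglyMeasurable)]
  have h2 : ∫ x, (Complex.exp (f x) - 1) ∂μ =
      ∑ x ∈ f.range, μ.real (f ⁻¹' {x}) • (Complex.exp x - 1) := by
    have hi := SimpleFunc.map_integral f (fun x => Complex.exp x - 1) hf (by simp)
    rw [← hi, SimpleFunc.integral_eq_integral]
    · rfl
    · have := SimpleFunc.integrable_iff.1 hf
      exact (SimpleFunc.integrable_iff_finMeasSupp.2
        ((SimpleFunc.integrable_iff_finMeasSupp.1 hf).map (by simp)))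
  rw [h2, hsum (fun x => Complex.exp x - 1) (by simp), Complex.exp_sum]
  exact Finset.prod_congr rfl fun i _ => h.integral_exp_mul_apply (hB i) (hμB i) (c i)

/-- Fatou along simple approximations, whose expectations are given by the simple-function formula
and bounded through `|exp x - 1| ≤ |x| exp |x|`. The result provides the dominating variable for the
complex exponential formula. -/
lemma IsPoissonProcess.integrable_exp_integral_of_nonneg [IsProbabilityMeasure Pr]
    (h : IsPoissonProcess η μ Pr) {f : E → ℝ} (hf : Measurable f) (hfi : Integrable f μ)
    {C : ℝ} (hC : ∀ x, ‖f x‖ ≤ C) :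
    Integrable (fun ω => Real.exp (∫ x, f x ∂(η ω))) Pr := by
  set g : ℕ → SimpleFunc E ℝ := fun n => SimpleFunc.approxOn f hf univ 0 (mem_univ _) n with hg
  have hgle : ∀ n x, ‖g n x‖ ≤ 2 * ‖f x‖ := fun n x => by
    rw [two_mul]; exact SimpleFunc.norm_approxOn_zero_le hf (mem_univ _) x n
  have hglim : ∀ x, Tendsto (fun n => g n x) atTop (𝓝 (f x)) := fun x =>
    SimpleFunc.tendsto_approxOn hf (mem_univ _) (by simp)
  have hgi : ∀ (ν : Measure E), Integrable f ν → ∀ n, Integrable (g n) ν := fun ν hν n =>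
    (hν.norm.const_mul 2).mono' (g n).measurable.aestronglyMeasurable
      (Eventually.of_forall (hgle n))
  have hkey : ∀ n, Integrable (fun ω => Real.exp (∫ x, g n x ∂(η ω))) Pr ∧
      ∫ ω, Real.exp (∫ x, g n x ∂(η ω)) ∂Pr ≤
        Real.exp (∫ x, 2 * ‖f x‖ * Real.exp (2 * C) ∂μ) := by
    intro n
    have hs := h.integral_exp_simpleFunc ((g n).map ((↑) : ℝ → ℂ)) (hgi μ hfi n).ofReal
    have e1 : ∀ ω, Complex.exp (∫ x, ((g n).map ((↑) : ℝ → ℂ)) x ∂(η ω)) =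
        ((Real.exp (∫ x, g n x ∂(η ω)) : ℝ) : ℂ) := by
      intro ω
      rw [Complex.ofReal_exp, ← integral_complex_ofReal]
      rfl
    have e2 : ∫ x, (Complex.exp (((g n).map ((↑) : ℝ → ℂ)) x) - 1) ∂μ =
        ((∫ x, (Real.exp (g n x) - 1) ∂μ : ℝ) : ℂ) := by
      rw [← integral_complex_ofReal]
      refine integral_congr_ae (Eventually.of_forall fun x => ?_)
      simp
    rw [integral_congr_ae (Eventually.of_forall e1), e2, integral_complex_ofReal,
      ← Complex.ofReal_exp, Complex.ofReal_inj] at hs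
    refine ⟨?_, ?_⟩
    -- The integral of a non-integrable function is `0` by convention, whereas the formula equates
    -- it with an exponential.
    · by_contra hni
      rw [integral_undef hni] at hs
      exact (Real.exp_pos _).ne hs
    · rw [hs]
      refine Real.exp_le_exp.2 ((le_abs_self _).trans ?_)
      refine norm_integral_le_of_norm_le (f := fun x => Real.exp (g n x) - 1)
        ((hfi.norm.const_mul 2).mul_const _) (Eventually.of_forall fun x => ?_)
      have := norm_exp_sub_one_le_mul_exp (g n x : ℂ)
      rw [← Complex.ofReal_exp, ← Complex.ofReal_one, ← Complex.ofReal_sub, Complex.norm_real,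
        Complex.norm_real] at this
      exact this.trans (mul_le_mul (hgle n x) (Real.exp_le_exp.2 ((hgle n x).trans
        (mul_le_mul_of_nonneg_left (hC x) two_pos.le))) (Real.exp_pos _).le (by positivity))
  have hmeas : ∀ n, AEMeasurable (fun ω => ENNReal.ofReal (Real.exp (∫ x, g n x ∂(η ω)))) Pr :=
    fun n => (hkey n).1.1.aemeasurable.ennreal_ofReal
  have hlim : ∀ᵐ ω ∂Pr, Tendsto (fun n => ENNReal.ofReal (Real.exp (∫ x, g n x ∂(η ω)))) atTop
      (𝓝 (ENNReal.ofReal (Real.exp (∫ x, f x ∂(η ω))))) := by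
    filter_upwards [h.ae_integrable hf hfi] with ω hω
    refine (ENNReal.continuous_ofReal.tendsto _).comp ((Real.continuous_exp.tendsto _).comp ?_)
    exact tendsto_integral_of_dominated_convergence (fun x => 2 * ‖f x‖)
      (fun n => (g n).measurable.aestronglyMeasurable) (hω.norm.const_mul 2)
      (fun n => Eventually.of_forall (hgle n)) (Eventually.of_forall hglim)
  refine ⟨Real.continuous_exp.comp_aestronglyMeasurable
    (h.aestronglyMeasurable_integral hf hfi), ?_⟩
  rw [hasFiniteIntegral_iff_ofReal (Eventually.of_forall fun ω => (Real.exp_pos _).le)]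
  calc ∫⁻ ω, ENNReal.ofReal (Real.exp (∫ x, f x ∂(η ω))) ∂Pr
      = ∫⁻ ω, liminf (fun n => ENNReal.ofReal (Real.exp (∫ x, g n x ∂(η ω)))) atTop ∂Pr := by
        refine lintegral_congr_ae ?_
        filter_upwards [hlim] with ω hω using hω.liminf_eq.symm
    _ ≤ liminf (fun n => ∫⁻ ω, ENNReal.ofReal (Real.exp (∫ x, g n x ∂(η ω))) ∂Pr) atTop :=
        lintegral_liminf_le' hmeas
    _ ≤ liminf (fun _ : ℕ => ENNReal.ofReal (Real.exp (∫ x, 2 * ‖f x‖ * Real.exp (2 * C) ∂μ)))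
        atTop := by
        refine liminf_le_liminf (Eventually.of_forall fun n => ?_)
        rw [← ofReal_integral_eq_lintegral_ofReal (hkey n).1
          (Eventually.of_forall fun ω => (Real.exp_pos _).le)]
        exact ENNReal.ofReal_le_ofReal (hkey n).2
    _ < ∞ := by simp

/-- The exponential formula for bounded integrable functions. -/
lemma IsPoissonProcess.integral_exp_integral [IsProbabilityMeasure Pr]
    (h : IsPoissonProcess η μ Pr) {f : E → ℂ} (hf : Measurable f) (hfi : Integrable f μ)
    {C : ℝ} (hC : ∀ x, ‖f x‖ ≤ C) :
    Integrable (fun ω => Complex.exp (∫ x, f x ∂(η ω))) Pr ∧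
    ∫ ω, Complex.exp (∫ x, f x ∂(η ω)) ∂Pr = Complex.exp (∫ x, (Complex.exp (f x) - 1) ∂μ) := by
  set g : ℕ → SimpleFunc E ℂ := fun n => SimpleFunc.approxOn f hf univ 0 (mem_univ _) n with hg
  have hgle : ∀ n x, ‖g n x‖ ≤ 2 * ‖f x‖ := fun n x => by
    rw [two_mul]; exact SimpleFunc.norm_approxOn_zero_le hf (mem_univ _) x n
  have hglim : ∀ x, Tendsto (fun n => g n x) atTop (𝓝 (f x)) := fun x =>
    SimpleFunc.tendsto_approxOn hf (mem_univ _) (by simp)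
  have hgi : ∀ (ν : Measure E), Integrable f ν → ∀ n, Integrable (g n) ν := fun ν hν n =>
    (hν.norm.const_mul 2).mono' (g n).measurable.aestronglyMeasurable
      (Eventually.of_forall (hgle n))
  -- The approximants are bounded by `2 ‖f‖`, so one exponential moment dominates all of their
  -- exponentials.
  have hdom : Integrable (fun ω => Real.exp (∫ x, 2 * ‖f x‖ ∂(η ω))) Pr :=
    h.integrable_exp_integral_of_nonneg (hf.norm.const_mul 2) (hfi.norm.const_mul 2)
      (C := 2 * C) fun x => by
        rw [Real.norm_of_nonneg (by positivity)]
        exact mul_le_mul_of_nonneg_left (hC x) two_pos.le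
  have haesm : ∀ {k : E → ℂ}, Measurable k → Integrable k μ →
      AEStronglyMeasurable (fun ω => Complex.exp (∫ x, k x ∂(η ω))) Pr := by
    intro k hk hki
    have h1 := h.aestronglyMeasurable_integral (Complex.measurable_re.comp hk) hki.re
    have h2 := h.aestronglyMeasurable_integral (Complex.measurable_im.comp hk) hki.im
    have h3 : AEStronglyMeasurable (fun ω => (((∫ x, (k x).re ∂(η ω) : ℝ) : ℂ) +
        ((∫ x, (k x).im ∂(η ω) : ℝ) : ℂ) * Complex.I)) Pr :=
      (Complex.continuous_ofReal.comp_aestronglyMeasurable h1).add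
        ((Complex.continuous_ofReal.comp_aestronglyMeasurable h2).mul_const _)
    refine Complex.continuous_exp.comp_aestronglyMeasurable (h3.congr ?_)
    filter_upwards [h.ae_integrable hk hki] with ω hω
    exact integral_re_add_im hω
  have hb : ∀ᵐ ω ∂Pr, ∀ n, ‖Complex.exp (∫ x, g n x ∂(η ω))‖ ≤
      Real.exp (∫ x, 2 * ‖f x‖ ∂(η ω)) := by
    filter_upwards [h.ae_integrable hf hfi] with ω hω n
    rw [Complex.norm_exp]
    refine Real.exp_le_exp.2 ((Complex.re_le_norm _).trans ?_)
    exact norm_integral_le_of_norm_le (hω.norm.const_mul 2) (Eventually.of_forall (hgle n))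
  have hlim : ∀ᵐ ω ∂Pr, Tendsto (fun n => Complex.exp (∫ x, g n x ∂(η ω))) atTop
      (𝓝 (Complex.exp (∫ x, f x ∂(η ω)))) := by
    filter_upwards [h.ae_integrable hf hfi] with ω hω
    refine (Complex.continuous_exp.tendsto _).comp ?_
    exact tendsto_integral_of_dominated_convergence (fun x => 2 * ‖f x‖)
      (fun n => (g n).measurable.aestronglyMeasurable) (hω.norm.const_mul 2)
      (fun n => Eventually.of_forall (hgle n)) (Eventually.of_forall hglim)
  refine ⟨hdom.mono' (haesm hf hfi) ?_, ?_⟩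
  · filter_upwards [hb, hlim] with ω h1 h2
    exact le_of_tendsto h2.norm (Eventually.of_forall h1)
  · have l1 := tendsto_integral_of_dominated_convergence _
      (fun n => haesm (g n).measurable (hgi μ hfi n)) hdom
      (fun n => by filter_upwards [hb] with ω hω using hω n) hlim
    have l2 : Tendsto (fun n => ∫ x, (Complex.exp (g n x) - 1) ∂μ) atTop
        (𝓝 (∫ x, (Complex.exp (f x) - 1) ∂μ)) := by
      refine tendsto_integral_of_dominated_convergence (fun x => 2 * ‖f x‖ * Real.exp (2 * C))
        (fun n => ?_) ((hfi.norm.const_mul 2).mul_const _)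
        (fun n => Eventually.of_forall fun x => ?_) (Eventually.of_forall fun x => ?_)
      · exact ((Complex.measurable_exp.comp (g n).measurable).sub_const 1).aestronglyMeasurable
      · exact (norm_exp_sub_one_le_mul_exp _).trans (mul_le_mul (hgle n x)
          (Real.exp_le_exp.2 ((hgle n x).trans (mul_le_mul_of_nonneg_left (hC x) two_pos.le)))
          (Real.exp_pos _).le (by positivity))
      · exact ((Complex.continuous_exp.tendsto _).comp (hglim x)).sub_const 1
    have l3 := (Complex.continuous_exp.tendsto _).comp l2
    refine tendsto_nhds_unique l1 (l3.congr fun n => ?_)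
    exact (h.integral_exp_simpleFunc (g n) (hgi μ hfi n)).symm

/-! ### Compensated integrals: exponential moments, variance and characteristic function -/

/-- The compensated integral `∫ k dη - ∫ k dμ`. -/
def compensated (η μ : Measure E) (k : E → ℝ) : ℝ := (∫ x, k x ∂η) - ∫ x, k x ∂μ

/-- The cumulant functional `∫ (exp (w k) - 1 - w k) dμ`. -/
def cumulant (μ : Measure E) (k : E → ℝ) (w : ℂ) : ℂ :=
  ∫ x, (Complex.exp (w * k x) - 1 - w * k x) ∂μ

/-- The compensator contributes `exp (-w ∫ k dμ)`, which removes the linear term of `exp (w k) - 1`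
in the exponent. What is left is of second order in `k`, so later estimates use only the sup norm
and the `L²` norm of the kernel. -/
lemma IsPoissonProcess.integral_exp_compensated [IsProbabilityMeasure Pr]
    (h : IsPoissonProcess η μ Pr) {k : E → ℝ} (hk : Measurable k) (hki : Integrable k μ)
    {C : ℝ} (hC : ∀ x, |k x| ≤ C) (w : ℂ) :
    Integrable (fun ω => Complex.exp (w * compensated (η ω) μ k)) Pr ∧
    ∫ ω, Complex.exp (w * compensated (η ω) μ k) ∂Pr = Complex.exp (cumulant μ k w) := by
  have hb : ∀ x, ‖w * (k x : ℂ)‖ ≤ ‖w‖ * C := fun x => by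
    rw [norm_mul, Complex.norm_real]
    exact mul_le_mul_of_nonneg_left (hC x) (norm_nonneg _)
  have hwi : Integrable (fun x => w * (k x : ℂ)) μ := hki.ofReal.const_mul w
  obtain ⟨h1, h2⟩ := h.integral_exp_integral (f := fun x => w * (k x : ℂ)) (by fun_prop) hwi hb
  have e : ∀ ω, Complex.exp (w * compensated (η ω) μ k) =
      Complex.exp (∫ x, w * (k x : ℂ) ∂(η ω)) * Complex.exp (-∫ x, w * (k x : ℂ) ∂μ) := by
    intro ω
    rw [← Complex.exp_add, integral_const_mul, integral_const_mul, integral_complex_ofReal,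
      integral_complex_ofReal, compensated]
    congr 1
    push_cast
    ring
  simp only [e]
  refine ⟨h1.mul_const _, ?_⟩
  rw [integral_mul_const, h2, ← Complex.exp_add, cumulant, integral_sub _ hwi, sub_eq_add_neg]
  refine (hwi.norm.mul_const (Real.exp (‖w‖ * C))).mono' (by fun_prop)
    (Eventually.of_forall fun x => ?_)
  exact (norm_exp_sub_one_le_mul_exp _).trans
    (mul_le_mul_of_nonneg_left (Real.exp_le_exp.2 (hb x)) (norm_nonneg _))

lemma norm_cumulant_integrand_le {x C : ℝ} (hC : |x| ≤ C) (w : ℂ) :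
    ‖Complex.exp (w * x) - 1 - w * x‖ ≤ ‖w‖ ^ 2 * Real.exp (‖w‖ * C) * x ^ 2 := by
  refine (norm_exp_sub_one_sub_le_mul_exp _).trans ?_
  rw [norm_mul, Complex.norm_real, Real.norm_eq_abs, mul_pow, sq_abs]
  have := Real.exp_le_exp.2 (mul_le_mul_of_nonneg_left hC (norm_nonneg w))
  calc ‖w‖ ^ 2 * x ^ 2 * Real.exp (‖w‖ * |x|) ≤ ‖w‖ ^ 2 * x ^ 2 * Real.exp (‖w‖ * C) :=
        mul_le_mul_of_nonneg_left this (by positivity)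
    _ = _ := by ring

lemma norm_cumulant_le {k : E → ℝ} (hk2 : Integrable (fun x => k x ^ 2) μ) {C : ℝ}
    (hC : ∀ x, |k x| ≤ C) (w : ℂ) :
    ‖cumulant μ k w‖ ≤ ‖w‖ ^ 2 * Real.exp (‖w‖ * C) * ∫ x, k x ^ 2 ∂μ := by
  rw [← integral_const_mul]
  exact norm_integral_le_of_norm_le (hk2.const_mul _)
    (Eventually.of_forall fun x => norm_cumulant_integrand_le (hC x) w)

lemma IsPoissonProcess.aestronglyMeasurable_compensated [IsProbabilityMeasure Pr]
    (h : IsPoissonProcess η μ Pr) {k : E → ℝ} (hk : Measurable k) (hki : Integrable k μ) :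
    AEStronglyMeasurable (fun ω => compensated (η ω) μ k) Pr :=
  (h.aestronglyMeasurable_integral hk hki).sub aestronglyMeasurable_const

/-- At a real argument the exponential formula computes an honest moment, and the cumulant is
quadratic in `k`. The arguments `1` and `-1` together control `exp |·|`. -/
lemma IsPoissonProcess.integral_real_exp_compensated_le [IsProbabilityMeasure Pr]
    (h : IsPoissonProcess η μ Pr) {k : E → ℝ} (hk : Measurable k) (hki : Integrable k μ)
    (hk2 : Integrable (fun x => k x ^ 2) μ) {C : ℝ} (hC : ∀ x, |k x| ≤ C) {r : ℝ}
    (hr : |r| = 1) :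
    Integrable (fun ω => Real.exp (r * compensated (η ω) μ k)) Pr ∧
    ∫ ω, Real.exp (r * compensated (η ω) μ k) ∂Pr ≤
      Real.exp (Real.exp C * ∫ x, k x ^ 2 ∂μ) := by
  obtain ⟨h1, h2⟩ := h.integral_exp_compensated hk hki hC (r : ℂ)
  have e : ∀ ω, Complex.exp (r * compensated (η ω) μ k) =
      ((Real.exp (r * compensated (η ω) μ k) : ℝ) : ℂ) := fun ω => by push_cast; rfl
  simp only [e] at h1 h2
  refine ⟨h1.re, ?_⟩
  rw [integral_complex_ofReal] at h2
  have h3 := congrArg norm h2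
  rw [Complex.norm_real, Complex.norm_exp] at h3
  refine (le_abs_self _).trans (h3.le.trans (Real.exp_le_exp.2 ?_))
  refine (Complex.re_le_norm _).trans ((norm_cumulant_le hk2 hC _).trans ?_)
  simp [hr]

lemma IsPoissonProcess.integral_exp_abs_compensated_le [IsProbabilityMeasure Pr]
    (h : IsPoissonProcess η μ Pr) {k : E → ℝ} (hk : Measurable k) (hki : Integrable k μ)
    (hk2 : Integrable (fun x => k x ^ 2) μ) {C : ℝ} (hC : ∀ x, |k x| ≤ C) :
    Integrable (fun ω => Real.exp |compensated (η ω) μ k|) Pr ∧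
    ∫ ω, Real.exp |compensated (η ω) μ k| ∂Pr ≤
      2 * Real.exp (Real.exp C * ∫ x, k x ^ 2 ∂μ) := by
  obtain ⟨a1, a2⟩ := h.integral_real_exp_compensated_le hk hki hk2 hC (r := 1) (by simp)
  obtain ⟨b1, b2⟩ := h.integral_real_exp_compensated_le hk hki hk2 hC (r := -1) (by simp)
  have hle : ∀ ω, Real.exp |compensated (η ω) μ k| ≤
      Real.exp (1 * compensated (η ω) μ k) + Real.exp (-1 * compensated (η ω) μ k) := by
    intro ω
    rcases abs_cases (compensated (η ω) μ k) with hx | hx <;> rw [hx.1]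
    · rw [one_mul]; exact le_add_of_nonneg_right (Real.exp_pos _).le
    · rw [neg_one_mul]; exact le_add_of_nonneg_left (Real.exp_pos _).le
  have hi : Integrable (fun ω => Real.exp |compensated (η ω) μ k|) Pr := by
    refine (a1.add b1).mono' ?_ (Eventually.of_forall fun ω => ?_)
    · exact (Real.continuous_exp.comp continuous_abs).comp_aestronglyMeasurable
        (h.aestronglyMeasurable_compensated hk hki)
    · rw [Real.norm_of_nonneg (Real.exp_pos _).le]; exact hle ω
  refine ⟨hi, (integral_mono hi (a1.add b1) hle).trans ?_⟩
  rw [integral_add' a1 b1, two_mul]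
  exact add_le_add a2 b2

/-- The right-hand side is `2 cosh x - 2 = 4 sinh² (x / 2)`, and `|sinh y| ≥ |y|`. -/
lemma sq_le_exp_add_exp_neg (x : ℝ) : x ^ 2 ≤ Real.exp (1 * x) + Real.exp (-1 * x) - 2 := by
  have h := Real.cosh_sq' (x / 2)
  have h2 := Real.cosh_two_mul (x / 2)
  have h3 : |x / 2| ≤ |Real.sinh (x / 2)| := by
    rw [Real.abs_sinh]; exact Real.self_le_sinh_iff.2 (abs_nonneg _)
  have h4 := sq_le_sq.2 h3
  rw [Real.cosh_eq] at h2
  have e : 2 * (x / 2) = x := by ring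
  rw [e] at h2
  rw [one_mul, neg_one_mul]
  nlinarith

/-- The value of the bound at a zero kernel is `0`, so for a fixed sup bound a small `L²` norm of
`k` makes the second moment small. This replaces the exact variance formula in the Cauchy estimate
for the truncated convolutions. -/
lemma IsPoissonProcess.integral_sq_compensated_le [IsProbabilityMeasure Pr]
    (h : IsPoissonProcess η μ Pr) {k : E → ℝ} (hk : Measurable k) (hki : Integrable k μ)
    (hk2 : Integrable (fun x => k x ^ 2) μ) {C : ℝ} (hC : ∀ x, |k x| ≤ C) :
    Integrable (fun ω => compensated (η ω) μ k ^ 2) Pr ∧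
    ∫ ω, compensated (η ω) μ k ^ 2 ∂Pr ≤
      2 * Real.exp (Real.exp C * ∫ x, k x ^ 2 ∂μ) - 2 := by
  obtain ⟨a1, a2⟩ := h.integral_real_exp_compensated_le hk hki hk2 hC (r := 1) (by simp)
  obtain ⟨b1, b2⟩ := h.integral_real_exp_compensated_le hk hki hk2 hC (r := -1) (by simp)
  have hs := (a1.add b1).sub (integrable_const (2 : ℝ))
  have hi : Integrable (fun ω => compensated (η ω) μ k ^ 2) Pr := by
    refine hs.mono' ((h.aestronglyMeasurable_compensated hk hki).pow 2)
      (Eventually.of_forall fun ω => ?_)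
    rw [Real.norm_of_nonneg (sq_nonneg _)]; exact sq_le_exp_add_exp_neg _
  refine ⟨hi, (integral_mono hi hs fun ω => sq_le_exp_add_exp_neg _).trans ?_⟩
  rw [integral_sub' (a1.add b1) (integrable_const _), integral_add' a1 b1]
  simp only [integral_const, probReal_univ, smul_eq_mul, one_mul]
  simp only [one_mul] at a2
  linarith

lemma IsPoissonProcess.charFun_compensated [IsProbabilityMeasure Pr]
    (h : IsPoissonProcess η μ Pr) {k : E → ℝ} (hk : Measurable k) (hki : Integrable k μ)
    {C : ℝ} (hC : ∀ x, |k x| ≤ C) (l : ℝ) :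
    charFun (Pr.map fun ω => compensated (η ω) μ k) l =
      Complex.exp (cumulant μ k (l * Complex.I)) := by
  rw [← (h.integral_exp_compensated hk hki hC (l * Complex.I)).2, charFun_apply_real,
    integral_map (h.aestronglyMeasurable_compensated hk hki).aemeasurable (by fun_prop)]
  refine integral_congr_ae (Eventually.of_forall fun ω => ?_)
  dsimp only
  congr 1
  ring

end Poisson

/-! ### Convolution of a kernel with a Poisson shot noise -/

section Noise

variable {Ω G : Type*} [MeasurableSpace Ω] [MeasurableSpace G] [AddCommGroup G] [MeasurableAdd₂ G]
  [MeasurableNeg G] {η : Ω → Measure G} {μ : Measure G} {Pr : Measure Ω}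

/-- The kernel `u ↦ ∫ f(y) τ(y - u) dy` against which a Poisson process is integrated when the
shot noise with profile `τ` is tested against `f`. -/
def noiseKernel (μ : Measure G) (f τ : G → ℝ) (u : G) : ℝ := ∫ y, f y * τ (y - u) ∂μ

variable {f τ : G → ℝ}

lemma measurable_mul_comp_sub (hf : Measurable f) (hτ : Measurable τ) :
    Measurable fun p : G × G => f p.2 * τ (p.2 - p.1) := by
  simp only [sub_eq_add_neg]
  fun_prop

lemma integrable_mul_comp_sub [SFinite μ] [μ.IsAddLeftInvariant] [μ.IsNegInvariant]
    (hf : Measurable f) (hτ : Measurable τ) (hfi : Integrable f μ) (hτi : Integrable τ μ) :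
    Integrable (fun p : G × G => f p.2 * τ (p.2 - p.1)) (μ.prod μ) := by
  rw [integrable_prod_iff' (measurable_mul_comp_sub hf hτ).aestronglyMeasurable]
  refine ⟨Eventually.of_forall fun y => (hτi.comp_sub_left y).const_mul (f y), ?_⟩
  have : ∀ y, ∫ u, ‖f y * τ (y - u)‖ ∂μ = ‖f y‖ * ∫ u, ‖τ u‖ ∂μ := by
    intro y
    simp only [norm_mul]
    rw [integral_const_mul, integral_sub_left_eq_self (fun u => ‖τ u‖) μ y]
  simp only [this]
  exact hfi.norm.mul_const _

lemma integrable_noiseKernel [SFinite μ] [μ.IsAddLeftInvariant] [μ.IsNegInvariant]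
    (hf : Measurable f) (hτ : Measurable τ) (hfi : Integrable f μ) (hτi : Integrable τ μ) :
    Integrable (noiseKernel μ f τ) μ :=
  (integrable_mul_comp_sub hf hτ hfi hτi).integral_prod_left

/-- Since the profile `τ` has mass one, the constant `-1` in the shot noise is exactly the
compensator of the resulting kernel. -/
lemma integral_noiseKernel [SFinite μ] [μ.IsAddLeftInvariant] [μ.IsNegInvariant]
    (hf : Measurable f) (hτ : Measurable τ) (hfi : Integrable f μ) (hτi : Integrable τ μ)
    (hτ1 : ∫ u, τ u ∂μ = 1) :
    ∫ u, noiseKernel μ f τ u ∂μ = ∫ y, f y ∂μ := by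
  simp only [noiseKernel]
  rw [integral_integral_swap (integrable_mul_comp_sub hf hτ hfi hτi)]
  refine integral_congr_ae (Eventually.of_forall fun y => ?_)
  dsimp only
  rw [integral_const_mul, integral_sub_left_eq_self τ μ y, hτ1, mul_one]

/-- Testing the shot noise against an integrable kernel gives a compensated Poisson integral. -/
lemma IsPoissonProcess.ae_integral_mul_noise [IsProbabilityMeasure Pr] [SFinite μ]
    [μ.IsAddLeftInvariant] [μ.IsNegInvariant] (h : IsPoissonProcess η μ Pr)
    (hf : Measurable f) (hτ : Measurable τ) (hfi : Integrable f μ) (hτi : Integrable τ μ)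
    (hτ1 : ∫ u, τ u ∂μ = 1) :
    ∀ᵐ ω ∂Pr, Integrable (fun y => f y * ((∫ u, τ (y - u) ∂(η ω)) - 1)) μ ∧
      ∫ y, f y * ((∫ u, τ (y - u) ∂(η ω)) - 1) ∂μ =
        compensated (η ω) μ (noiseKernel μ f τ) := by
  have hm := measurable_mul_comp_sub hf hτ
  have hmH : Measurable fun u => ∫⁻ y, ‖f y * τ (y - u)‖ₑ ∂μ := hm.enorm.lintegral_prod_right'
  -- Through Campbell's formula this makes the double integral against `η × μ` absolutely convergent
  -- almost surely, which justifies Fubini for the random measure below.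
  have hH : ∫⁻ u, ∫⁻ y, ‖f y * τ (y - u)‖ₑ ∂μ ∂μ ≠ ∞ := by
    rw [← lintegral_prod (fun p : G × G => ‖f p.2 * τ (p.2 - p.1)‖ₑ) hm.enorm.aemeasurable]
    exact (integrable_mul_comp_sub hf hτ hfi hτi).2.ne
  filter_upwards [h.ae_lintegral_lt_top hmH hH] with ω hω
  have := h.sigmaFinite ω
  have hi : Integrable (fun p : G × G => f p.2 * τ (p.2 - p.1)) ((η ω).prod μ) := by
    refine ⟨hm.aestronglyMeasurable, ?_⟩
    rw [HasFiniteIntegral, lintegral_prod _ hm.enorm.aemeasurable]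
    exact hω
  have hi2 : Integrable (fun y => f y * ∫ u, τ (y - u) ∂(η ω)) μ := by
    have := hi.integral_prod_right
    simpa only [integral_const_mul] using this
  simp only [mul_sub, mul_one]
  refine ⟨hi2.sub hfi, ?_⟩
  rw [integral_sub hi2 hfi, compensated, integral_noiseKernel hf hτ hfi hτi hτ1]
  congr 1
  simp only [noiseKernel]
  rw [integral_integral_swap hi]
  simp only [integral_const_mul]

end Noise

/-! ### Limit theorems -/

/-- Dominated convergence with a convergent sequence of bounds (Pratt's lemma). -/
lemma tendsto_integral_of_tendsto_bound {α : Type*} [MeasurableSpace α] {μ : Measure α}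
    {h : ℕ → α → ℂ} {h₀ : α → ℂ} {g : ℕ → α → ℝ} {g₀ : α → ℝ}
    (hm : ∀ n, AEStronglyMeasurable (h n) μ)
    (hgi : ∀ n, Integrable (g n) μ) (hgi₀ : Integrable g₀ μ)
    (hb : ∀ n, ∀ᵐ x ∂μ, ‖h n x‖ ≤ g n x)
    (hlim : ∀ᵐ x ∂μ, Tendsto (fun n => h n x) atTop (𝓝 (h₀ x)))
    (hglim : ∀ᵐ x ∂μ, Tendsto (fun n => g n x) atTop (𝓝 (g₀ x)))
    (hgint : Tendsto (fun n => ∫ x, g n x ∂μ) atTop (𝓝 (∫ x, g₀ x ∂μ))) :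
    Tendsto (fun n => ∫ x, h n x ∂μ) atTop (𝓝 (∫ x, h₀ x ∂μ)) := by
  have hball : ∀ᵐ x ∂μ, ∀ n, ‖h n x‖ ≤ g n x := ae_all_iff.2 hb
  have hb₀ : ∀ᵐ x ∂μ, ‖h₀ x‖ ≤ g₀ x := by
    filter_upwards [hball, hlim, hglim] with x h1 h2 h3
    exact le_of_tendsto_of_tendsto h2.norm h3 (Eventually.of_forall h1)
  have hm₀ : AEStronglyMeasurable h₀ μ := aestronglyMeasurable_of_tendsto_ae atTop hm hlim
  have hi : ∀ n, Integrable (h n) μ := fun n => (hgi n).mono' (hm n) (hb n)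
  have hi₀ : Integrable h₀ μ := hgi₀.mono' hm₀ hb₀
  -- the excess `g n + g₀ - ‖h n - h₀‖ ≥ 0` tends to `2 g₀`; truncate it at `2 g₀`
  have hd : ∀ n, Integrable (fun x => ‖h n x - h₀ x‖) μ := fun n => ((hi n).sub hi₀).norm
  have hex : ∀ n, Integrable (fun x => g n x + g₀ x - ‖h n x - h₀ x‖) μ := fun n =>
    ((hgi n).add hgi₀).sub (hd n)
  have h2g : Integrable (fun x => 2 * g₀ x) μ := hgi₀.const_mul 2
  have hmin : Tendsto (fun n => ∫ x, min (g n x + g₀ x - ‖h n x - h₀ x‖) (2 * g₀ x) ∂μ) atTop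
      (𝓝 (∫ x, 2 * g₀ x ∂μ)) := by
    refine tendsto_integral_of_dominated_convergence (fun x => 2 * g₀ x)
      (fun n => ((hex n).inf h2g).1) h2g (fun n => ?_) ?_
    · filter_upwards [hball, hb₀] with x h1 h2
      have hg0 : 0 ≤ g₀ x := (norm_nonneg _).trans h2
      rw [Real.norm_of_nonneg]
      · exact min_le_right _ _
      · refine le_min ?_ (by positivity)
        have := norm_sub_le (h n x) (h₀ x)
        linarith [h1 n]
    · filter_upwards [hlim, hglim] with x h1 h2
      have h3 : Tendsto (fun n => g n x + g₀ x - ‖h n x - h₀ x‖) atTop (𝓝 (2 * g₀ x)) := by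
        have := (h2.add_const (g₀ x)).sub ((h1.sub_const (h₀ x)).norm)
        simpa [two_mul] using this
      simpa using h3.min (tendsto_const_nhds (x := 2 * g₀ x))
  -- Truncating the excess only lowers its integral, and the truncated integral already converges to
  -- `2 ∫ g₀`; the `L¹` distance is squeezed to zero.
  have hup : ∀ n, ∫ x, ‖h n x - h₀ x‖ ∂μ ≤ (∫ x, g n x ∂μ) + (∫ x, g₀ x ∂μ) -
      ∫ x, min (g n x + g₀ x - ‖h n x - h₀ x‖) (2 * g₀ x) ∂μ := by
    intro n
    have e : ∫ x, (g n x + g₀ x - ‖h n x - h₀ x‖) ∂μ =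
        (∫ x, g n x ∂μ) + (∫ x, g₀ x ∂μ) - ∫ x, ‖h n x - h₀ x‖ ∂μ := by
      rw [← integral_add (hgi n) hgi₀]
      exact integral_sub ((hgi n).add hgi₀) (hd n)
    have := integral_mono ((hex n).inf h2g) (hex n) fun x => min_le_left _ _
    simp only [Pi.inf_apply] at this
    have h' : ∫ x, min (g n x + g₀ x - ‖h n x - h₀ x‖) (2 * g₀ x) ∂μ ≤
      ∫ x, (g n x + g₀ x - ‖h n x - h₀ x‖) ∂μ := this
    linarith
  refine tendsto_integral_of_L1 h₀ hi₀.1 (Eventually.of_forall hi) ?_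
  have hr : Tendsto (fun n => ∫ x, ‖h n x - h₀ x‖ ∂μ) atTop (𝓝 0) := by
    refine squeeze_zero (fun n => integral_nonneg fun x => norm_nonneg _) hup ?_
    have := (hgint.add_const (∫ x, g₀ x ∂μ)).sub hmin
    rw [integral_const_mul, two_mul, sub_self] at this
    exact this
  have := (ENNReal.continuous_ofReal.tendsto _).comp hr
  rw [ENNReal.ofReal_zero] at this
  refine this.congr fun n => ?_
  dsimp only [Function.comp]
  rw [ofReal_integral_eq_lintegral_ofReal (hd n) (Eventually.of_forall fun x => norm_nonneg _)]
  exact lintegral_congr fun x => ofReal_norm _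

/-- Convergence of expectations of continuous functions of exponential growth. -/
lemma tendsto_integral_of_tendsto_charFun {ν : ℕ → Measure ℝ} {ν₀ : Measure ℝ}
    [∀ n, IsProbabilityMeasure (ν n)] [IsProbabilityMeasure ν₀]
    (hchar : ∀ l, Tendsto (fun n => charFun (ν n) l) atTop (𝓝 (charFun ν₀ l)))
    {B : ℝ} (hi : ∀ n, Integrable (fun x => Real.exp |x|) (ν n))
    (hB : ∀ n, ∫ x, Real.exp |x| ∂(ν n) ≤ B)
    (hi₀ : Integrable (fun x => Real.exp |x|) ν₀)
    {g : ℝ → ℝ} (hg : Continuous g) {A : ℝ} (hA : ∀ x, g x ^ 2 ≤ A * Real.exp |x|) :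
    Tendsto (fun n => ∫ x, g x ∂(ν n)) atTop (𝓝 (∫ x, g x ∂ν₀)) := by
  have hA0 : 0 ≤ A := by
    have := (sq_nonneg _).trans (hA 0)
    simpa using this
  let m : ℕ → ProbabilityMeasure ℝ := fun n => ⟨ν n, inferInstance⟩
  let m₀ : ProbabilityMeasure ℝ := ⟨ν₀, inferInstance⟩
  have hweak : ∀ f : BoundedContinuousFunction ℝ ℝ,
      Tendsto (fun n => ∫ x, f x ∂(ν n)) atTop (𝓝 (∫ x, f x ∂ν₀)) :=
    ProbabilityMeasure.tendsto_iff_forall_integral_tendsto.1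
      (ProbabilityMeasure.tendsto_of_tendsto_charFun (μ := m) (μ₀ := m₀) hchar)
  have hgi : ∀ (m : Measure ℝ) [IsProbabilityMeasure m], Integrable (fun x => Real.exp |x|) m →
      Integrable g m := by
    intro m _ hm
    refine ((integrable_const (1 : ℝ)).add (hm.const_mul A)).mono' hg.aestronglyMeasurable
      (Eventually.of_forall fun x => ?_)
    have := hA x
    rw [Real.norm_eq_abs, ← sq_abs] at *
    simp only [Pi.add_apply]
    nlinarith [sq_nonneg (|g x| - 1)]
  set B' := max B (∫ x, Real.exp |x| ∂ν₀) with hB'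
  have hB'0 : 0 ≤ B' := le_max_of_le_right (integral_nonneg fun x => (Real.exp_pos _).le)
  -- Clipping `g` at height `R` changes it only where `|g| > R`, and there by at most `|g| ≤ g² /
  -- R`. This is why the growth condition is imposed on `g²`: the truncation error is `O(1 / R)`
  -- uniformly over the measures.
  have htrunc : ∀ R : ℝ, 0 < R → ∀ x, |g x - max (-R) (min (g x) R)| ≤
      A / R * Real.exp |x| := by
    intro R hR x
    have h1 : |g x - max (-R) (min (g x) R)| ≤ g x ^ 2 / R := by
      rw [le_div_iff₀ hR]
      rcases le_total (g x) R with h2 | h2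
      · rw [min_eq_left h2]
        rcases le_total (-R) (g x) with h3 | h3
        · rw [max_eq_right h3]; simp [sq_nonneg]
        · rw [max_eq_left h3, abs_of_nonpos (by linarith)]; nlinarith
      · rw [min_eq_right h2, max_eq_right (by linarith), abs_of_nonneg (by linarith)]; nlinarith
    refine h1.trans ?_
    rw [div_mul_eq_mul_div]
    exact div_le_div_of_nonneg_right (hA x) hR.le
  rw [Metric.tendsto_atTop]
  intro e he
  obtain ⟨R, hR, hRe⟩ : ∃ R : ℝ, 0 < R ∧ A / R * B' < e / 3 := by
    refine ⟨3 * (A * B' + 1) / e, by positivity, ?_⟩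
    rw [div_mul_eq_mul_div, div_lt_iff₀ (by positivity)]
    have : e / 3 * (3 * (A * B' + 1) / e) = A * B' + 1 := by field_simp
    rw [this]; linarith
  set gR : BoundedContinuousFunction ℝ ℝ :=
    BoundedContinuousFunction.ofNormedAddCommGroup (fun x => max (-R) (min (g x) R))
      (by fun_prop) R (fun x => by
        rw [Real.norm_eq_abs, abs_le]
        exact ⟨le_max_left _ _, max_le (by linarith) (min_le_right _ _)⟩) with hgR
  have hclose : ∀ (m : Measure ℝ) [IsProbabilityMeasure m], Integrable (fun x => Real.exp |x|) m →
      ∫ x, Real.exp |x| ∂m ≤ B' → |(∫ x, g x ∂m) - ∫ x, gR x ∂m| < e / 3 := by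
    intro m _ hm hmB
    rw [← integral_sub (hgi m hm) (gR.integrable m), ← Real.norm_eq_abs]
    refine lt_of_le_of_lt (norm_integral_le_of_norm_le (hm.const_mul (A / R))
      (Eventually.of_forall (htrunc R hR))) ?_
    rw [integral_const_mul]
    exact lt_of_le_of_lt (mul_le_mul_of_nonneg_left hmB (by positivity)) hRe
  obtain ⟨N, hN⟩ := Metric.tendsto_atTop.1 (hweak gR) (e / 3) (by positivity)
  refine ⟨N, fun n hn => ?_⟩
  have a1 := hclose (ν n) (hi n) ((hB n).trans (le_max_left _ _))
  have a2 := hclose ν₀ hi₀ (le_max_right _ _)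
  have a3 := hN n hn
  rw [Real.dist_eq] at a3 ⊢
  rw [abs_lt] at *
  constructor <;> linarith [a1.1, a1.2, a2.1, a2.2, a3.1, a3.2]

/-! ### Bounds on the symbol -/

/-- A polynomial is bounded by any positive polynomial of at least the same degree. -/
lemma exists_abs_eval_le_mul_eval {P R : Polynomial ℝ} (hR : ∀ x, 0 < R.eval x)
    (hdeg : P.natDegree ≤ R.natDegree) : ∃ A : ℝ, 0 < A ∧ ∀ x, |P.eval x| ≤ A * R.eval x := by
  have hright : ∀ P R : Polynomial ℝ, (∀ x, 0 < R.eval x) → P.natDegree ≤ R.natDegree →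
      ∃ A : ℝ, 0 < A ∧ ∀ x, 0 ≤ x → |P.eval x| ≤ A * R.eval x := by
    intro P R hR hdeg
    have hR0 : R ≠ 0 := fun h => by simpa [h] using hR 0
    -- The degree comparison handles large `x`; on the remaining compact interval the continuous
    -- quotient is bounded because `R` has no zero.
    have hO : (fun x => P.eval x) =O[atTop] fun x => R.eval x := by
      refine Polynomial.isBigO_atTop_of_degree_le P R ?_
      rw [Polynomial.degree_eq_natDegree hR0]
      exact Polynomial.natDegree_le_iff_degree_le.1 hdeg
    obtain ⟨A₁, hA₁, h₁⟩ := hO.exists_pos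
    rw [Asymptotics.isBigOWith_iff, eventually_atTop] at h₁
    obtain ⟨N, hN⟩ := h₁
    have hcont : ContinuousOn (fun x => |P.eval x| / R.eval x) (Icc 0 N) :=
      (P.continuous.abs.div R.continuous fun x => (hR x).ne').continuousOn
    obtain ⟨A₂, hA₂⟩ := (isCompact_Icc.image_of_continuousOn hcont).bddAbove
    refine ⟨max A₁ A₂, lt_max_of_lt_left hA₁, fun x hx => ?_⟩
    rcases le_total N x with h | h
    · have := hN x h
      rw [Real.norm_eq_abs, Real.norm_of_nonneg (hR x).le] at this
      exact this.trans (mul_le_mul_of_nonneg_right (le_max_left _ _) (hR x).le)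
    · have := hA₂ ⟨x, ⟨hx, h⟩, rfl⟩
      rw [← div_le_iff₀ (hR x)]
      exact this.trans (le_max_right _ _)
  obtain ⟨A₁, h₁, h₁'⟩ := hright P R hR hdeg
  -- Negative arguments follow by reflecting both polynomials.
  obtain ⟨A₂, h₂, h₂'⟩ := hright (P.comp (-Polynomial.X)) (R.comp (-Polynomial.X))
    (fun x => by simpa using hR (-x)) (by simpa [Polynomial.natDegree_comp] using hdeg)
  refine ⟨max A₁ A₂, lt_max_of_lt_left h₁, fun x => ?_⟩
  rcases le_total 0 x with h | h
  · exact (h₁' x h).trans (mul_le_mul_of_nonneg_right (le_max_left _ _) (hR x).le)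
  · have := h₂' (-x) (by linarith)
    simp only [Polynomial.eval_comp, Polynomial.eval_neg, Polynomial.eval_X, neg_neg] at this
    exact this.trans (mul_le_mul_of_nonneg_right (le_max_right _ _) (hR x).le)

/-- The symbol as a function of the frequency `k`, where `e^{2πikx}` is the Fourier mode. -/
def symbol (Q : Polynomial ℝ) (k : ℝ) : ℝ := Q.eval (2 * Real.pi * k)

lemma continuous_symbol (Q : Polynomial ℝ) : Continuous (symbol Q) := by
  unfold symbol; fun_prop

lemma SmoothingAssumption.symbol_neg {Q : Polynomial ℝ} (hQ : SmoothingAssumption Q) (k : ℝ) :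
    symbol Q (-k) = symbol Q k := by
  simp only [symbol, mul_neg, hQ.even]

/-- The symbol has a zero of order exactly two at the origin: the linear coefficient vanishes at a
minimum and the quadratic one does not. Dividing by `X ^ 2` leaves a strictly positive `R` of degree
at least `2`, hence bounded below by a multiple of `1 + k²`. The derivative bounds come from `P' = X
(2R + X R')` and `P'' = 2R + 4 X R' + X² R''`, where no bracket exceeds the degree of `R`. -/
lemma SmoothingAssumption.exists_factor {Q : Polynomial ℝ} (hQ : SmoothingAssumption Q) :
    ∃ P R : Polynomial ℝ, (∀ k, P.eval k = symbol Q k) ∧ P = Polynomial.X ^ 2 * R ∧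
      ∃ c > 0, ∃ A > 0, (∀ k, c * (1 + k ^ 2) ≤ R.eval k) ∧
      (∀ k, |P.derivative.eval k| ≤ A * (|k| * R.eval k)) ∧
      ∀ k, |P.derivative.derivative.eval k| ≤ A * R.eval k := by
  obtain ⟨n, hn, hdeg⟩ := hQ.degree
  have hpi : (2 * Real.pi) ≠ 0 := by positivity
  set P : Polynomial ℝ := Q.comp (Polynomial.C (2 * Real.pi) * Polynomial.X) with hP
  have hPe : ∀ k, P.eval k = symbol Q k := fun k => by simp [hP, symbol]
  have hPpos : ∀ k, k ≠ 0 → 0 < P.eval k := fun k hk => by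
    rw [hPe]; exact hQ.eval_pos _ (mul_ne_zero hpi hk)
  have hP0 : P.eval 0 = 0 := by rw [hPe, symbol, mul_zero, hQ.eval_zero]
  have hPdeg : P.natDegree = 2 * n := by
    rw [hP, Polynomial.natDegree_comp, hdeg, Polynomial.natDegree_C_mul_X _ hpi, mul_one]
  have hP1 : P.coeff 1 = 0 := by
    have hmin : IsLocalMin (fun x => P.eval x) 0 := Eventually.of_forall fun x => by
      dsimp only
      rw [hP0]
      by_cases h : x = 0
      · rw [h, hP0]
      · exact (hPpos x h).le
    have := hmin.deriv_eq_zero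
    rw [Polynomial.deriv, ← Polynomial.coeff_zero_eq_eval_zero, Polynomial.coeff_derivative] at this
    simpa using this
  have hP2 : P.coeff 2 ≠ 0 := by
    rw [hP, Polynomial.comp_C_mul_X_coeff, hQ.coeff_two, one_mul]
    positivity
  obtain ⟨R, hR⟩ : Polynomial.X ^ 2 ∣ P := by
    rw [Polynomial.X_pow_dvd_iff]
    intro d hd
    interval_cases d
    · rw [Polynomial.coeff_zero_eq_eval_zero, hP0]
    · exact hP1
  have hR0 : R.eval 0 ≠ 0 := by
    rw [← Polynomial.coeff_zero_eq_eval_zero]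
    rw [hR, Polynomial.coeff_X_pow_mul'] at hP2
    simpa using hP2
  have hRne : R ≠ 0 := fun h => hR0 (by simp [h])
  have hRpos' : ∀ k, k ≠ 0 → 0 < R.eval k := fun k hk => by
    have := hPpos k hk
    rw [hR, Polynomial.eval_mul, Polynomial.eval_pow, Polynomial.eval_X] at this
    exact pos_of_mul_pos_right this (by positivity)
  have hRpos : ∀ k, 0 < R.eval k := by
    intro k
    by_cases hk : k = 0
    · subst hk
      refine lt_of_le_of_ne ?_ hR0.symm
      have h1 : Tendsto (fun x => R.eval x) (𝓝[≠] 0) (𝓝 (R.eval 0)) :=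
        R.continuous.continuousAt.mono_left nhdsWithin_le_nhds
      exact ge_of_tendsto h1 (eventually_mem_nhdsWithin.mono fun x hx => (hRpos' x hx).le)
    · exact hRpos' k hk
  have hRdeg : R.natDegree + 2 = 2 * n := by
    rw [← hPdeg, hR, Polynomial.natDegree_mul (by simp) hRne]
    simp [add_comm]
  obtain ⟨A₁, hA₁, h₁⟩ := exists_abs_eval_le_mul_eval (P := 1 + Polynomial.X ^ 2) hRpos (by
    have : (1 + Polynomial.X ^ 2 : Polynomial ℝ).natDegree ≤ 2 := by compute_degree
    omega)
  have hd1 : R.derivative.natDegree ≤ R.natDegree - 1 := Polynomial.natDegree_derivative_le R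
  have hd2 : R.derivative.derivative.natDegree ≤ R.natDegree - 1 - 1 :=
    (Polynomial.natDegree_derivative_le _).trans (by omega)
  have hX1 : (Polynomial.X * R.derivative).natDegree ≤ R.natDegree :=
    Polynomial.natDegree_mul_le.trans (by rw [Polynomial.natDegree_X]; omega)
  have hX2 : (Polynomial.X ^ 2 * R.derivative.derivative).natDegree ≤ R.natDegree :=
    Polynomial.natDegree_mul_le.trans (by rw [Polynomial.natDegree_X_pow]; omega)
  have hC : ∀ a : ℝ, (Polynomial.C a * R).natDegree ≤ R.natDegree :=
    fun a => Polynomial.natDegree_C_mul_le a R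
  have e1 : P.derivative = Polynomial.X * (Polynomial.C 2 * R + Polynomial.X * R.derivative) := by
    rw [hR, Polynomial.derivative_mul, Polynomial.derivative_X_pow]
    simp only [Nat.cast_ofNat, Nat.add_one_sub_one, pow_one]
    ring
  have e2 : P.derivative.derivative = Polynomial.C 2 * R +
      (Polynomial.C 4 * (Polynomial.X * R.derivative) +
        Polynomial.X ^ 2 * R.derivative.derivative) := by
    rw [e1]
    simp only [Polynomial.derivative_mul, Polynomial.derivative_add, Polynomial.derivative_X,
      Polynomial.derivative_C]
    rw [map_ofNat Polynomial.C 4, map_ofNat Polynomial.C 2]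
    ring
  obtain ⟨A₂, hA₂, h₂⟩ := exists_abs_eval_le_mul_eval
    (P := Polynomial.C 2 * R + Polynomial.X * R.derivative) hRpos
    ((Polynomial.natDegree_add_le _ _).trans (max_le (hC 2) hX1))
  obtain ⟨A₃, hA₃, h₃⟩ := exists_abs_eval_le_mul_eval (P := P.derivative.derivative) hRpos (by
    rw [e2]
    exact (Polynomial.natDegree_add_le _ _).trans (max_le (hC 2)
      ((Polynomial.natDegree_add_le _ _).trans (max_le
        ((Polynomial.natDegree_C_mul_le _ _).trans hX1) hX2))))
  refine ⟨P, R, hPe, hR, A₁⁻¹, inv_pos.2 hA₁, max A₂ A₃, lt_max_of_lt_left hA₂,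
    fun k => ?_, fun k => ?_, fun k => ?_⟩
  · have := h₁ k
    rw [inv_mul_le_iff₀ hA₁]
    simp only [Polynomial.eval_add, Polynomial.eval_one, Polynomial.eval_pow,
      Polynomial.eval_X] at this
    exact (le_abs_self _).trans this
  · rw [e1, Polynomial.eval_mul, Polynomial.eval_X, abs_mul]
    calc |k| * _ ≤ |k| * (A₂ * R.eval k) := mul_le_mul_of_nonneg_left (h₂ k) (abs_nonneg _)
      _ = A₂ * (|k| * R.eval k) := by ring
      _ ≤ _ := mul_le_mul_of_nonneg_right (le_max_left _ _)
        (mul_nonneg (abs_nonneg _) (hRpos k).le)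
  · exact (h₃ k).trans (mul_le_mul_of_nonneg_right (le_max_right _ _) (hRpos k).le)

lemma SmoothingAssumption.symbol_lower_bound {Q : Polynomial ℝ} (hQ : SmoothingAssumption Q) :
    ∃ c > 0, ∀ k, c * (k ^ 2 * (1 + k ^ 2)) ≤ symbol Q k := by
  obtain ⟨P, R, hP, hPR, c, hc, -, -, h, -⟩ := hQ.exists_factor
  refine ⟨c, hc, fun k => ?_⟩
  rw [← hP, hPR, Polynomial.eval_mul, Polynomial.eval_pow, Polynomial.eval_X]
  calc c * (k ^ 2 * (1 + k ^ 2)) = k ^ 2 * (c * (1 + k ^ 2)) := by ring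
    _ ≤ _ := mul_le_mul_of_nonneg_left (h k) (by positivity)

lemma SmoothingAssumption.symbol_nonneg {Q : Polynomial ℝ} (hQ : SmoothingAssumption Q) (k : ℝ) :
    0 ≤ symbol Q k := by
  obtain ⟨c, hc, h⟩ := hQ.symbol_lower_bound
  exact le_trans (by positivity) (h k)

lemma SmoothingAssumption.symbol_pos {Q : Polynomial ℝ} (hQ : SmoothingAssumption Q) {k : ℝ}
    (hk : k ≠ 0) : 0 < symbol Q k :=
  hQ.eval_pos _ (mul_ne_zero (by positivity) hk)

/-- The exponent `3/4` is a compromise: with `y` of order `t k⁴` it yields `t^(-3/4)`, integrable at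
`t = 0`, and `|k|^(-3)`, integrable at infinity even after multiplication by `|k|`. Powers up to `2`
arise on differentiating a mode twice in `k`. The constant is `2! + 3! = 8`, from `y² + y³ ≤ 8 exp
y`. -/
lemma pow_mul_exp_neg_le {y : ℝ} (hy : 0 < y) {j : ℕ} (hj : j ≤ 2) :
    y ^ j * Real.exp (-y) ≤ 8 * y ^ (-(3 / 4) : ℝ) := by
  have h1 : y ^ (3 / 4 : ℝ) ≤ 1 + y := by
    rcases le_total y 1 with h | h
    · exact (Real.rpow_le_one hy.le h (by norm_num)).trans (by linarith)
    · calc y ^ (3 / 4 : ℝ) ≤ y ^ (1 : ℝ) := Real.rpow_le_rpow_of_exponent_le h (by norm_num)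
        _ = y := Real.rpow_one y
        _ ≤ 1 + y := by linarith
  have h2 := Real.pow_div_factorial_le_exp y hy.le j
  have h3 := Real.pow_div_factorial_le_exp y hy.le (j + 1)
  have h4 : y ^ j * (1 + y) ≤ 8 * Real.exp y := by
    rw [div_le_iff₀ (by positivity)] at h2 h3
    have e : y ^ j * (1 + y) = y ^ j + y ^ (j + 1) := by ring
    have := Real.one_le_exp hy.le
    rw [e]
    interval_cases j <;> norm_num [Nat.factorial] at h2 h3 ⊢ <;> nlinarith
  rw [Real.rpow_neg hy.le, Real.exp_neg, ← div_eq_mul_inv, ← div_eq_mul_inv,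
    div_le_div_iff₀ (Real.exp_pos _) (by positivity)]
  exact (mul_le_mul_of_nonneg_left h1 (by positivity)).trans h4

/-- For `|k| ≥ 1` the symbol is at least a multiple of `k⁴`, whatever its degree, and the negative
power in `pow_mul_exp_neg_le` is decreasing. -/
lemma SmoothingAssumption.pow_mul_exp_symbol_le {Q : Polynomial ℝ} (hQ : SmoothingAssumption Q) :
    ∃ C > 0, ∀ t k : ℝ, 0 < t → 1 ≤ |k| → ∀ j ≤ 2,
      (t * symbol Q k) ^ j * Real.exp (-(t * symbol Q k)) ≤
        C * t ^ (-(3 / 4) : ℝ) * (|k| ^ 3)⁻¹ := by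
  obtain ⟨c, hc, h⟩ := hQ.symbol_lower_bound
  refine ⟨8 * c ^ (-(3 / 4) : ℝ), by positivity, fun t k ht hk j hj => ?_⟩
  have hk0 : 0 < |k| := by linarith
  have hk0' : k ≠ 0 := abs_pos.1 hk0
  have hy : 0 < t * symbol Q k := mul_pos ht (hQ.symbol_pos hk0')
  refine (pow_mul_exp_neg_le hy hj).trans ?_
  have h1 : c * t * |k| ^ 4 ≤ t * symbol Q k := by
    have : c * |k| ^ 4 ≤ symbol Q k := by
      refine le_trans (mul_le_mul_of_nonneg_left ?_ hc.le) (h k)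
      have e : |k| ^ 4 = k ^ 4 := by rw [← abs_pow, abs_of_nonneg (by positivity)]
      rw [e]; nlinarith [sq_nonneg k]
    nlinarith
  have h2 : (t * symbol Q k) ^ (-(3 / 4) : ℝ) ≤ (c * t * |k| ^ 4) ^ (-(3 / 4) : ℝ) :=
    Real.rpow_le_rpow_of_nonpos (by positivity) h1 (by norm_num)
  have h3 : (c * t * |k| ^ 4) ^ (-(3 / 4) : ℝ) =
      c ^ (-(3 / 4) : ℝ) * t ^ (-(3 / 4) : ℝ) * (|k| ^ 3)⁻¹ := by
    rw [Real.mul_rpow (by positivity) (by positivity), Real.mul_rpow hc.le ht.le,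
      ← Real.rpow_natCast |k| 4, ← Real.rpow_mul hk0.le, ← Real.rpow_natCast |k| 3,
      ← Real.rpow_neg hk0.le]
    norm_num
  rw [h3] at h2
  calc _ ≤ 8 * (c ^ (-(3 / 4) : ℝ) * t ^ (-(3 / 4) : ℝ) * (|k| ^ 3)⁻¹) := by gcongr
    _ = _ := by ring

/-- The singular factor in time of the kernel bounds. -/
def timeBound (t : ℝ) : ℝ := 1 + t ^ (-(3 / 4) : ℝ)

lemma timeBound_nonneg {t : ℝ} (ht : 0 < t) : 0 ≤ timeBound t := by
  unfold timeBound; positivity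

lemma SmoothingAssumption.abs_mul_exp_symbol_le {Q : Polynomial ℝ} (hQ : SmoothingAssumption Q) :
    ∃ C > 0, ∀ t k : ℝ, 0 < t →
      |k| * Real.exp (-(t * symbol Q k)) ≤ C * timeBound t * (1 + k ^ 2)⁻¹ := by
  obtain ⟨C, hC, h⟩ := hQ.pow_mul_exp_symbol_le
  refine ⟨2 * (C + 1), by positivity, fun t k ht => ?_⟩
  have ht' : 0 < t ^ (-(3 / 4) : ℝ) := by positivity
  rcases le_total 1 |k| with hk | hk
  · have h0 := h t k ht hk 0 (by norm_num)
    rw [pow_zero, one_mul] at h0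
    have h1 : (|k| ^ 3)⁻¹ * |k| ≤ 2 * (1 + k ^ 2)⁻¹ := by
      have hk0 : 0 < |k| := by linarith
      rw [← div_eq_inv_mul, ← div_eq_mul_inv, div_le_div_iff₀ (by positivity) (by positivity)]
      rw [← sq_abs k]
      nlinarith [mul_pos hk0 hk0, mul_le_mul hk hk zero_le_one hk0.le]
    calc |k| * Real.exp (-(t * symbol Q k)) ≤ |k| * (C * t ^ (-(3 / 4) : ℝ) * (|k| ^ 3)⁻¹) :=
          mul_le_mul_of_nonneg_left h0 (abs_nonneg _)
      _ = C * t ^ (-(3 / 4) : ℝ) * ((|k| ^ 3)⁻¹ * |k|) := by ring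
      _ ≤ C * t ^ (-(3 / 4) : ℝ) * (2 * (1 + k ^ 2)⁻¹) := by gcongr
      _ = 2 * C * t ^ (-(3 / 4) : ℝ) * (1 + k ^ 2)⁻¹ := by ring
      _ ≤ _ := by
        refine mul_le_mul_of_nonneg_right ?_ (by positivity)
        unfold timeBound; nlinarith
  · have h1 : Real.exp (-(t * symbol Q k)) ≤ 1 :=
      Real.exp_le_one_iff.2 (neg_nonpos.2 (mul_nonneg ht.le (hQ.symbol_nonneg k)))
    have h2 : 1 ≤ 2 * (1 + k ^ 2)⁻¹ := by
      rw [← div_eq_mul_inv, le_div_iff₀ (by positivity)]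
      rw [← sq_abs]; nlinarith [abs_nonneg k]
    calc |k| * Real.exp (-(t * symbol Q k)) ≤ 1 * 1 :=
          mul_le_mul hk h1 (Real.exp_pos _).le zero_le_one
      _ ≤ 2 * (1 + k ^ 2)⁻¹ := by linarith
      _ ≤ _ := by
        refine mul_le_mul_of_nonneg_right ?_ (by positivity)
        unfold timeBound; nlinarith

/-! ### Sampled spectral kernels -/

/-- A sampling of the frequencies: the identity for the whole line, and a rounding to a lattice for
a torus, so that integrals become Riemann sums. -/
structure IsSampling (ρ : ℝ → ℝ) : Prop where
  measurable : Measurable ρ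
  abs_sub_le : ∀ k, |ρ k - k| ≤ 1

lemma IsSampling.id : IsSampling (fun k => k) := ⟨measurable_id, fun k => by simp⟩

/-- From `k² ≤ 2 (ρ k)² + 2`. It lets one integrable function of `k` dominate the line and all tori
at once. -/
lemma IsSampling.inv_le {ρ : ℝ → ℝ} (hρ : IsSampling ρ) (k : ℝ) :
    (1 + ρ k ^ 2)⁻¹ ≤ 3 * (1 + k ^ 2)⁻¹ := by
  rw [← div_eq_mul_inv, ← one_div, div_le_div_iff₀ (by positivity) (by positivity)]
  have h := abs_le.1 (hρ.abs_sub_le k)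
  nlinarith [sq_nonneg (ρ k - k), sq_nonneg (2 * ρ k - k), h.1, h.2,
    mul_nonneg (sub_nonneg.2 h.1) (sub_nonneg.2 h.2)]

/-- The integrand of the spatial derivative of the heat kernel at frequency `k`. -/
def gradMode (Q : Polynomial ℝ) (t x k : ℝ) : ℝ :=
  2 * Real.pi * k * Real.exp (-(t * symbol Q k)) * Real.sin (2 * Real.pi * k * x)

lemma continuous_gradMode (Q : Polynomial ℝ) :
    Continuous fun p : (ℝ × ℝ) × ℝ => gradMode Q p.1.1 p.1.2 p.2 := by
  have := continuous_symbol Q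
  unfold gradMode
  fun_prop

/-- The spatial derivative of the heat kernel with frequencies sampled by `ρ`. -/
def specKernel (Q : Polynomial ℝ) (ρ : ℝ → ℝ) (p : ℝ × ℝ) : ℝ :=
  if 0 < p.1 then -∫ k, gradMode Q p.1 p.2 (ρ k) else 0

lemma measurable_specKernel (Q : Polynomial ℝ) {ρ : ℝ → ℝ} (hρ : IsSampling ρ) :
    Measurable (specKernel Q ρ) := by
  have h : Measurable fun p : (ℝ × ℝ) × ℝ => gradMode Q p.1.1 p.1.2 (ρ p.2) :=
    (continuous_gradMode Q).measurable.comp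
      (measurable_fst.prodMk (hρ.measurable.comp measurable_snd))
  exact Measurable.ite (measurableSet_lt measurable_const measurable_fst)
    h.stronglyMeasurable.integral_prod_right.measurable.neg measurable_const

lemma SmoothingAssumption.abs_gradMode_le {Q : Polynomial ℝ} (hQ : SmoothingAssumption Q) :
    ∃ C > 0, ∀ t x k : ℝ, 0 < t → |gradMode Q t x k| ≤ C * timeBound t * (1 + k ^ 2)⁻¹ := by
  obtain ⟨C, hC, h⟩ := hQ.abs_mul_exp_symbol_le
  refine ⟨2 * Real.pi * C, by positivity, fun t x k ht => ?_⟩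
  unfold gradMode
  rw [abs_mul, abs_mul, abs_mul, abs_of_nonneg (by positivity : (0 : ℝ) ≤ 2 * Real.pi),
    abs_of_nonneg (Real.exp_pos _).le]
  calc 2 * Real.pi * |k| * Real.exp (-(t * symbol Q k)) * |Real.sin (2 * Real.pi * k * x)|
      ≤ 2 * Real.pi * |k| * Real.exp (-(t * symbol Q k)) * 1 :=
        mul_le_mul_of_nonneg_left (Real.abs_sin_le_one _) (by positivity)
    _ = 2 * Real.pi * (|k| * Real.exp (-(t * symbol Q k))) := by ring
    _ ≤ 2 * Real.pi * (C * timeBound t * (1 + k ^ 2)⁻¹) :=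
        mul_le_mul_of_nonneg_left (h t k ht) (by positivity)
    _ = _ := by ring

lemma SmoothingAssumption.abs_gradMode_sampled_le {Q : Polynomial ℝ}
    (hQ : SmoothingAssumption Q) :
    ∃ C > 0, ∀ ρ, IsSampling ρ → ∀ t x k : ℝ, 0 < t →
      |gradMode Q t x (ρ k)| ≤ C * timeBound t * (1 + k ^ 2)⁻¹ := by
  obtain ⟨C, hC, h⟩ := hQ.abs_gradMode_le
  refine ⟨3 * C, by positivity, fun ρ hρ t x k ht => (h t x _ ht).trans ?_⟩
  calc C * timeBound t * (1 + ρ k ^ 2)⁻¹ ≤ C * timeBound t * (3 * (1 + k ^ 2)⁻¹) :=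
        mul_le_mul_of_nonneg_left (hρ.inv_le k) (mul_nonneg hC.le (timeBound_nonneg ht))
    _ = _ := by ring

lemma integrable_gradMode {Q : Polynomial ℝ} (hQ : SmoothingAssumption Q)
    {ρ : ℝ → ℝ} (hρ : IsSampling ρ) {t : ℝ} (ht : 0 < t) (x : ℝ) :
    Integrable fun k => gradMode Q t x (ρ k) := by
  obtain ⟨C, hC, h⟩ := hQ.abs_gradMode_sampled_le
  refine (integrable_inv_one_add_sq.const_mul (C * timeBound t)).mono' ?_
    (Eventually.of_forall fun k => h ρ hρ t x k ht)
  exact ((continuous_gradMode Q).measurable.comp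
    (measurable_const.prodMk hρ.measurable) : Measurable fun k =>
      gradMode Q (t, x).1 (t, x).2 (ρ k)).aestronglyMeasurable

lemma SmoothingAssumption.abs_specKernel_le {Q : Polynomial ℝ} (hQ : SmoothingAssumption Q) :
    ∃ C > 0, ∀ ρ, IsSampling ρ → ∀ p : ℝ × ℝ, 0 < p.1 →
      |specKernel Q ρ p| ≤ C * timeBound p.1 := by
  obtain ⟨C, hC, h⟩ := hQ.abs_gradMode_sampled_le
  refine ⟨C * Real.pi, by positivity, fun ρ hρ p hp => ?_⟩
  rw [specKernel, if_pos hp, abs_neg, ← Real.norm_eq_abs]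
  refine (norm_integral_le_of_norm_le (integrable_inv_one_add_sq.const_mul (C * timeBound p.1))
    (Eventually.of_forall fun k => h ρ hρ p.1 p.2 k hp)).trans (le_of_eq ?_)
  rw [integral_const_mul, integral_univ_inv_one_add_sq]
  ring

lemma specKernel_of_nonpos (Q : Polynomial ℝ) (ρ : ℝ → ℝ) {p : ℝ × ℝ} (hp : p.1 ≤ 0) :
    specKernel Q ρ p = 0 := if_neg (not_lt.2 hp)

/-- Dominated convergence in frequency: the integrand is continuous in `k`, and the majorant is the
same for every sampling. -/
lemma tendsto_specKernel {Q : Polynomial ℝ} (hQ : SmoothingAssumption Q) {ρ : ℕ → ℝ → ℝ}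
    (hρ : ∀ n, IsSampling (ρ n)) (hlim : ∀ k, Tendsto (fun n => ρ n k) atTop (𝓝 k))
    (p : ℝ × ℝ) :
    Tendsto (fun n => specKernel Q (ρ n) p) atTop (𝓝 (specKernel Q (fun k => k) p)) := by
  obtain ⟨C, hC, h⟩ := hQ.abs_gradMode_sampled_le
  unfold specKernel
  split_ifs with hp
  · refine (tendsto_integral_of_dominated_convergence
      (fun k => C * timeBound p.1 * (1 + k ^ 2)⁻¹)
      (fun n => (integrable_gradMode hQ (hρ n) hp p.2).1)
      (integrable_inv_one_add_sq.const_mul _)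
      (fun n => Eventually.of_forall fun k => h _ (hρ n) p.1 p.2 k hp)
      (Eventually.of_forall fun k => ?_)).neg
    exact ((continuous_gradMode Q).tendsto (p, k)).comp (tendsto_const_nhds.prodMk_nhds (hlim k))
  · exact tendsto_const_nhds

/-! ### The covariance of the kernel -/

/-- The spectral density `(2πk)² / (2 Q(2πk))` of the kernel. -/
def specDensity (Q : Polynomial ℝ) (k : ℝ) : ℝ := (2 * Real.pi * k) ^ 2 / (2 * symbol Q k)

lemma SmoothingAssumption.specDensity_nonneg {Q : Polynomial ℝ} (hQ : SmoothingAssumption Q)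
    (k : ℝ) : 0 ≤ specDensity Q k :=
  div_nonneg (sq_nonneg _) (mul_nonneg two_pos.le (hQ.symbol_nonneg k))

lemma measurable_specDensity (Q : Polynomial ℝ) : Measurable (specDensity Q) := by
  have := (continuous_symbol Q).measurable
  unfold specDensity
  fun_prop

/-- The factor `k²` cancels the double zero of the symbol, leaving the decay of `1 / (1 + k²)`. This
integrability at both small and large frequencies is what puts the kernel in `L²` of space-time. -/
lemma SmoothingAssumption.specDensity_le {Q : Polynomial ℝ} (hQ : SmoothingAssumption Q) :
    ∃ C > 0, ∀ ρ, IsSampling ρ → ∀ k, specDensity Q (ρ k) ≤ C * (1 + k ^ 2)⁻¹ := by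
  obtain ⟨c, hc, h⟩ := hQ.symbol_lower_bound
  refine ⟨3 * ((2 * Real.pi) ^ 2 / c), by positivity, fun ρ hρ k => ?_⟩
  have h1 : ∀ k, specDensity Q k ≤ (2 * Real.pi) ^ 2 / c * (1 + k ^ 2)⁻¹ := by
    intro k
    by_cases hk : k = 0
    · subst hk
      simp only [specDensity, mul_zero]
      rw [zero_pow two_ne_zero, zero_div]
      positivity
    · have hpos := hQ.symbol_pos hk
      unfold specDensity
      rw [← div_eq_mul_inv, div_div, div_le_div_iff₀ (by positivity) (by positivity), mul_pow,
        mul_assoc]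
      refine mul_le_mul_of_nonneg_left ?_ (by positivity)
      nlinarith [h k]
  calc specDensity Q (ρ k) ≤ (2 * Real.pi) ^ 2 / c * (1 + ρ k ^ 2)⁻¹ := h1 _
    _ ≤ (2 * Real.pi) ^ 2 / c * (3 * (1 + k ^ 2)⁻¹) :=
      mul_le_mul_of_nonneg_left (hρ.inv_le k) (by positivity)
    _ = _ := by ring

/-- The space-time covariance of the kernel with frequencies sampled by `ρ`. -/
def specCov (Q : Polynomial ℝ) (ρ : ℝ → ℝ) (p : ℝ × ℝ) : ℝ :=
  ∫ k, specDensity Q (ρ k) * Real.exp (-(|p.1| * symbol Q (ρ k))) *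
    Real.cos (2 * Real.pi * ρ k * p.2)

lemma measurable_specCov_integrand (Q : Polynomial ℝ) {ρ : ℝ → ℝ} (hρ : Measurable ρ) :
    Measurable fun p : (ℝ × ℝ) × ℝ => specDensity Q (ρ p.2) *
      Real.exp (-(|p.1.1| * symbol Q (ρ p.2))) * Real.cos (2 * Real.pi * ρ p.2 * p.1.2) := by
  have h1 := (continuous_symbol Q).measurable
  have h2 := measurable_specDensity Q
  fun_prop

lemma measurable_specCov (Q : Polynomial ℝ) {ρ : ℝ → ℝ} (hρ : IsSampling ρ) :
    Measurable (specCov Q ρ) :=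
  (measurable_specCov_integrand Q hρ.measurable).stronglyMeasurable.integral_prod_right.measurable

lemma SmoothingAssumption.abs_specCov_integrand_le {Q : Polynomial ℝ}
    (hQ : SmoothingAssumption Q) (s x k : ℝ) :
    |specDensity Q k * Real.exp (-(|s| * symbol Q k)) * Real.cos (2 * Real.pi * k * x)| ≤
      specDensity Q k := by
  rw [abs_mul, abs_mul, abs_of_nonneg (hQ.specDensity_nonneg k), abs_of_nonneg (Real.exp_pos _).le]
  have h1 : Real.exp (-(|s| * symbol Q k)) ≤ 1 :=
    Real.exp_le_one_iff.2 (neg_nonpos.2 (mul_nonneg (abs_nonneg _) (hQ.symbol_nonneg k)))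
  have h2 := Real.abs_cos_le_one (2 * Real.pi * k * x)
  have h3 := hQ.specDensity_nonneg k
  calc _ ≤ specDensity Q k * 1 * 1 := by gcongr
    _ = _ := by ring

lemma integrable_specDensity {Q : Polynomial ℝ} (hQ : SmoothingAssumption Q)
    {ρ : ℝ → ℝ} (hρ : IsSampling ρ) : Integrable fun k => specDensity Q (ρ k) := by
  obtain ⟨C, hC, h⟩ := hQ.specDensity_le
  refine (integrable_inv_one_add_sq.const_mul C).mono'
    ((measurable_specDensity Q).comp hρ.measurable).aestronglyMeasurable
    (Eventually.of_forall fun k => ?_)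
  rw [Real.norm_of_nonneg (hQ.specDensity_nonneg _)]
  exact h ρ hρ k

lemma SmoothingAssumption.abs_specCov_le {Q : Polynomial ℝ} (hQ : SmoothingAssumption Q) :
    ∃ C > 0, ∀ ρ, IsSampling ρ → ∀ p : ℝ × ℝ, |specCov Q ρ p| ≤ C := by
  obtain ⟨C, hC, h⟩ := hQ.specDensity_le
  refine ⟨C * Real.pi, by positivity, fun ρ hρ p => ?_⟩
  rw [specCov, ← Real.norm_eq_abs]
  refine (norm_integral_le_of_norm_le (integrable_inv_one_add_sq.const_mul C)
    (Eventually.of_forall fun k =>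
      (hQ.abs_specCov_integrand_le p.1 p.2 _).trans (h ρ hρ k))).trans (le_of_eq ?_)
  rw [integral_const_mul, integral_univ_inv_one_add_sq]

lemma tendsto_specCov {Q : Polynomial ℝ} (hQ : SmoothingAssumption Q) {ρ : ℕ → ℝ → ℝ}
    (hρ : ∀ n, IsSampling (ρ n)) (hlim : ∀ k, Tendsto (fun n => ρ n k) atTop (𝓝 k))
    (p : ℝ × ℝ) :
    Tendsto (fun n => specCov Q (ρ n) p) atTop (𝓝 (specCov Q (fun k => k) p)) := by
  obtain ⟨C, hC, h⟩ := hQ.specDensity_le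
  refine tendsto_integral_of_dominated_convergence (fun k => C * (1 + k ^ 2)⁻¹)
    (fun n => ?_) (integrable_inv_one_add_sq.const_mul _)
    (fun n => Eventually.of_forall fun k =>
      (hQ.abs_specCov_integrand_le p.1 p.2 _).trans (h _ (hρ n) k)) ?_
  · exact ((measurable_specCov_integrand Q (hρ n).measurable).comp
      (measurable_const (a := p) |>.prodMk measurable_id)).aestronglyMeasurable
  -- At `k = 0` the density is `0 / 0`, read as `0`, and is not continuous there; a single frequency
  -- is negligible.
  · have hne : ∀ᵐ k : ℝ, k ≠ 0 := by simp [ae_iff]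
    filter_upwards [hne] with k hk
    have hS := (continuous_symbol Q).continuousAt (x := k)
    have hD : ContinuousAt (specDensity Q) k := by
      unfold specDensity
      refine ContinuousAt.div (by fun_prop) (continuousAt_const.mul hS) ?_
      exact (mul_pos two_pos (hQ.symbol_pos hk)).ne'
    have hc : ContinuousAt (fun k => specDensity Q k * Real.exp (-(|p.1| * symbol Q k)) *
        Real.cos (2 * Real.pi * k * p.2)) k := by fun_prop
    exact hc.tendsto.comp (hlim k)

/-- Integrating the modes in time gives the covariance. -/
lemma integrable_sq_mul_exp {Q : Polynomial ℝ} (hQ : SmoothingAssumption Q)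
    {ρ : ℝ → ℝ} (hρ : IsSampling ρ) (s x : ℝ) :
    Integrable (fun p : ℝ × ℝ => (2 * Real.pi * ρ p.2) ^ 2 *
      Real.exp (-((2 * p.1 + |s|) * symbol Q (ρ p.2))) * Real.cos (2 * Real.pi * ρ p.2 * x))
      ((volume.restrict (Ioi 0)).prod volume) ∧
    ∫ t in Ioi 0, ∫ k, (2 * Real.pi * ρ k) ^ 2 *
      Real.exp (-((2 * t + |s|) * symbol Q (ρ k))) * Real.cos (2 * Real.pi * ρ k * x) =
      specCov Q ρ (s, x) := by
  have hm : Measurable fun p : ℝ × ℝ => (2 * Real.pi * ρ p.2) ^ 2 *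
      Real.exp (-((2 * p.1 + |s|) * symbol Q (ρ p.2))) * Real.cos (2 * Real.pi * ρ p.2 * x) := by
    have h1 := (continuous_symbol Q).measurable
    have h2 := hρ.measurable
    fun_prop
  have hform : ∀ t k : ℝ, (2 * Real.pi * k) ^ 2 *
      Real.exp (-((2 * t + |s|) * symbol Q k)) * Real.cos (2 * Real.pi * k * x) =
      Real.exp (-(2 * symbol Q k) * t) * ((2 * Real.pi * k) ^ 2 *
        Real.exp (-(|s| * symbol Q k)) * Real.cos (2 * Real.pi * k * x)) := by
    intro t k
    rw [show -((2 * t + |s|) * symbol Q k) = -(2 * symbol Q k) * t + -(|s| * symbol Q k) by ring,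
      Real.exp_add]
    ring
  have hexp : ∀ c : ℝ, 0 < c → IntegrableOn (fun t => Real.exp (-c * t)) (Ioi 0) ∧
      ∫ t in Ioi 0, Real.exp (-c * t) = c⁻¹ := by
    intro c hc
    refine ⟨exp_neg_integrableOn_Ioi 0 hc, ?_⟩
    rw [integral_exp_mul_Ioi (neg_lt_zero.2 hc)]
    simp
  -- The `2` in the denominator of the spectral density is `∫ exp (-2 S t) dt = 1 / (2 S)`. For `k =
  -- 0` the time integral would diverge, but the prefactor `k²` annihilates it and both sides are
  -- `0`.
  have hk : ∀ (k z : ℝ), Integrable (fun t => Real.exp (-(2 * symbol Q k) * t) *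
        ((2 * Real.pi * k) ^ 2 * z)) (volume.restrict (Ioi 0)) ∧
      ∫ t in Ioi 0, Real.exp (-(2 * symbol Q k) * t) * ((2 * Real.pi * k) ^ 2 * z) =
        specDensity Q k * z := by
    intro k z
    by_cases h0 : k = 0
    · subst h0; simp [specDensity]
    · obtain ⟨h1, h2⟩ := hexp (2 * symbol Q k) (mul_pos two_pos (hQ.symbol_pos h0))
      refine ⟨Integrable.mul_const h1 _, ?_⟩
      rw [integral_mul_const, h2, specDensity]
      ring
  have hint : Integrable (fun p : ℝ × ℝ => (2 * Real.pi * ρ p.2) ^ 2 *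
      Real.exp (-((2 * p.1 + |s|) * symbol Q (ρ p.2))) * Real.cos (2 * Real.pi * ρ p.2 * x))
      ((volume.restrict (Ioi 0)).prod volume) := by
    rw [integrable_prod_iff' hm.aestronglyMeasurable]
    refine ⟨Eventually.of_forall fun k => ?_, ?_⟩
    · simp only [hform]
      simpa only [mul_assoc] using (hk (ρ k) (Real.exp (-(|s| * symbol Q (ρ k))) *
        Real.cos (2 * Real.pi * ρ k * x))).1
    · refine (integrable_specDensity hQ hρ).mono'
        hm.norm.stronglyMeasurable.integral_prod_left.aestronglyMeasurable
        (Eventually.of_forall fun k => ?_)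
      have e : ∀ t, ‖(2 * Real.pi * ρ k) ^ 2 *
          Real.exp (-((2 * t + |s|) * symbol Q (ρ k))) * Real.cos (2 * Real.pi * ρ k * x)‖ =
          Real.exp (-(2 * symbol Q (ρ k)) * t) * ((2 * Real.pi * ρ k) ^ 2 *
            |Real.exp (-(|s| * symbol Q (ρ k))) * Real.cos (2 * Real.pi * ρ k * x)|) := by
        intro t
        rw [hform, mul_assoc, Real.norm_eq_abs, abs_mul, abs_mul,
          abs_of_nonneg (Real.exp_pos _).le, abs_of_nonneg (sq_nonneg _)]
      simp only [e]
      rw [(hk _ _).2, Real.norm_of_nonneg (mul_nonneg (hQ.specDensity_nonneg _) (abs_nonneg _))]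
      have := hQ.abs_specCov_integrand_le s x (ρ k)
      rwa [mul_assoc, abs_mul, abs_of_nonneg (hQ.specDensity_nonneg _)] at this
  refine ⟨hint, ?_⟩
  rw [integral_integral_swap hint, specCov]
  refine integral_congr_ae (Eventually.of_forall fun k => ?_)
  simp only [hform]
  have := (hk (ρ k) (Real.exp (-(|s| * symbol Q (ρ k))) * Real.cos (2 * Real.pi * ρ k * x))).2
  simpa only [mul_assoc] using this

/-! ### Bounds on the mollifier -/

/-- The exponent `4` is split as `5/2 + 3/2`. The first part becomes `5/4` in time because `√|t|`
scales parabolically, and both `5/4` and `3/2` exceed `1`, so the product majorant is integrable. -/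
lemma MollifierAssumption.abs_le {θ : ℝ × ℝ → ℝ} (hθ : MollifierAssumption θ) :
    ∃ C ≥ 0, ∀ a : ℝ × ℝ,
      |θ a| ≤ C * ((1 + |a.1|) ^ (-(5 / 4) : ℝ) * (1 + |a.2|) ^ (-(3 / 2) : ℝ)) := by
  obtain ⟨δ, hδ, C, h⟩ := hθ.decay
  have hC : 0 ≤ C := by
    have := (abs_nonneg _).trans (h 0 0)
    simpa using this
  refine ⟨C, hC, fun ⟨t, x⟩ => (h t x).trans (mul_le_mul_of_nonneg_left ?_ hC)⟩
  dsimp only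
  have h1 : 1 ≤ 1 + (√|t| + |x|) := by
    have := Real.sqrt_nonneg |t|
    linarith [abs_nonneg x]
  have h0 : 0 < 1 + (√|t| + |x|) := by linarith
  calc (1 + (√|t| + |x|)) ^ (-4 - δ) ≤ (1 + (√|t| + |x|)) ^ (-(5 / 2) + -(3 / 2) : ℝ) :=
        Real.rpow_le_rpow_of_exponent_le h1 (by linarith)
    _ = (1 + (√|t| + |x|)) ^ (-(5 / 2) : ℝ) * (1 + (√|t| + |x|)) ^ (-(3 / 2) : ℝ) :=
        Real.rpow_add h0 _ _
    _ ≤ (1 + |t|) ^ (-(5 / 4) : ℝ) * (1 + |x|) ^ (-(3 / 2) : ℝ) := by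
        refine mul_le_mul ?_ ?_ (by positivity) (by positivity)
        · have e : (1 + (√|t| + |x|)) ^ (-(5 / 2) : ℝ) =
              ((1 + (√|t| + |x|)) ^ 2) ^ (-(5 / 4) : ℝ) := by
            rw [← Real.rpow_natCast, ← Real.rpow_mul h0.le]; norm_num
          rw [e]
          refine Real.rpow_le_rpow_of_nonpos (by positivity) ?_ (by norm_num)
          nlinarith [Real.sq_sqrt (abs_nonneg t), Real.sqrt_nonneg |t|, abs_nonneg x,
            mul_nonneg (Real.sqrt_nonneg |t|) (abs_nonneg x)]
        · exact Real.rpow_le_rpow_of_nonpos (by positivity)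
            (by linarith [Real.sqrt_nonneg |t|]) (by norm_num)

lemma integrable_one_add_abs_rpow {r : ℝ} (hr : 1 < r) :
    Integrable fun x : ℝ => (1 + |x|) ^ (-r) := by
  simpa using integrable_one_add_norm (E := ℝ) (μ := volume) (r := r) (by simpa using hr)

lemma MollifierAssumption.integrable {θ : ℝ × ℝ → ℝ} (hθ : MollifierAssumption θ) :
    Integrable θ := by
  obtain ⟨C, hC, h⟩ := hθ.abs_le
  have := ((integrable_one_add_abs_rpow (r := 5 / 4) (by norm_num)).mul_prod
    (integrable_one_add_abs_rpow (r := 3 / 2) (by norm_num))).const_mul C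
  exact this.mono' hθ.measurable.aestronglyMeasurable (Eventually.of_forall h)

/-- Uniform integrability of the mollifier against the temporal singularity of the kernel. -/
lemma MollifierAssumption.exists_dominating {θ : ℝ × ℝ → ℝ} (hθ : MollifierAssumption θ) :
    ∃ (D : ℝ → ℝ × ℝ → ℝ) (M : ℝ), (∀ s, Integrable (D s)) ∧ (∀ s, ∫ a, D s a = M) ∧
      (∀ s a, 0 ≤ D s a) ∧
      ∀ (s : ℝ) (a : ℝ × ℝ), 0 < s - a.1 → timeBound (s - a.1) * |θ a| ≤ D s a := by
  obtain ⟨C, hC, h⟩ := hθ.abs_le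
  set A : ℝ → ℝ := fun t => (1 + |t|) ^ (-(5 / 4) : ℝ) with hA
  set B : ℝ → ℝ := fun t => (1 + |t|) ^ (-(3 / 2) : ℝ) with hB
  set J : ℝ → ℝ := (Ioc (0 : ℝ) 1).indicator fun t => t ^ (-(3 / 4) : ℝ) with hJ
  have hAi : Integrable A := integrable_one_add_abs_rpow (by norm_num)
  have hBi : Integrable B := integrable_one_add_abs_rpow (by norm_num)
  have hJi : Integrable J := by
    rw [hJ, integrable_indicator_iff measurableSet_Ioc,
      ← intervalIntegrable_iff_integrableOn_Ioc_of_le zero_le_one]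
    exact intervalIntegral.intervalIntegrable_rpow' (by norm_num)
  have hA0 : ∀ t, 0 < A t := fun t => by positivity
  have hB0 : ∀ t, 0 < B t := fun t => by positivity
  have hA1 : ∀ t, A t ≤ 1 := fun t =>
    Real.rpow_le_one_of_one_le_of_nonpos (by linarith [abs_nonneg t]) (by norm_num)
  have hJ0 : ∀ t, 0 ≤ J t := fun t => indicator_nonneg (fun x hx => by
    have := hx.1
    positivity) t
  -- The singularity enters as a translate of the fixed integrable function `J`, so the total mass
  -- does not depend on `s`.
  refine ⟨fun s a => C * ((2 * A a.1 + J (s - a.1)) * B a.2),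
    C * ((2 * (∫ t, A t) + ∫ t, J t) * ∫ t, B t), fun s => ?_, fun s => ?_, fun s a => ?_,
    fun s a hsa => ?_⟩
  · exact (((hAi.const_mul 2).add (hJi.comp_sub_left s)).mul_prod hBi).const_mul C
  · rw [integral_const_mul]
    congr 1
    have := integral_prod_mul (μ := (volume : Measure ℝ)) (ν := (volume : Measure ℝ))
      (fun t => 2 * A t + J (s - t)) B
    rw [← Measure.volume_eq_prod] at this
    rw [this, integral_add (hAi.const_mul 2) (hJi.comp_sub_left s), integral_const_mul,
      integral_sub_left_eq_self J volume s]
  · exact mul_nonneg hC (mul_nonneg (add_nonneg (mul_nonneg two_pos.le (hA0 _).le) (hJ0 _))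
      (hB0 _).le)
  -- Within unit time of the singularity `A ≤ 1` leaves `A + J`; beyond it the factor `timeBound` is
  -- at most `2`.
  · have h1 : timeBound (s - a.1) * A a.1 ≤ 2 * A a.1 + J (s - a.1) := by
      unfold timeBound
      rcases le_or_gt (s - a.1) 1 with h2 | h2
      · have e : J (s - a.1) = (s - a.1) ^ (-(3 / 4) : ℝ) :=
          indicator_of_mem (show s - a.1 ∈ Ioc (0 : ℝ) 1 from ⟨hsa, h2⟩) _
        have h3 : 0 < (s - a.1) ^ (-(3 / 4) : ℝ) := by positivity
        rw [e]
        nlinarith [hA0 a.1, hA1 a.1]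
      · have h3 : (s - a.1) ^ (-(3 / 4) : ℝ) ≤ 1 :=
          Real.rpow_le_one_of_one_le_of_nonpos h2.le (by norm_num)
        nlinarith [hA0 a.1, hJ0 (s - a.1)]
    calc timeBound (s - a.1) * |θ a| ≤ timeBound (s - a.1) * (C * (A a.1 * B a.2)) :=
          mul_le_mul_of_nonneg_left (h a) (timeBound_nonneg hsa)
      _ = C * ((timeBound (s - a.1) * A a.1) * B a.2) := by ring
      _ ≤ _ := mul_le_mul_of_nonneg_left (mul_le_mul_of_nonneg_right h1 (hB0 _).le) hC

/-! ### Convolution of square integrable kernels with the mollifier -/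

section Conv

variable {G : Type*} [MeasurableSpace G] [AddCommGroup G] [MeasurableAdd₂ G] [MeasurableNeg G]
  {m : Measure G}

/-- The convolution of a function `g` on `G` with the image under `ι` of `θ(a) da`. -/
def liftConv (ι : ℝ × ℝ → G) (g : G → ℝ) (θ : ℝ × ℝ → ℝ) (u : G) : ℝ :=
  ∫ a, g (u - ι a) * θ a

variable {ι : ℝ × ℝ → G} {g : G → ℝ} {θ : ℝ × ℝ → ℝ}

lemma measurable_liftConv_integrand (hι : Measurable ι) (hg : Measurable g) (hθ : Measurable θ) :
    Measurable fun p : G × (ℝ × ℝ) => g (p.1 - ι p.2) * θ p.2 := by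
  simp only [sub_eq_add_neg]
  fun_prop

lemma measurable_liftConv (hι : Measurable ι) (hg : Measurable g) (hθ : Measurable θ) :
    Measurable (liftConv ι g θ) :=
  (measurable_liftConv_integrand hι hg hθ).stronglyMeasurable.integral_prod_right.measurable

/-- The arithmetic-geometric mean inequality and translation invariance; the bound does not depend
on the two shifts. -/
lemma integrable_mul_translates [m.IsAddLeftInvariant] (hg : Measurable g)
    (hg2 : Integrable (fun u => g u ^ 2) m) (a b : G) :
    Integrable (fun u => g (u - a) * g (u - b)) m ∧
      ∫ u, ‖g (u - a) * g (u - b)‖ ∂m ≤ ∫ u, g u ^ 2 ∂m := by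
  have ha : ∀ a, Integrable (fun u => g (u - a) ^ 2) m := fun a => hg2.comp_sub_right a
  have hm : Measurable fun u => g (u - a) * g (u - b) :=
    (hg.comp (measurable_sub_const a)).mul (hg.comp (measurable_sub_const b))
  have hle : ∀ u, ‖g (u - a) * g (u - b)‖ ≤ (1 / 2) * (g (u - a) ^ 2 + g (u - b) ^ 2) := by
    intro u
    rw [norm_mul, Real.norm_eq_abs, Real.norm_eq_abs, ← sq_abs (g (u - a)), ← sq_abs (g (u - b))]
    nlinarith [sq_nonneg (|g (u - a)| - |g (u - b)|)]
  have hi : Integrable (fun u => (1 / 2) * (g (u - a) ^ 2 + g (u - b) ^ 2)) m :=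
    ((ha a).add (ha b)).const_mul _
  have h1 : Integrable (fun u => g (u - a) * g (u - b)) m :=
    hi.mono' hm.aestronglyMeasurable (Eventually.of_forall hle)
  refine ⟨h1, (integral_mono h1.norm hi hle).trans (le_of_eq ?_)⟩
  rw [integral_const_mul, integral_add (ha a) (ha b),
    integral_sub_right_eq_self (fun u => g u ^ 2) a,
    integral_sub_right_eq_self (fun u => g u ^ 2) b]
  ring

/-- The square is written as an integral over two independent mollifier variables and integrated in
`u` first. The `L²` norm of the mollified kernel thereby depends on `g` only through its
autocorrelation. -/
lemma integral_sq_liftConv [SFinite m] [m.IsAddLeftInvariant] (hι : Measurable ι)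
    (hg : Measurable g) (hθ : Measurable θ) (hg2 : Integrable (fun u => g u ^ 2) m)
    (hθi : Integrable θ) :
    Integrable (fun u => liftConv ι g θ u ^ 2) m ∧
    ∫ u, liftConv ι g θ u ^ 2 ∂m = ∫ p : (ℝ × ℝ) × (ℝ × ℝ),
      θ p.1 * θ p.2 * ∫ u, g (u - ι p.1) * g (u - ι p.2) ∂m := by
  have hm : Measurable fun p : G × ((ℝ × ℝ) × (ℝ × ℝ)) =>
      (g (p.1 - ι p.2.1) * θ p.2.1) * (g (p.1 - ι p.2.2) * θ p.2.2) := by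
    have := measurable_liftConv_integrand hι hg hθ
    exact (this.comp (measurable_fst.prodMk (measurable_fst.comp measurable_snd))).mul
      (this.comp (measurable_fst.prodMk (measurable_snd.comp measurable_snd)))
  have hform : ∀ (u : G) (p : (ℝ × ℝ) × (ℝ × ℝ)),
      (g (u - ι p.1) * θ p.1) * (g (u - ι p.2) * θ p.2) =
      (θ p.1 * θ p.2) * (g (u - ι p.1) * g (u - ι p.2)) := fun u p => by ring
  have hint : Integrable (fun p : G × ((ℝ × ℝ) × (ℝ × ℝ)) =>
      (g (p.1 - ι p.2.1) * θ p.2.1) * (g (p.1 - ι p.2.2) * θ p.2.2)) (m.prod volume) := by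
    rw [integrable_prod_iff' hm.aestronglyMeasurable]
    refine ⟨Eventually.of_forall fun p => ?_, ?_⟩
    · simp only [hform]
      exact (integrable_mul_translates hg hg2 _ _).1.const_mul _
    · have hb : Integrable (fun p : (ℝ × ℝ) × (ℝ × ℝ) =>
          ‖θ p.1‖ * ‖θ p.2‖ * ∫ u, g u ^ 2 ∂m) := (hθi.norm.mul_prod hθi.norm).mul_const _
      refine hb.mono' hm.norm.stronglyMeasurable.integral_prod_left.aestronglyMeasurable
        (Eventually.of_forall fun p => ?_)
      rw [Real.norm_of_nonneg (integral_nonneg fun _ => norm_nonneg _)]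
      simp only [hform, norm_mul (θ _ * θ _)]
      rw [integral_const_mul, norm_mul]
      exact mul_le_mul_of_nonneg_left (integrable_mul_translates hg hg2 _ _).2 (by positivity)
  have hsq : ∀ u, liftConv ι g θ u ^ 2 = ∫ p : (ℝ × ℝ) × (ℝ × ℝ),
      (g (u - ι p.1) * θ p.1) * (g (u - ι p.2) * θ p.2) := by
    intro u
    have := integral_prod_mul (μ := (volume : Measure (ℝ × ℝ))) (ν := (volume : Measure (ℝ × ℝ)))
      (fun a => g (u - ι a) * θ a) (fun a => g (u - ι a) * θ a)
    rw [← Measure.volume_eq_prod] at this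
    rw [this, sq, liftConv]
  simp only [hsq]
  refine ⟨hint.integral_prod_left, ?_⟩
  rw [integral_integral_swap hint]
  refine integral_congr_ae (Eventually.of_forall fun p => ?_)
  simp only [hform]
  rw [integral_const_mul]

/-- Young's inequality for the convolution of `L²` and `L¹`. -/
lemma integral_sq_liftConv_le [SFinite m] [m.IsAddLeftInvariant] (hι : Measurable ι)
    (hg : Measurable g) (hθ : Measurable θ) (hg2 : Integrable (fun u => g u ^ 2) m)
    (hθi : Integrable θ) :
    ∫ u, liftConv ι g θ u ^ 2 ∂m ≤ (∫ a, |θ a|) ^ 2 * ∫ u, g u ^ 2 ∂m := by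
  rw [(integral_sq_liftConv hι hg hθ hg2 hθi).2]
  have hb : Integrable (fun p : (ℝ × ℝ) × (ℝ × ℝ) =>
    ‖θ p.1‖ * ‖θ p.2‖ * ∫ u, g u ^ 2 ∂m) := (hθi.norm.mul_prod hθi.norm).mul_const _
  refine (le_abs_self _).trans ((norm_integral_le_of_norm_le
    (f := fun p : (ℝ × ℝ) × (ℝ × ℝ) => θ p.1 * θ p.2 * ∫ u, g (u - ι p.1) * g (u - ι p.2) ∂m)
    hb (Eventually.of_forall fun p => ?_)).trans (le_of_eq ?_))
  · rw [norm_mul, norm_mul]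
    exact mul_le_mul_of_nonneg_left ((norm_integral_le_integral_norm _).trans
      (integrable_mul_translates hg hg2 _ _).2) (by positivity)
  · rw [integral_mul_const]
    congr 1
    have := integral_prod_mul (μ := (volume : Measure (ℝ × ℝ))) (ν := (volume : Measure (ℝ × ℝ)))
      (fun a => ‖θ a‖) (fun a => ‖θ a‖)
    rw [← Measure.volume_eq_prod] at this
    rw [this, sq]
    rfl

end Conv

/-! ### Kernels on a space-time `ℝ × Y` -/

section Slice

variable {Y : Type*} [MeasurableSpace Y] [AddCommGroup Y]

/-- A space-time kernel whose time slices have the given spectral covariances. -/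
structure IsSpectralKernel (Q : Polynomial ℝ) (ρ : ℝ → ℝ) (ν : Measure Y) (π : ℝ → Y)
    (q : ℝ × Y → ℝ) : Prop where
  measurable : Measurable q
  apply_proj : ∀ t x, q (t, π x) = specKernel Q ρ (t, x)
  surjective : Function.Surjective π
  sampling : IsSampling ρ
  parseval : ∀ t t' a b : ℝ, 0 < t → 0 < t' →
    Integrable (fun x => q (t, x - π a) * q (t', x - π b)) ν ∧
    ∫ x, q (t, x - π a) * q (t', x - π b) ∂ν =
      ∫ k, (2 * Real.pi * ρ k) ^ 2 * Real.exp (-((t + t') * symbol Q (ρ k))) *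
        Real.cos (2 * Real.pi * ρ k * (a - b))

variable {Q : Polynomial ℝ} {ρ : ℝ → ℝ} {ν : Measure Y} {π : ℝ → Y} {q : ℝ × Y → ℝ}

lemma IsSpectralKernel.eq_zero (h : IsSpectralKernel Q ρ ν π q) {p : ℝ × Y} (hp : p.1 ≤ 0) :
    q p = 0 := by
  obtain ⟨t, y⟩ := p
  obtain ⟨x, rfl⟩ := h.surjective y
  rw [h.apply_proj]
  exact specKernel_of_nonpos Q ρ hp

/-- Parseval gives the squared norm of each time slice, and the time integral of these converges by
the bound on the spectral density. Integrability of the kernel itself is not needed. -/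
lemma IsSpectralKernel.integrable_sq [SFinite ν] (h : IsSpectralKernel Q ρ ν π q)
    (hQ : SmoothingAssumption Q) (hπ : π 0 = 0) :
    Integrable (fun u => q u ^ 2) (volume.prod ν) := by
  have h0 := h.parseval
  have hz : ∀ {p : ℝ × Y}, p.1 ≤ 0 → q p = 0 := fun hp => h.eq_zero hp
  have hslice : ∀ t, 0 < t → Integrable (fun x => q (t, x) ^ 2) ν ∧
      ∫ x, q (t, x) ^ 2 ∂ν = ∫ k, (2 * Real.pi * ρ k) ^ 2 *
        Real.exp (-((2 * t + |(0 : ℝ)|) * symbol Q (ρ k))) *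
          Real.cos (2 * Real.pi * ρ k * 0) := by
    intro t ht
    have := h0 t t 0 0 ht ht
    simp only [hπ, sub_zero, ← sq, ← two_mul] at this
    simpa only [abs_zero, add_zero] using this
  rw [integrable_prod_iff (h.measurable.pow_const 2).aestronglyMeasurable]
  refine ⟨Eventually.of_forall fun t => ?_, ?_⟩
  · rcases le_or_gt t 0 with ht | ht
    · have : ∀ x, q (t, x) = 0 := fun x => hz ht
      simp [this]
    · exact (hslice t ht).1
  · have e : (fun t => ∫ x, ‖q (t, x) ^ 2‖ ∂ν) = (Ioi (0 : ℝ)).indicator fun t =>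
        ∫ k, (2 * Real.pi * ρ k) ^ 2 * Real.exp (-((2 * t + |(0 : ℝ)|) * symbol Q (ρ k))) *
          Real.cos (2 * Real.pi * ρ k * 0) := by
      funext t
      by_cases ht : 0 < t
      · rw [indicator_of_mem (mem_Ioi.2 ht), ← (hslice t ht).2]
        simp only [Real.norm_of_nonneg (sq_nonneg _)]
      · rw [indicator_of_notMem (by simpa using ht)]
        have : ∀ x, q (t, x) = 0 := fun x => hz (not_lt.1 ht)
        simp [this]
    rw [e, integrable_indicator_iff measurableSet_Ioi]
    exact (integrable_sq_mul_exp hQ h.sampling 0 0).1.integral_prod_left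

lemma IsSpectralKernel.integral_mul_translates [SFinite ν] [MeasurableAdd₂ (ℝ × Y)]
    [MeasurableNeg (ℝ × Y)] [((volume : Measure ℝ).prod ν).IsAddLeftInvariant]
    (h : IsSpectralKernel Q ρ ν π q) (hQ : SmoothingAssumption Q) (hπ : π 0 = 0)
    (a b : ℝ × ℝ) :
    ∫ u, q (u - (a.1, π a.2)) * q (u - (b.1, π b.2)) ∂(volume.prod ν) = specCov Q ρ (a - b) := by
  have hint := (integrable_mul_translates (m := volume.prod ν) h.measurable
    (h.integrable_sq hQ hπ) (a.1, π a.2) (b.1, π b.2)).1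
  rw [integral_prod _ hint]
  -- Both factors are nonzero only after the later of the two times. At time `M + t` the ages of the
  -- two kernels add up to `2 t + |a.1 - b.1|`, the exponent appearing in the covariance.
  set M := max a.1 b.1 with hM
  rw [← integral_add_right_eq_self _ M]
  have e : (fun t : ℝ => ∫ x, q ((t + M, x) - (a.1, π a.2)) * q ((t + M, x) - (b.1, π b.2)) ∂ν) =
      (Ioi (0 : ℝ)).indicator fun t => ∫ k, (2 * Real.pi * ρ k) ^ 2 *
        Real.exp (-((2 * t + |a.1 - b.1|) * symbol Q (ρ k))) *
          Real.cos (2 * Real.pi * ρ k * (a.2 - b.2)) := by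
    funext t
    simp only [Prod.mk_sub_mk]
    by_cases ht : 0 < t
    · rw [indicator_of_mem (mem_Ioi.2 ht)]
      have ha : 0 < t + M - a.1 := by linarith [le_max_left a.1 b.1]
      have hb : 0 < t + M - b.1 := by linarith [le_max_right a.1 b.1]
      rw [(h.parseval _ _ a.2 b.2 ha hb).2]
      have : t + M - a.1 + (t + M - b.1) = 2 * t + |a.1 - b.1| := by
        rcases le_total a.1 b.1 with hab | hab
        · rw [hM, max_eq_right hab, abs_of_nonpos (by linarith)]; ring
        · rw [hM, max_eq_left hab, abs_of_nonneg (by linarith)]; ring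
      rw [this]
    · rw [indicator_of_notMem (by simpa using ht)]
      have hz : ∀ x, q (t + M - a.1, x - π a.2) * q (t + M - b.1, x - π b.2) = 0 := by
        intro x
        rcases max_choice a.1 b.1 with hab | hab
        · rw [h.eq_zero (p := (t + M - a.1, x - π a.2))
            (by rw [hM, hab]; simpa using ht), zero_mul]
        · rw [h.eq_zero (p := (t + M - b.1, x - π b.2))
            (by rw [hM, hab]; simpa using ht), mul_zero]
      simp [hz]
  rw [e, integral_indicator measurableSet_Ioi, (integrable_sq_mul_exp hQ h.sampling _ _).2]
  rfl

/-- The lift to space-time of a map in space. -/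
def timeLift {Y : Type*} (π : ℝ → Y) (a : ℝ × ℝ) : ℝ × Y := (a.1, π a.2)

lemma measurable_timeLift {Y : Type*} [MeasurableSpace Y] {π : ℝ → Y} (hπ : Measurable π) :
    Measurable (timeLift π) := by
  unfold timeLift; fun_prop

lemma IsSpectralKernel.integral_sq_liftConv [SFinite ν] [MeasurableAdd₂ (ℝ × Y)]
    [MeasurableNeg (ℝ × Y)] [((volume : Measure ℝ).prod ν).IsAddLeftInvariant]
    (h : IsSpectralKernel Q ρ ν π q) (hQ : SmoothingAssumption Q) (hπ : π 0 = 0)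
    (hπm : Measurable π) {θ : ℝ × ℝ → ℝ} (hθ : MollifierAssumption θ) :
    ∫ u, liftConv (timeLift π) q θ u ^ 2 ∂(volume.prod ν) =
      ∫ p : (ℝ × ℝ) × (ℝ × ℝ), θ p.1 * θ p.2 * specCov Q ρ (p.1 - p.2) := by
  rw [(KPZCoupling.integral_sq_liftConv (measurable_timeLift hπm) h.measurable hθ.measurable
    (h.integrable_sq hQ hπ) hθ.integrable).2]
  refine integral_congr_ae (Eventually.of_forall fun p => ?_)
  dsimp only [timeLift]
  rw [h.integral_mul_translates hQ hπ]

end Slice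

/-- Convergence of the `L²` norms as the frequency sampling becomes exact. -/
lemma tendsto_integral_specCov {Q : Polynomial ℝ} (hQ : SmoothingAssumption Q) {ρ : ℕ → ℝ → ℝ}
    (hρ : ∀ n, IsSampling (ρ n)) (hlim : ∀ k, Tendsto (fun n => ρ n k) atTop (𝓝 k))
    {θ : ℝ × ℝ → ℝ} (hθ : MollifierAssumption θ) :
    Tendsto (fun n => ∫ p : (ℝ × ℝ) × (ℝ × ℝ), θ p.1 * θ p.2 * specCov Q (ρ n) (p.1 - p.2)) atTop
      (𝓝 (∫ p : (ℝ × ℝ) × (ℝ × ℝ), θ p.1 * θ p.2 * specCov Q (fun k => k) (p.1 - p.2))) := by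
  obtain ⟨C, hC, h⟩ := hQ.abs_specCov_le
  refine tendsto_integral_of_dominated_convergence (fun p => ‖θ p.1‖ * ‖θ p.2‖ * C)
    (fun n => ?_) ((hθ.integrable.norm.mul_prod hθ.integrable.norm).mul_const _)
    (fun n => Eventually.of_forall fun p => ?_) (Eventually.of_forall fun p => ?_)
  · have h1 := hθ.measurable
    have h2 := measurable_specCov Q (hρ n)
    exact (((h1.comp measurable_fst).mul (h1.comp measurable_snd)).mul
      (h2.comp (measurable_fst.sub measurable_snd))).aestronglyMeasurable
  · rw [norm_mul, norm_mul]
    exact mul_le_mul_of_nonneg_left (h _ (hρ n) _) (by positivity)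
  · exact (tendsto_specCov hQ hρ hlim _).const_mul _

/-! ### The Green's function on the line -/

/-- The bounds on `k exp(-t Q(2πk))` and its first two derivatives in `k`. -/
lemma SmoothingAssumption.exists_mode_derivatives {Q : Polynomial ℝ}
    (hQ : SmoothingAssumption Q) :
    ∃ C > 0, ∀ t : ℝ, 0 < t → ∃ h₁ h₂ : ℝ → ℝ,
      (∀ k, HasDerivAt (fun k => k * Real.exp (-(t * symbol Q k))) (h₁ k) k) ∧
      (∀ k, HasDerivAt h₁ (h₂ k) k) ∧ Continuous h₂ ∧
      (∀ k, |k * Real.exp (-(t * symbol Q k))| ≤ C * (1 + t) ^ 2 * timeBound t * (1 + k ^ 2)⁻¹) ∧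
      (∀ k, |h₁ k| ≤ C * (1 + t) ^ 2 * timeBound t * (1 + k ^ 2)⁻¹) ∧
      ∀ k, |h₂ k| ≤ C * (1 + t) ^ 2 * timeBound t * (1 + k ^ 2)⁻¹ := by
  obtain ⟨P, R, hP, hPR, c, hc, A, hA, hR, hP1, hP2⟩ := hQ.exists_factor
  obtain ⟨C₀, hC₀, h0⟩ := hQ.pow_mul_exp_symbol_le
  obtain ⟨C₁, hC₁, hmode⟩ := hQ.abs_mul_exp_symbol_le
  have hRpos : ∀ k, 0 < R.eval k := fun k => lt_of_lt_of_le (by positivity) (hR k)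
  obtain ⟨B, hB⟩ := (isCompact_Icc.image_of_continuousOn
    (R.continuous.continuousOn (s := Icc (-1 : ℝ) 1))).bddAbove
  have hB : ∀ k, |k| ≤ 1 → R.eval k ≤ B := fun k hk => hB ⟨k, abs_le.1 hk, rfl⟩
  have hB0 : 0 < B := (hRpos 0).trans_le (hB 0 (by simp))
  -- The first summand serves `|k| ≥ 1`, where powers of `t S(k)` are absorbed by the exponential.
  -- The second serves `|k| ≤ 1`, where `R ≤ B` and the derivatives grow at most quadratically in
  -- `t`; this is the origin of `(1 + t)²`.
  set D := (1 + 3 * A + A ^ 2) * C₀ + (1 + 3 * A * B + A ^ 2 * B ^ 2) with hD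
  have hD0 : 0 < D := by positivity
  refine ⟨C₁ + 2 * D, by positivity, fun t ht => ?_⟩
  have hS : ∀ k, HasDerivAt (symbol Q) (P.derivative.eval k) k := fun k => by
    have := P.hasDerivAt k
    simpa only [hP] using this
  set E : ℝ → ℝ := fun k => Real.exp (-(t * symbol Q k)) with hE
  have hEd : ∀ k, HasDerivAt E (-(t * P.derivative.eval k) * E k) k := fun k => by
    have := (((hS k).const_mul t).neg).exp
    exact this.congr_deriv (by simp only [hE, Pi.neg_apply]; ring)
  have hE0 : ∀ k, 0 < E k := fun k => Real.exp_pos _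
  have hE1 : ∀ k, E k ≤ 1 := fun k =>
    Real.exp_le_one_iff.2 (neg_nonpos.2 (mul_nonneg ht.le (hQ.symbol_nonneg k)))
  have hSf : ∀ k, symbol Q k = k ^ 2 * R.eval k := fun k => by
    rw [← hP, hPR, Polynomial.eval_mul, Polynomial.eval_pow, Polynomial.eval_X]
  have ht' : 0 < t ^ (-(3 / 4) : ℝ) := by positivity
  have hT : 1 ≤ (1 + t) ^ 2 := by nlinarith
  have htb : 1 ≤ timeBound t := by unfold timeBound; linarith
  have hfin : ∀ k z : ℝ, (1 ≤ |k| → z ≤ (1 + 3 * A + A ^ 2) * C₀ * (t ^ (-(3 / 4) : ℝ) *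
      (|k| ^ 3)⁻¹)) → (|k| ≤ 1 → z ≤ (1 + 3 * A * B + A ^ 2 * B ^ 2) * (1 + t) ^ 2) →
      z ≤ (C₁ + 2 * D) * (1 + t) ^ 2 * timeBound t * (1 + k ^ 2)⁻¹ := by
    intro k z h1 h2
    have key : z ≤ 2 * D * (1 + t) ^ 2 * timeBound t * (1 + k ^ 2)⁻¹ := by
      rcases le_total 1 |k| with hk | hk
      · have hk0 : 0 < |k| := by linarith
        have h3 : (|k| ^ 3)⁻¹ ≤ 2 * (1 + k ^ 2)⁻¹ := by
          rw [← one_div, ← div_eq_mul_inv, div_le_div_iff₀ (by positivity) (by positivity),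
            ← sq_abs k]
          nlinarith [mul_le_mul hk hk zero_le_one hk0.le,
            mul_le_mul_of_nonneg_left hk (sq_nonneg |k|)]
        calc z ≤ (1 + 3 * A + A ^ 2) * C₀ * (t ^ (-(3 / 4) : ℝ) * (|k| ^ 3)⁻¹) := h1 hk
          _ ≤ D * (timeBound t * (2 * (1 + k ^ 2)⁻¹)) := by
            refine mul_le_mul ?_ (mul_le_mul ?_ h3 (by positivity) (by linarith))
              (by positivity) hD0.le
            · rw [hD]; exact le_add_of_nonneg_right (by positivity)
            · unfold timeBound; linarith
          _ = 1 * (2 * D * timeBound t * (1 + k ^ 2)⁻¹) := by ring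
          _ ≤ (1 + t) ^ 2 * (2 * D * timeBound t * (1 + k ^ 2)⁻¹) :=
            mul_le_mul_of_nonneg_right hT (by positivity)
          _ = _ := by ring
      · have h3 : 1 ≤ 2 * (1 + k ^ 2)⁻¹ := by
          rw [← div_eq_mul_inv, le_div_iff₀ (by positivity), ← sq_abs]
          nlinarith [abs_nonneg k]
        calc z ≤ (1 + 3 * A * B + A ^ 2 * B ^ 2) * (1 + t) ^ 2 := h2 hk
          _ ≤ D * (1 + t) ^ 2 := by
            refine mul_le_mul_of_nonneg_right ?_ (by positivity)
            rw [hD]; exact le_add_of_nonneg_left (by positivity)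
          _ = D * (1 + t) ^ 2 * 1 * 1 := by ring
          _ ≤ D * (1 + t) ^ 2 * timeBound t * (2 * (1 + k ^ 2)⁻¹) := by gcongr
          _ = _ := by ring
    refine key.trans ?_
    gcongr
    linarith
  -- the derivatives of the symbol are controlled by the symbol itself
  have hy : ∀ k, |t * k * P.derivative.eval k| ≤ A * (t * symbol Q k) := fun k => by
    rw [abs_mul, abs_mul, abs_of_pos ht, hSf, ← sq_abs]
    calc t * |k| * |P.derivative.eval k| ≤ t * |k| * (A * (|k| * R.eval k)) := by
          gcongr; exact hP1 k
      _ = _ := by ring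
  -- The two witnesses come from the product rule with `E' = -t P' E`.
  refine ⟨fun k => (1 - t * k * P.derivative.eval k) * E k, fun k =>
    (-(2 * (t * P.derivative.eval k)) - t * k * P.derivative.derivative.eval k +
      t * k * P.derivative.eval k * (t * P.derivative.eval k)) * E k,
    fun k => ?_, fun k => ?_, ?_, fun k => ?_, fun k => ?_, fun k => ?_⟩
  · exact ((hasDerivAt_id k).mul (hEd k)).congr_deriv (by simp; ring)
  · have hpk : HasDerivAt (fun k => 1 - t * k * P.derivative.eval k)
        (-(t * P.derivative.eval k) - t * k * P.derivative.derivative.eval k) k := by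
      have h1 := (((hasDerivAt_id k).const_mul t).mul (P.derivative.hasDerivAt k)).const_sub 1
      exact h1.congr_deriv (by simp; ring)
    exact (hpk.mul (hEd k)).congr_deriv (by ring)
  · have := continuous_symbol Q
    fun_prop
  · rw [abs_mul, abs_of_pos (Real.exp_pos _)]
    refine (hmode t k ht).trans ?_
    calc C₁ * timeBound t * (1 + k ^ 2)⁻¹ = C₁ * 1 * timeBound t * (1 + k ^ 2)⁻¹ := by ring
      _ ≤ (C₁ + 2 * D) * (1 + t) ^ 2 * timeBound t * (1 + k ^ 2)⁻¹ := by
        have : 0 ≤ timeBound t := by linarith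
        gcongr
        linarith
  · refine hfin k _ (fun hk => ?_) (fun hk => ?_)
    · have e0 := h0 t k ht hk 0 (by norm_num)
      have e1 := h0 t k ht hk 1 (by norm_num)
      rw [pow_zero, one_mul] at e0
      rw [pow_one] at e1
      rw [abs_mul, abs_of_pos (hE0 k)]
      have h1 : |1 - t * k * P.derivative.eval k| ≤ 1 + A * (t * symbol Q k) :=
        (abs_sub _ _).trans (by rw [abs_one]; linarith [hy k])
      calc _ ≤ (1 + A * (t * symbol Q k)) * E k := mul_le_mul_of_nonneg_right h1 (hE0 k).le
        _ = E k + A * (t * symbol Q k * E k) := by ring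
        _ ≤ C₀ * t ^ (-(3 / 4) : ℝ) * (|k| ^ 3)⁻¹ +
            A * (C₀ * t ^ (-(3 / 4) : ℝ) * (|k| ^ 3)⁻¹) :=
          add_le_add e0 (mul_le_mul_of_nonneg_left e1 hA.le)
        _ = (1 + A) * C₀ * (t ^ (-(3 / 4) : ℝ) * (|k| ^ 3)⁻¹) := by ring
        _ ≤ _ := by
          refine mul_le_mul_of_nonneg_right (mul_le_mul_of_nonneg_right ?_ hC₀.le) (by positivity)
          nlinarith [sq_nonneg A]
    · rw [abs_mul, abs_of_pos (hE0 k)]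
      have hS1 : symbol Q k ≤ B := by
        rw [hSf, ← sq_abs]
        calc |k| ^ 2 * R.eval k ≤ 1 ^ 2 * B := by
              have := (hRpos k).le
              have := hB k hk
              gcongr
          _ = B := by ring
      have h1 : |1 - t * k * P.derivative.eval k| ≤ 1 + A * (t * B) :=
        (abs_sub _ _).trans (by
          rw [abs_one]
          have : A * (t * symbol Q k) ≤ A * (t * B) := by gcongr
          linarith [hy k])
      calc _ ≤ (1 + A * (t * B)) * 1 := mul_le_mul h1 (hE1 k) (hE0 k).le (by positivity)
        _ = 1 + A * B * t := by ring
        _ ≤ (1 + 3 * A * B) * (1 + t) ^ 2 := by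
          have hAB : 0 < A * B := by positivity
          nlinarith [mul_pos hAB ht]
        _ ≤ _ := by
          refine mul_le_mul_of_nonneg_right ?_ (by positivity)
          exact le_add_of_nonneg_right (by positivity)
  · refine hfin k _ (fun hk => ?_) (fun hk => ?_)
    · have hk0 : 0 < |k| := by linarith
      have e1 := h0 t k ht hk 1 (by norm_num)
      have e2 := h0 t k ht hk 2 (by norm_num)
      rw [pow_one] at e1
      have a1 : |t * P.derivative.eval k| ≤ A * (t * symbol Q k) := by
        refine le_trans ?_ (hy k)
        rw [mul_assoc, mul_comm k, ← mul_assoc, abs_mul _ k]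
        exact le_mul_of_one_le_right (abs_nonneg _) hk
      have a2 : |t * k * P.derivative.derivative.eval k| ≤ A * (t * symbol Q k) := by
        rw [abs_mul, abs_mul, abs_of_pos ht, hSf, ← sq_abs]
        calc t * |k| * |P.derivative.derivative.eval k| ≤ t * |k| ^ 2 * (A * R.eval k) := by
              gcongr
              · exact le_self_pow₀ hk two_ne_zero
              · exact hP2 k
          _ = _ := by ring
      have a3 : |t * k * P.derivative.eval k * (t * P.derivative.eval k)| ≤
          A ^ 2 * (t * symbol Q k) ^ 2 := by
        rw [abs_mul]
        calc _ ≤ (A * (t * symbol Q k)) * (A * (t * symbol Q k)) :=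
              mul_le_mul (hy k) a1 (abs_nonneg _) ((abs_nonneg _).trans (hy k))
          _ = _ := by ring
      have h1 : |-(2 * (t * P.derivative.eval k)) - t * k * P.derivative.derivative.eval k +
          t * k * P.derivative.eval k * (t * P.derivative.eval k)| ≤
          3 * A * (t * symbol Q k) + A ^ 2 * (t * symbol Q k) ^ 2 := by
        refine (abs_add_le _ _).trans ?_
        have := abs_sub (-(2 * (t * P.derivative.eval k))) (t * k * P.derivative.derivative.eval k)
        rw [abs_neg, abs_mul 2, abs_two] at this
        linarith
      rw [abs_mul, abs_of_pos (hE0 k)]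
      calc _ ≤ (3 * A * (t * symbol Q k) + A ^ 2 * (t * symbol Q k) ^ 2) * E k :=
            mul_le_mul_of_nonneg_right h1 (hE0 k).le
        _ = 3 * A * (t * symbol Q k * E k) + A ^ 2 * ((t * symbol Q k) ^ 2 * E k) := by ring
        _ ≤ 3 * A * (C₀ * t ^ (-(3 / 4) : ℝ) * (|k| ^ 3)⁻¹) +
            A ^ 2 * (C₀ * t ^ (-(3 / 4) : ℝ) * (|k| ^ 3)⁻¹) :=
          add_le_add (mul_le_mul_of_nonneg_left e1 (by positivity))
            (mul_le_mul_of_nonneg_left e2 (by positivity))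
        _ = (3 * A + A ^ 2) * C₀ * (t ^ (-(3 / 4) : ℝ) * (|k| ^ 3)⁻¹) := by ring
        _ ≤ _ := by gcongr; linarith
    · have hRk := hB k hk
      have a1 : |t * P.derivative.eval k| ≤ t * (A * B) := by
        rw [abs_mul, abs_of_pos ht]
        have : |k| * R.eval k ≤ 1 * B := mul_le_mul hk hRk (hRpos k).le zero_le_one
        rw [one_mul] at this
        exact mul_le_mul_of_nonneg_left ((hP1 k).trans (by gcongr)) ht.le
      have a2 : |t * k * P.derivative.derivative.eval k| ≤ t * (A * B) := by
        rw [abs_mul, abs_mul, abs_of_pos ht]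
        calc t * |k| * |P.derivative.derivative.eval k| ≤ t * 1 * (A * B) := by
              gcongr
              exact (hP2 k).trans (by gcongr)
          _ = _ := by ring
      have a3 : |t * k * P.derivative.eval k * (t * P.derivative.eval k)| ≤ (t * (A * B)) ^ 2 := by
        rw [abs_mul, sq]
        refine mul_le_mul ?_ a1 (abs_nonneg _) (by positivity)
        rw [mul_assoc, mul_comm k, ← mul_assoc, abs_mul _ k]
        exact (mul_le_of_le_one_right (abs_nonneg _) hk).trans a1
      have h1 : |-(2 * (t * P.derivative.eval k)) - t * k * P.derivative.derivative.eval k +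
          t * k * P.derivative.eval k * (t * P.derivative.eval k)| ≤
          3 * (t * (A * B)) + (t * (A * B)) ^ 2 := by
        refine (abs_add_le _ _).trans ?_
        have := abs_sub (-(2 * (t * P.derivative.eval k))) (t * k * P.derivative.derivative.eval k)
        rw [abs_neg, abs_mul 2, abs_two] at this
        linarith
      rw [abs_mul, abs_of_pos (hE0 k)]
      have hAB : 0 < A * B := by positivity
      calc _ ≤ (3 * (t * (A * B)) + (t * (A * B)) ^ 2) * 1 :=
            mul_le_mul h1 (hE1 k) (hE0 k).le (by positivity)
        _ = 3 * (A * B) * t + (A * B) ^ 2 * t ^ 2 := by ring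
        _ ≤ 3 * (A * B) * (1 + t) ^ 2 + (A * B) ^ 2 * (1 + t) ^ 2 := by
          gcongr <;> nlinarith
        _ ≤ (1 + 3 * A * B + A ^ 2 * B ^ 2) * (1 + t) ^ 2 := by nlinarith

lemma SmoothingAssumption.exp_symbol_le {Q : Polynomial ℝ} (hQ : SmoothingAssumption Q) :
    ∃ C > 0, ∀ ρ, IsSampling ρ → ∀ t k : ℝ, 0 < t →
      Real.exp (-(t * symbol Q (ρ k))) ≤ C * timeBound t * (1 + k ^ 2)⁻¹ := by
  obtain ⟨C, hC, h⟩ := hQ.abs_mul_exp_symbol_le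
  refine ⟨3 * (C + 2), by positivity, fun ρ hρ t k ht => ?_⟩
  have htb : 1 ≤ timeBound t := by
    unfold timeBound
    have : 0 < t ^ (-(3 / 4) : ℝ) := by positivity
    linarith
  have key : ∀ k, Real.exp (-(t * symbol Q k)) ≤ (C + 2) * timeBound t * (1 + k ^ 2)⁻¹ := by
    intro k
    rcases le_total 1 |k| with hk | hk
    · calc Real.exp (-(t * symbol Q k)) ≤ |k| * Real.exp (-(t * symbol Q k)) :=
            le_mul_of_one_le_left (Real.exp_pos _).le hk
        _ ≤ C * timeBound t * (1 + k ^ 2)⁻¹ := h t k ht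
        _ ≤ _ := by gcongr; linarith
    · have h3 : 1 ≤ 2 * (1 + k ^ 2)⁻¹ := by
        rw [← div_eq_mul_inv, le_div_iff₀ (by positivity), ← sq_abs]
        nlinarith [abs_nonneg k]
      calc Real.exp (-(t * symbol Q k)) ≤ 1 :=
            Real.exp_le_one_iff.2 (neg_nonpos.2 (mul_nonneg ht.le (hQ.symbol_nonneg k)))
        _ ≤ 2 * (1 + k ^ 2)⁻¹ := h3
        _ = 2 * 1 * (1 + k ^ 2)⁻¹ := by ring
        _ ≤ (C + 2) * timeBound t * (1 + k ^ 2)⁻¹ := by gcongr; linarith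
  calc _ ≤ (C + 2) * timeBound t * (1 + ρ k ^ 2)⁻¹ := key _
    _ ≤ (C + 2) * timeBound t * (3 * (1 + k ^ 2)⁻¹) :=
      mul_le_mul_of_nonneg_left (hρ.inv_le k) (by positivity)
    _ = _ := by ring

lemma integrable_exp_symbol_mul_cos {Q : Polynomial ℝ} (hQ : SmoothingAssumption Q) {ρ : ℝ → ℝ}
    (hρ : IsSampling ρ) {t : ℝ} (ht : 0 < t) (x : ℝ) :
    Integrable fun k => Real.exp (-(t * symbol Q (ρ k))) * Real.cos (2 * Real.pi * ρ k * x) := by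
  obtain ⟨C, hC, h⟩ := hQ.exp_symbol_le
  refine (integrable_inv_one_add_sq.const_mul (C * timeBound t)).mono' ?_
    (Eventually.of_forall fun k => ?_)
  · have h1 := (continuous_symbol Q).measurable
    have h2 := hρ.measurable
    exact Measurable.aestronglyMeasurable (by fun_prop)
  · rw [norm_mul, Real.norm_of_nonneg (Real.exp_pos _).le]
    exact (mul_le_of_le_one_right (Real.exp_pos _).le (Real.abs_cos_le_one _)).trans
      (h ρ hρ t k ht)

/-- Differentiation of the sampled heat kernel in space. -/
lemma hasDerivAt_specHeat {Q : Polynomial ℝ} (hQ : SmoothingAssumption Q) {ρ : ℝ → ℝ}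
    (hρ : IsSampling ρ) {t : ℝ} (ht : 0 < t) (x : ℝ) :
    HasDerivAt (fun x => ∫ k, Real.exp (-(t * symbol Q (ρ k))) *
      Real.cos (2 * Real.pi * ρ k * x)) (specKernel Q ρ (t, x)) x := by
  obtain ⟨C, hC, h⟩ := hQ.abs_gradMode_sampled_le
  have := (hasDerivAt_integral_of_dominated_loc_of_deriv_le (x₀ := x) (s := univ) univ_mem
    (μ := volume) (F := fun x k => Real.exp (-(t * symbol Q (ρ k))) *
      Real.cos (2 * Real.pi * ρ k * x))
    (F' := fun x k => -gradMode Q t x (ρ k))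
    (bound := fun k => C * timeBound t * (1 + k ^ 2)⁻¹)
    (Eventually.of_forall fun x => (integrable_exp_symbol_mul_cos hQ hρ ht x).1)
    (integrable_exp_symbol_mul_cos hQ hρ ht x)
    (integrable_gradMode hQ hρ ht x).1.neg
    (Eventually.of_forall fun k x _ => by
      rw [norm_neg]; exact h ρ hρ t x k ht)
    (integrable_inv_one_add_sq.const_mul _)
    (Eventually.of_forall fun k x _ => ?_)).2
  · rw [integral_neg] at this
    rwa [specKernel, if_pos ht]
  · have h1 := (((hasDerivAt_id x).const_mul (2 * Real.pi * ρ k)).cos).const_mul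
      (Real.exp (-(t * symbol Q (ρ k))))
    refine h1.congr_deriv ?_
    simp only [gradMode, id]
    ring

/-! ### The kernel on the line -/

lemma greenLineDeriv_eq {Q : Polynomial ℝ} (hQ : SmoothingAssumption Q) (p : ℝ × ℝ) :
    greenLineDeriv Q p = specKernel Q (fun k => k) p := by
  obtain ⟨t, x⟩ := p
  unfold greenLineDeriv
  by_cases ht : 0 < t
  · rw [← (hasDerivAt_specHeat hQ IsSampling.id ht x).deriv]
    congr 1
    funext x
    simp only [greenLine, if_pos ht]
    have hi : Integrable fun k : ℝ => (Real.exp (-(t * Q.eval (-(2 * Real.pi * k)))) : ℂ) *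
        Complex.exp (2 * Real.pi * Complex.I * k * x) := by
      refine (integrable_exp_symbol_mul_cos hQ IsSampling.id ht 0).mono ?_ ?_
      · exact Continuous.aestronglyMeasurable (by fun_prop)
      · refine Eventually.of_forall fun k => ?_
        rw [norm_mul, show (2 * Real.pi * Complex.I * k * x : ℂ) =
          ((2 * Real.pi * k * x : ℝ) : ℂ) * Complex.I by push_cast; ring,
          Complex.norm_exp_ofReal_mul_I, mul_one, hQ.even, Complex.norm_real]
        simp [symbol]
    have hre := integral_re hi
    simp only [RCLike.re_to_complex] at hre
    rw [← hre]
    refine integral_congr_ae (Eventually.of_forall fun k => ?_)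
    dsimp only
    rw [Complex.re_ofReal_mul, show (2 * Real.pi * Complex.I * k * x : ℂ) =
      ((2 * Real.pi * k * x : ℝ) : ℂ) * Complex.I by push_cast; ring, Complex.exp_ofReal_mul_I_re,
      hQ.even]
    rfl
  · have : ∀ x, greenLine Q t x = 0 := fun x => if_neg ht
    simp [specKernel, ht, this]

/-- The mode `k exp(-t Q(2πk))` as a complex function. -/
def complexMode (Q : Polynomial ℝ) (t k : ℝ) : ℂ := ((k * Real.exp (-(t * symbol Q k)) : ℝ) : ℂ)

lemma integrable_mul_exp_symbol {Q : Polynomial ℝ} (hQ : SmoothingAssumption Q) {t : ℝ}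
    (ht : 0 < t) : Integrable fun k => k * Real.exp (-(t * symbol Q k)) := by
  obtain ⟨C, hC, h⟩ := hQ.abs_mul_exp_symbol_le
  refine (integrable_inv_one_add_sq.const_mul (C * timeBound t)).mono' ?_
    (Eventually.of_forall fun k => ?_)
  · have := continuous_symbol Q
    exact Continuous.aestronglyMeasurable (by fun_prop)
  · rw [norm_mul, Real.norm_of_nonneg (Real.exp_pos _).le]
    exact h t k ht

lemma integrable_complexMode {Q : Polynomial ℝ} (hQ : SmoothingAssumption Q) {t : ℝ}
    (ht : 0 < t) : Integrable (complexMode Q t) :=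
  (integrable_mul_exp_symbol hQ ht).ofReal

lemma continuous_complexMode (Q : Polynomial ℝ) (t : ℝ) : Continuous (complexMode Q t) := by
  have := continuous_symbol Q
  unfold complexMode
  fun_prop

/-- The mode is odd in `k`, so only the sine part of its inverse transform survives, with a factor
`i`; multiplication by `2πi` makes it real and produces the minus sign in `specKernel`. -/
lemma fourierInv_complexMode {Q : Polynomial ℝ} (hQ : SmoothingAssumption Q) {t : ℝ}
    (ht : 0 < t) (x : ℝ) :
    2 * Real.pi * Complex.I * 𝓕⁻ (complexMode Q t) x =
      (specKernel Q (fun k => k) (t, x) : ℂ) := by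
  set h : ℝ → ℝ := fun k => k * Real.exp (-(t * symbol Q k)) with hh
  have hi : Integrable h := integrable_mul_exp_symbol hQ ht
  have hodd : ∫ k, h k * Real.cos (2 * Real.pi * k * x) = 0 := by
    have := integral_neg_eq_self (fun k => h k * Real.cos (2 * Real.pi * k * x)) volume
    have e : ∀ k, h (-k) * Real.cos (2 * Real.pi * -k * x) =
        -(h k * Real.cos (2 * Real.pi * k * x)) := by
      intro k
      simp only [hh, hQ.symbol_neg]
      rw [show 2 * Real.pi * -k * x = -(2 * Real.pi * k * x) by ring, Real.cos_neg]
      ring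
    simp only [e, integral_neg] at this
    linarith
  have hic : Integrable fun k => h k * Real.cos (2 * Real.pi * k * x) := by
    refine hi.mono (hi.1.mul (Continuous.aestronglyMeasurable (by fun_prop)))
      (Eventually.of_forall fun k => ?_)
    rw [norm_mul]
    exact mul_le_of_le_one_right (norm_nonneg _) (Real.abs_cos_le_one _)
  have his : Integrable fun k => h k * Real.sin (2 * Real.pi * k * x) := by
    refine hi.mono (hi.1.mul (Continuous.aestronglyMeasurable (by fun_prop)))
      (Eventually.of_forall fun k => ?_)
    rw [norm_mul]
    exact mul_le_of_le_one_right (norm_nonneg _) (Real.abs_sin_le_one _)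
  have hF : 𝓕⁻ (complexMode Q t) x =
      ((∫ k, h k * Real.sin (2 * Real.pi * k * x) : ℝ) : ℂ) * Complex.I := by
    rw [Real.fourierInv_eq']
    have e : ∀ k : ℝ, Complex.exp (((2 * Real.pi * inner ℝ k x : ℝ) : ℂ) * Complex.I) •
        complexMode Q t k = ((h k * Real.cos (2 * Real.pi * k * x) : ℝ) : ℂ) +
          ((h k * Real.sin (2 * Real.pi * k * x) : ℝ) : ℂ) * Complex.I := by
      intro k
      have : (inner ℝ k x : ℝ) = k * x := by simp [mul_comm]
      rw [this, Complex.exp_mul_I, smul_eq_mul, complexMode, ← Complex.ofReal_cos,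
        ← Complex.ofReal_sin, ← mul_assoc]
      push_cast [hh]
      ring
    simp only [e]
    rw [integral_add hic.ofReal (his.ofReal.mul_const _), integral_mul_const,
      integral_complex_ofReal, integral_complex_ofReal, hodd]
    simp
  rw [hF, specKernel, if_pos ht]
  have e : ∫ k, gradMode Q t x k = 2 * Real.pi * ∫ k, h k * Real.sin (2 * Real.pi * k * x) := by
    rw [← integral_const_mul]
    refine integral_congr_ae (Eventually.of_forall fun k => ?_)
    simp only [gradMode, hh]
    ring
  dsimp only
  rw [e]
  push_cast
  linear_combination (2 * Real.pi * ((∫ k, h k * Real.sin (2 * Real.pi * k * x) : ℝ) : ℂ)) *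
    Complex.I_mul_I

lemma norm_fourier_le_integral (f : ℝ → ℂ) (x : ℝ) : ‖𝓕 f x‖ ≤ ∫ v, ‖f v‖ :=
  VectorFourier.norm_fourierIntegral_le_integral_norm _ _ _ _ _

/-- Spatial decay of the kernel on the line, with a locally integrable constant. -/
lemma SmoothingAssumption.exists_abs_lineKernel_le {Q : Polynomial ℝ}
    (hQ : SmoothingAssumption Q) :
    ∃ C > 0, ∀ t x : ℝ, 0 < t → |specKernel Q (fun k => k) (t, x)| ≤
      C * (1 + t) ^ 2 * timeBound t * (1 + x ^ 2)⁻¹ := by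
  obtain ⟨C, hC, h⟩ := hQ.exists_mode_derivatives
  refine ⟨2 * Real.pi * (2 * C * Real.pi), by positivity, fun t x ht => ?_⟩
  obtain ⟨h₁, h₂, hd₁, hd₂, hc₂, b₀, b₁, b₂⟩ := h t ht
  set D := C * (1 + t) ^ 2 * timeBound t with hD
  have hD0 : 0 ≤ D := mul_nonneg (by positivity) (timeBound_nonneg ht)
  have hbd : Integrable fun k : ℝ => D * (1 + k ^ 2)⁻¹ := integrable_inv_one_add_sq.const_mul D
  have hint : ∀ g : ℝ → ℝ, Continuous g → (∀ k, |g k| ≤ D * (1 + k ^ 2)⁻¹) →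
      Integrable (fun k => (g k : ℂ)) ∧ ∫ k, ‖(g k : ℂ)‖ ≤ D * Real.pi := by
    intro g hg hb
    have hi : Integrable g := hbd.mono' hg.aestronglyMeasurable (Eventually.of_forall hb)
    refine ⟨hi.ofReal, ?_⟩
    simp only [Complex.norm_real]
    refine (integral_mono hi.norm hbd hb).trans (le_of_eq ?_)
    rw [integral_const_mul, integral_univ_inv_one_add_sq]
  have hS := continuous_symbol Q
  obtain ⟨i₀, j₀⟩ := hint (fun k => k * Real.exp (-(t * symbol Q k))) (by fun_prop) b₀
  obtain ⟨i₁, -⟩ := hint h₁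
    (continuous_iff_continuousAt.2 fun k => (hd₂ k).continuousAt) b₁
  obtain ⟨i₂, j₂⟩ := hint h₂ hc₂ b₂
  have D₀ : ∀ k, HasDerivAt (fun k : ℝ => ((k * Real.exp (-(t * symbol Q k)) : ℝ) : ℂ))
      (h₁ k : ℂ) k := fun k => (hd₁ k).ofReal_comp
  have D₁ : ∀ k, HasDerivAt (fun k : ℝ => (h₁ k : ℂ)) (h₂ k : ℂ) k := fun k =>
    (hd₂ k).ofReal_comp
  have e₀ : deriv (fun k : ℝ => ((k * Real.exp (-(t * symbol Q k)) : ℝ) : ℂ)) =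
      fun k => (h₁ k : ℂ) := funext fun k => (D₀ k).deriv
  have e₁ : deriv (fun k : ℝ => (h₁ k : ℂ)) = fun k => (h₂ k : ℂ) :=
    funext fun k => (D₁ k).deriv
  have F₀ := Real.fourier_deriv i₀ (fun k => (D₀ k).differentiableAt) (by rw [e₀]; exact i₁)
  have F₁ := Real.fourier_deriv i₁ (fun k => (D₁ k).differentiableAt) (by rw [e₁]; exact i₂)
  rw [e₀] at F₀
  rw [e₁] at F₁
  -- Transforming two derivatives multiplies by `(2πix)²`, while the transform is bounded by the
  -- `L¹` norm of the second derivative: this is the `1 / x²` decay.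
  have hx2 : (2 * Real.pi * x) ^ 2 * ‖𝓕 (complexMode Q t) (-x)‖ ≤ D * Real.pi := by
    have := norm_fourier_le_integral (fun k => (h₂ k : ℂ)) (-x)
    rw [F₁] at this
    simp only [F₀, norm_smul] at this
    refine le_trans (le_of_eq ?_) (this.trans j₂)
    rw [show complexMode Q t = fun k => ((k * Real.exp (-(t * symbol Q k)) : ℝ) : ℂ) from rfl]
    simp only [norm_mul, Complex.norm_real, Complex.norm_I, Complex.norm_ofNat,
      Real.norm_eq_abs, abs_neg, mul_one, abs_of_pos Real.pi_pos, ← mul_assoc]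
    rw [mul_pow, ← sq_abs x]
    ring
  have hx0 : ‖𝓕 (complexMode Q t) (-x)‖ ≤ D * Real.pi :=
    (norm_fourier_le_integral _ _).trans j₀
  have hsum : (1 + x ^ 2) * ‖𝓕 (complexMode Q t) (-x)‖ ≤ 2 * (D * Real.pi) := by
    have hpi : (1 : ℝ) ≤ (2 * Real.pi) ^ 2 := by nlinarith [Real.pi_gt_three]
    have : x ^ 2 * ‖𝓕 (complexMode Q t) (-x)‖ ≤
        (2 * Real.pi * x) ^ 2 * ‖𝓕 (complexMode Q t) (-x)‖ := by
      refine mul_le_mul_of_nonneg_right ?_ (norm_nonneg _)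
      rw [mul_pow]
      exact le_mul_of_one_le_left (sq_nonneg x) hpi
    linarith
  have hnorm : |specKernel Q (fun k => k) (t, x)| =
      2 * Real.pi * ‖𝓕 (complexMode Q t) (-x)‖ := by
    rw [← Real.norm_eq_abs, ← Complex.norm_real, ← fourierInv_complexMode hQ ht x,
      Real.fourierInv_eq_fourier_neg]
    simp [abs_of_pos Real.pi_pos]
  rw [hnorm, show 2 * Real.pi * (2 * C * Real.pi) * (1 + t) ^ 2 * timeBound t * (1 + x ^ 2)⁻¹ =
    2 * Real.pi * (2 * (D * Real.pi) * (1 + x ^ 2)⁻¹) by rw [hD]; ring]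
  refine mul_le_mul_of_nonneg_left ?_ (by positivity)
  rw [← div_eq_mul_inv, le_div_iff₀ (by positivity), mul_comm]
  exact hsum

lemma integrable_lineKernel_slice {Q : Polynomial ℝ} (hQ : SmoothingAssumption Q) {t : ℝ}
    (ht : 0 < t) : Integrable fun x => specKernel Q (fun k => k) (t, x) := by
  obtain ⟨C, hC, h⟩ := hQ.exists_abs_lineKernel_le
  exact (integrable_inv_one_add_sq.const_mul (C * (1 + t) ^ 2 * timeBound t)).mono'
    ((measurable_specKernel Q IsSampling.id).comp
      (measurable_const.prodMk measurable_id)).aestronglyMeasurable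
    (Eventually.of_forall fun x => h t x ht)

/-- Fourier inversion for the kernel on the line, in real form. -/
lemma integral_lineKernel_mul_trig {Q : Polynomial ℝ} (hQ : SmoothingAssumption Q) {t : ℝ}
    (ht : 0 < t) (k : ℝ) :
    ∫ x, specKernel Q (fun k => k) (t, x) * Real.cos (2 * Real.pi * k * x) = 0 ∧
    ∫ x, specKernel Q (fun k => k) (t, x) * Real.sin (2 * Real.pi * k * x) =
      -(2 * Real.pi * k * Real.exp (-(t * symbol Q k))) := by
  set q : ℝ → ℝ := fun x => specKernel Q (fun k => k) (t, x) with hq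
  have hqi : Integrable q := integrable_lineKernel_slice hQ ht
  have hpi : (2 * Real.pi * Complex.I : ℂ) ≠ 0 := Complex.two_pi_I_ne_zero
  have hFinv : ∀ x, 𝓕⁻ (complexMode Q t) x = (2 * Real.pi * Complex.I : ℂ)⁻¹ * (q x : ℂ) := by
    intro x
    rw [hq, ← fourierInv_complexMode hQ ht x, inv_mul_cancel_left₀ hpi]
  have hFi : Integrable (𝓕⁻ (complexMode Q t)) := by
    rw [show 𝓕⁻ (complexMode Q t) = fun x => (2 * Real.pi * Complex.I : ℂ)⁻¹ * (q x : ℂ) from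
      funext hFinv]
    exact hqi.ofReal.const_mul _
  have hFi' : Integrable (𝓕 (complexMode Q t)) := by
    have := hFi.comp_neg
    refine this.congr (Eventually.of_forall fun x => ?_)
    dsimp only
    rw [Real.fourierInv_eq_fourier_neg, neg_neg]
  -- Inversion applies because the mode is continuous and integrable and its transform is
  -- integrable, the latter by the `1 / x²` decay of the kernel.
  have hinv := congrFun (Continuous.fourier_fourierInv_eq (continuous_complexMode Q t)
    (integrable_complexMode hQ ht) hFi') k
  have hic : Integrable fun x => q x * Real.cos (2 * Real.pi * k * x) := by
    refine hqi.mono (hqi.1.mul (Continuous.aestronglyMeasurable (by fun_prop)))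
      (Eventually.of_forall fun k => ?_)
    rw [norm_mul]
    exact mul_le_of_le_one_right (norm_nonneg _) (Real.abs_cos_le_one _)
  have his : Integrable fun x => q x * Real.sin (2 * Real.pi * k * x) := by
    refine hqi.mono (hqi.1.mul (Continuous.aestronglyMeasurable (by fun_prop)))
      (Eventually.of_forall fun k => ?_)
    rw [norm_mul]
    exact mul_le_of_le_one_right (norm_nonneg _) (Real.abs_sin_le_one _)
  rw [Real.fourier_real_eq_integral_exp_smul] at hinv
  have e : ∀ x : ℝ, Complex.exp (((-2 * Real.pi * x * k : ℝ) : ℂ) * Complex.I) •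
      𝓕⁻ (complexMode Q t) x = (2 * Real.pi * Complex.I : ℂ)⁻¹ *
        (((q x * Real.cos (2 * Real.pi * k * x) : ℝ) : ℂ) -
          ((q x * Real.sin (2 * Real.pi * k * x) : ℝ) : ℂ) * Complex.I) := by
    intro x
    rw [hFinv, show -2 * Real.pi * x * k = -(2 * Real.pi * k * x) by ring, Complex.exp_mul_I,
      ← Complex.ofReal_cos, ← Complex.ofReal_sin, Real.cos_neg, Real.sin_neg, smul_eq_mul]
    push_cast
    ring
  simp only [e] at hinv
  rw [integral_const_mul, integral_sub hic.ofReal (his.ofReal.mul_const _), integral_mul_const,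
    integral_complex_ofReal, integral_complex_ofReal, inv_mul_eq_iff_eq_mul₀ hpi,
    complexMode] at hinv
  rw [mul_assoc (2 * Real.pi) k]
  generalize k * Real.exp (-(t * symbol Q k)) = z at hinv ⊢
  have hre := congrArg Complex.re hinv
  have him := congrArg Complex.im hinv
  simp at hre him
  exact ⟨hre, by linarith⟩

/-- The slices of the kernel on the line satisfy the spectral covariance identity. -/
lemma isSpectralKernel_line {Q : Polynomial ℝ} (hQ : SmoothingAssumption Q) :
    IsSpectralKernel Q (fun k => k) (volume : Measure ℝ) (fun x => x)
      (specKernel Q fun k => k) where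
  measurable := measurable_specKernel Q IsSampling.id
  apply_proj _ _ := rfl
  surjective := Function.surjective_id
  sampling := IsSampling.id
  parseval := by
    intro t t' a b ht ht'
    obtain ⟨C, hC, hCb⟩ := hQ.abs_specKernel_le
    set q : ℝ → ℝ := fun x => specKernel Q (fun k => k) (t, x) with hq
    have hqi : Integrable q := integrable_lineKernel_slice hQ ht
    have hqm : Measurable q := (measurable_specKernel Q IsSampling.id).comp
      (measurable_const.prodMk measurable_id)
    refine ⟨?_, ?_⟩
    · refine Integrable.mul_bdd (c := C * timeBound t') (hqi.comp_sub_right a) ?_ ?_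
      · exact ((measurable_specKernel Q IsSampling.id).comp
          (measurable_const.prodMk (measurable_id.sub_const b))).aestronglyMeasurable
      · exact Eventually.of_forall fun x => hCb _ IsSampling.id _ ht'
    · have hshift : ∫ x, specKernel Q (fun k => k) (t, x - a) *
          specKernel Q (fun k => k) (t', x - b) =
          ∫ x, q x * specKernel Q (fun k => k) (t', x + a - b) := by
        rw [← integral_add_right_eq_self _ a]
        simp [hq]
      -- Only the second slice is expanded in frequencies, so Fubini needs just an integrable slice
      -- times an integrable mode. The first slice is then tested against sines and cosines, which
      -- Fourier inversion evaluates.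
      have hm2 : Integrable (fun p : ℝ × ℝ => q p.1 * gradMode Q t' (p.1 + a - b) p.2)
          (volume.prod volume) := by
        have hbase : Integrable (fun p : ℝ × ℝ => q p.1 * (2 * Real.pi * (p.2 *
            Real.exp (-(t' * symbol Q p.2))))) (volume.prod volume) :=
          hqi.mul_prod ((integrable_mul_exp_symbol hQ ht').const_mul _)
        refine hbase.mono ?_ (Eventually.of_forall fun p => ?_)
        · have := continuous_symbol Q
          refine Measurable.aestronglyMeasurable ((hqm.comp measurable_fst).mul ?_)
          exact Continuous.measurable (by unfold gradMode; fun_prop)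
        · rw [norm_mul, norm_mul]
          refine mul_le_mul_of_nonneg_left ?_ (norm_nonneg _)
          unfold gradMode
          rw [norm_mul, mul_assoc (2 * Real.pi)]
          exact mul_le_of_le_one_right (norm_nonneg _) (Real.abs_sin_le_one _)
      have hexp : ∀ x, q x * specKernel Q (fun k => k) (t', x + a - b) =
          -∫ k, q x * gradMode Q t' (x + a - b) k := by
        intro x
        rw [specKernel, if_pos ht', integral_const_mul, mul_neg]
      rw [hshift]
      simp only [hexp]
      rw [integral_neg, integral_integral_swap hm2, ← integral_neg]
      refine integral_congr_ae (Eventually.of_forall fun k => ?_)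
      dsimp only
      obtain ⟨hcos, hsin⟩ := integral_lineKernel_mul_trig hQ ht k
      have hic : Integrable fun x => q x * Real.cos (2 * Real.pi * k * x) := by
        refine hqi.mono (hqi.1.mul (Continuous.aestronglyMeasurable (by fun_prop)))
          (Eventually.of_forall fun k => ?_)
        rw [norm_mul]
        exact mul_le_of_le_one_right (norm_nonneg _) (Real.abs_cos_le_one _)
      have his : Integrable fun x => q x * Real.sin (2 * Real.pi * k * x) := by
        refine hqi.mono (hqi.1.mul (Continuous.aestronglyMeasurable (by fun_prop)))
          (Eventually.of_forall fun k => ?_)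
        rw [norm_mul]
        exact mul_le_of_le_one_right (norm_nonneg _) (Real.abs_sin_le_one _)
      have e : ∀ x, q x * gradMode Q t' (x + a - b) k =
          2 * Real.pi * k * Real.exp (-(t' * symbol Q k)) * Real.cos (2 * Real.pi * k * (a - b)) *
            (q x * Real.sin (2 * Real.pi * k * x)) +
          2 * Real.pi * k * Real.exp (-(t' * symbol Q k)) * Real.sin (2 * Real.pi * k * (a - b)) *
            (q x * Real.cos (2 * Real.pi * k * x)) := by
        intro x
        rw [gradMode, show 2 * Real.pi * k * (x + a - b) =
          2 * Real.pi * k * x + 2 * Real.pi * k * (a - b) by ring, Real.sin_add]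
        ring
      simp only [e]
      rw [integral_add (his.const_mul _) (hic.const_mul _), integral_const_mul,
        integral_const_mul, hcos, hsin,
        show -((t + t') * symbol Q k) = -(t * symbol Q k) + -(t' * symbol Q k) by ring,
        Real.exp_add]
      ring

/-! ### Riemann sums as sampled integrals -/

/-- Rounding down to the lattice `ε ℤ`. -/
def latticeRound (ε : ℝ) (k : ℝ) : ℝ := ε * ⌊k / ε⌋

lemma abs_latticeRound_sub_le {ε : ℝ} (hε : 0 < ε) (k : ℝ) : |latticeRound ε k - k| ≤ ε := by
  have h1 := Int.floor_le (k / ε)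
  have h2 := Int.lt_floor_add_one (k / ε)
  rw [le_div_iff₀ hε] at h1
  rw [div_lt_iff₀ hε] at h2
  unfold latticeRound
  rw [abs_le]
  constructor <;> nlinarith

lemma isSampling_latticeRound {ε : ℝ} (hε : 0 < ε) (hε1 : ε ≤ 1) :
    IsSampling (latticeRound ε) where
  measurable := by
    unfold latticeRound
    have : Measurable fun k : ℝ => ⌊k / ε⌋ := Int.measurable_floor.comp (measurable_id.div_const ε)
    fun_prop
  abs_sub_le k := (abs_latticeRound_sub_le hε k).trans hε1

lemma floor_div_eq_iff {ε : ℝ} (hε : 0 < ε) {k : ℝ} {j : ℤ} :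
    ⌊k / ε⌋ = j ↔ k ∈ Ico (ε * j) (ε * j + ε) := by
  rw [Int.floor_eq_iff, le_div_iff₀ hε, div_lt_iff₀ hε, mem_Ico]
  constructor <;> rintro ⟨h1, h2⟩ <;> constructor <;> linarith

/-- The rounded integrand is constant on the cells `[εj, εj + ε)`, which tile the line and have
length `ε`. -/
lemma hasSum_latticeRound {ε : ℝ} (hε : 0 < ε) {g : ℝ → ℝ}
    (hg : Integrable fun k => g (latticeRound ε k)) :
    HasSum (fun j : ℤ => ε * g (ε * j)) (∫ k, g (latticeRound ε k)) := by
  have hU : ⋃ j : ℤ, Ico (ε * j) (ε * j + ε) = univ :=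
    eq_univ_of_forall fun k => mem_iUnion.2 ⟨⌊k / ε⌋, (floor_div_eq_iff hε).1 rfl⟩
  have hd : Pairwise (Function.onFun Disjoint fun j : ℤ => Ico (ε * (j : ℝ)) (ε * j + ε)) := by
    intro i j hij
    refine Set.disjoint_left.2 fun k h1 h2 => hij ?_
    rw [← (floor_div_eq_iff hε).2 h1, ← (floor_div_eq_iff hε).2 h2]
  have := hasSum_integral_iUnion (μ := volume) (f := fun k => g (latticeRound ε k))
    (s := fun j : ℤ => Ico (ε * (j : ℝ)) (ε * j + ε)) (fun j => measurableSet_Ico) hd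
    (by rw [hU]; exact hg.integrableOn)
  rw [hU, setIntegral_univ] at this
  refine this.congr_fun fun j => ?_
  rw [setIntegral_congr_fun (g := fun _ => g (ε * j)) measurableSet_Ico]
  · simp [hε.le]
  · intro k hk
    dsimp only [latticeRound]
    rw [(floor_div_eq_iff hε).2 hk]

lemma integral_ite_floor {ε : ℝ} (hε : 0 < ε) (j : ℤ) (c : ℝ) :
    Integrable (fun k : ℝ => if ⌊k / ε⌋ = j then c else 0) ∧
    ∫ k : ℝ, (if ⌊k / ε⌋ = j then c else 0) = ε * c := by
  have e : (fun k : ℝ => if ⌊k / ε⌋ = j then c else 0) =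
      (Ico (ε * (j : ℝ)) (ε * j + ε)).indicator fun _ => c := by
    funext k
    simp only [indicator, floor_div_eq_iff hε]
  rw [e]
  refine ⟨(integrable_indicator_iff measurableSet_Ico).2 (integrableOn_const (by simp)), ?_⟩
  rw [integral_indicator_const _ measurableSet_Ico]
  simp [hε.le]

/-! ### Orthogonality of the trigonometric functions -/

lemma integral_cos_lattice {ε : ℝ} (hε : 0 < ε) (n : ℤ) :
    ∫ x in Ioc 0 (1 / ε), Real.cos (2 * Real.pi * (ε * n) * x) = if n = 0 then 1 / ε else 0 := by
  rw [← intervalIntegral.integral_of_le (by positivity)]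
  split_ifs with hn
  · simp [hn]
  · have hc : 2 * Real.pi * (ε * n) ≠ 0 := by
      have : (n : ℝ) ≠ 0 := Int.cast_ne_zero.2 hn
      positivity
    rw [intervalIntegral.integral_comp_mul_left (fun y => Real.cos y) hc, integral_cos]
    have : 2 * Real.pi * (ε * n) * (1 / ε) = n * (2 * Real.pi) := by field_simp
    rw [this, Real.sin_eq_zero_iff.2 ⟨2 * n, by push_cast; ring⟩]
    simp

lemma integral_sin_lattice {ε : ℝ} (hε : 0 < ε) (n : ℤ) :
    ∫ x in Ioc 0 (1 / ε), Real.sin (2 * Real.pi * (ε * n) * x) = 0 := by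
  rw [← intervalIntegral.integral_of_le (by positivity)]
  by_cases hn : n = 0
  · simp [hn]
  · have hc : 2 * Real.pi * (ε * n) ≠ 0 := by
      have : (n : ℝ) ≠ 0 := Int.cast_ne_zero.2 hn
      positivity
    rw [intervalIntegral.integral_comp_mul_left (fun y => Real.sin y) hc, integral_sin]
    have : 2 * Real.pi * (ε * n) * (1 / ε) = n * (2 * Real.pi) := by field_simp
    rw [this, Real.cos_int_mul_two_pi]
    simp

lemma integrableOn_cos_mul (c L : ℝ) :
    IntegrableOn (fun x => Real.cos (c * x)) (Ioc 0 L) :=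
  ((by fun_prop : Continuous fun x => Real.cos (c * x)).integrableOn_Icc).mono_set
    Ioc_subset_Icc_self

lemma integrableOn_sin_mul (c L : ℝ) :
    IntegrableOn (fun x => Real.sin (c * x)) (Ioc 0 L) :=
  ((by fun_prop : Continuous fun x => Real.sin (c * x)).integrableOn_Icc).mono_set
    Ioc_subset_Icc_self

/-- Opposite frequencies carry the same sine up to sign, hence two terms; they cancel when `i = j =
0`, as the zero sine requires. -/
lemma integral_sin_mul_sin_lattice {ε : ℝ} (hε : 0 < ε) (i j : ℤ) :
    ∫ x in Ioc 0 (1 / ε), Real.sin (2 * Real.pi * (ε * i) * x) *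
      Real.sin (2 * Real.pi * (ε * j) * x) =
      (if i = j then 1 / (2 * ε) else 0) - if i = -j then 1 / (2 * ε) else 0 := by
  have e : ∀ x, Real.sin (2 * Real.pi * (ε * i) * x) * Real.sin (2 * Real.pi * (ε * j) * x) =
      1 / 2 * (Real.cos (2 * Real.pi * (ε * (i - j : ℤ)) * x) -
        Real.cos (2 * Real.pi * (ε * (i + j : ℤ)) * x)) := by
    intro x
    rw [show 2 * Real.pi * (ε * (i - j : ℤ)) * x =
      2 * Real.pi * (ε * i) * x - 2 * Real.pi * (ε * j) * x by push_cast; ring,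
      show 2 * Real.pi * (ε * (i + j : ℤ)) * x =
      2 * Real.pi * (ε * i) * x + 2 * Real.pi * (ε * j) * x by push_cast; ring,
      Real.cos_sub, Real.cos_add]
    ring
  simp only [e]
  rw [integral_const_mul, integral_sub (integrableOn_cos_mul _ _) (integrableOn_cos_mul _ _),
    integral_cos_lattice hε, integral_cos_lattice hε]
  simp only [sub_eq_zero, ← eq_neg_iff_add_eq_zero]
  split_ifs <;> field_simp <;> ring

lemma integral_sin_mul_cos_lattice {ε : ℝ} (hε : 0 < ε) (i j : ℤ) :
    ∫ x in Ioc 0 (1 / ε), Real.sin (2 * Real.pi * (ε * i) * x) *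
      Real.cos (2 * Real.pi * (ε * j) * x) = 0 := by
  have e : ∀ x, Real.sin (2 * Real.pi * (ε * i) * x) * Real.cos (2 * Real.pi * (ε * j) * x) =
      1 / 2 * (Real.sin (2 * Real.pi * (ε * (i - j : ℤ)) * x) +
        Real.sin (2 * Real.pi * (ε * (i + j : ℤ)) * x)) := by
    intro x
    rw [show 2 * Real.pi * (ε * (i - j : ℤ)) * x =
      2 * Real.pi * (ε * i) * x - 2 * Real.pi * (ε * j) * x by push_cast; ring,
      show 2 * Real.pi * (ε * (i + j : ℤ)) * x =
      2 * Real.pi * (ε * i) * x + 2 * Real.pi * (ε * j) * x by push_cast; ring,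
      Real.sin_sub, Real.sin_add]
    ring
  simp only [e]
  rw [integral_const_mul, integral_add (integrableOn_sin_mul _ _) (integrableOn_sin_mul _ _),
    integral_sin_lattice hε, integral_sin_lattice hε]
  simp

/-! ### The kernel on the torus -/

section Torus

variable {Q : Polynomial ℝ} {ε : ℝ}

lemma measurable_specKernel_slice (Q : Polynomial ℝ) {ρ : ℝ → ℝ} (hρ : IsSampling ρ) (t : ℝ) :
    Measurable fun x => specKernel Q ρ (t, x) :=
  (measurable_specKernel Q hρ).comp (measurable_const.prodMk measurable_id)

lemma integrable_specKernel_period (hQ : SmoothingAssumption Q) {ρ : ℝ → ℝ} (hρ : IsSampling ρ)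
    {t : ℝ} (ht : 0 < t) (L : ℝ) :
    Integrable (fun x => specKernel Q ρ (t, x)) (volume.restrict (Ioc 0 L)) := by
  obtain ⟨C, hC, h⟩ := hQ.abs_specKernel_le
  exact Integrable.of_bound (measurable_specKernel_slice Q hρ t).aestronglyMeasurable
    (C * timeBound t) (Eventually.of_forall fun x => h ρ hρ _ ht)

/-- Fubini for a kernel slice tested over a period. -/
lemma integral_period_gradMode (hQ : SmoothingAssumption Q) {ρ : ℝ → ℝ} (hρ : IsSampling ρ)
    {t : ℝ} (ht : 0 < t) (L a : ℝ) {φ : ℝ → ℝ} (hφm : Measurable φ)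
    (hφ : Integrable φ (volume.restrict (Ioc 0 L))) :
    ∫ x in Ioc 0 L, φ x * specKernel Q ρ (t, x + a) =
      -∫ k, ∫ x in Ioc 0 L, φ x * gradMode Q t (x + a) (ρ k) := by
  obtain ⟨C, hC, h⟩ := hQ.abs_gradMode_sampled_le
  have hi : Integrable (fun p : ℝ × ℝ => φ p.1 * gradMode Q t (p.1 + a) (ρ p.2))
      ((volume.restrict (Ioc 0 L)).prod volume) := by
    refine (hφ.norm.mul_prod (integrable_inv_one_add_sq.const_mul (C * timeBound t))).mono' ?_
      (Eventually.of_forall fun p => ?_)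
    · have hg : Measurable fun p : ℝ × ℝ => gradMode Q t (p.1 + a) (ρ p.2) :=
        (continuous_gradMode Q).measurable.comp ((measurable_const.prodMk
          (measurable_fst.add_const a)).prodMk (hρ.measurable.comp measurable_snd))
      exact ((hφm.comp measurable_fst).mul hg).aestronglyMeasurable
    · rw [norm_mul]
      exact mul_le_mul_of_nonneg_left (h ρ hρ t _ _ ht) (norm_nonneg _)
  rw [← integral_integral_swap hi, ← integral_neg]
  refine integral_congr_ae (Eventually.of_forall fun x => ?_)
  dsimp only
  rw [specKernel, if_pos ht, integral_const_mul, mul_neg]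

/-- Orthogonality over a period plays the role of Fourier inversion. The cells of `εj` and `-εj`
contribute equally, since the coefficient and the sine are both odd: each is a cell of width `ε`
times `1 / (2ε)`, that is, half of the answer. -/
lemma integral_period_mul_trig (hQ : SmoothingAssumption Q) (hε : 0 < ε) (hε1 : ε ≤ 1)
    {t : ℝ} (ht : 0 < t) (j : ℤ) :
    ∫ x in Ioc 0 (1 / ε), specKernel Q (latticeRound ε) (t, x) *
      Real.cos (2 * Real.pi * (ε * j) * x) = 0 ∧
    ∫ x in Ioc 0 (1 / ε), specKernel Q (latticeRound ε) (t, x) *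
      Real.sin (2 * Real.pi * (ε * j) * x) =
      -(2 * Real.pi * (ε * j) * Real.exp (-(t * symbol Q (ε * j)))) := by
  have hρ := isSampling_latticeRound hε hε1
  have hform : ∀ (φ : ℝ → ℝ) (k x : ℝ), φ x * gradMode Q t x (latticeRound ε k) =
      2 * Real.pi * latticeRound ε k * Real.exp (-(t * symbol Q (latticeRound ε k))) *
        (Real.sin (2 * Real.pi * (ε * ⌊k / ε⌋) * x) * φ x) := by
    intro φ k x
    rw [gradMode, latticeRound]
    ring
  constructor
  · simp only [mul_comm (specKernel Q (latticeRound ε) (t, _))]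
    have := integral_period_gradMode hQ hρ ht (1 / ε) 0
      (φ := fun x => Real.cos (2 * Real.pi * (ε * j) * x)) (by fun_prop)
      (integrableOn_cos_mul _ _)
    simp only [add_zero] at this
    rw [this]
    simp only [hform (fun x => Real.cos (2 * Real.pi * (ε * j) * x))]
    simp only [integral_const_mul, integral_sin_mul_cos_lattice hε]
    simp
  · simp only [mul_comm (specKernel Q (latticeRound ε) (t, _))]
    have := integral_period_gradMode hQ hρ ht (1 / ε) 0
      (φ := fun x => Real.sin (2 * Real.pi * (ε * j) * x)) (by fun_prop)
      (integrableOn_sin_mul _ _)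
    simp only [add_zero] at this
    rw [this]
    simp only [hform (fun x => Real.sin (2 * Real.pi * (ε * j) * x))]
    simp only [integral_const_mul, integral_sin_mul_sin_lattice hε]
    set c := 2 * Real.pi * (ε * j) * Real.exp (-(t * symbol Q (ε * j))) with hc
    have e : ∀ k : ℝ, 2 * Real.pi * latticeRound ε k *
        Real.exp (-(t * symbol Q (latticeRound ε k))) *
        ((if ⌊k / ε⌋ = j then 1 / (2 * ε) else 0) - if ⌊k / ε⌋ = -j then 1 / (2 * ε) else 0) =
        (if ⌊k / ε⌋ = j then c / (2 * ε) else 0) + if ⌊k / ε⌋ = -j then c / (2 * ε) else 0 := by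
      intro k
      have h1 : ⌊k / ε⌋ = j → 2 * Real.pi * latticeRound ε k *
          Real.exp (-(t * symbol Q (latticeRound ε k))) = c := by
        intro h; rw [latticeRound, h]
      have h2 : ⌊k / ε⌋ = -j → 2 * Real.pi * latticeRound ε k *
          Real.exp (-(t * symbol Q (latticeRound ε k))) = -c := by
        intro h
        rw [latticeRound, h, hc]
        push_cast
        rw [mul_neg, hQ.symbol_neg]
        ring
      rw [mul_sub, sub_eq_add_neg]
      congr 1
      · split_ifs with h
        · rw [h1 h]; ring
        · simp
      · split_ifs with h
        · rw [h2 h]; ring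
        · simp
    simp only [e]
    rw [integral_add (integral_ite_floor hε _ _).1 (integral_ite_floor hε _ _).1,
      (integral_ite_floor hε _ _).2, (integral_ite_floor hε _ _).2]
    field_simp
    ring

/-- The covariance of two slices of the kernel over a period. -/
lemma integral_period_mul_specKernel (hQ : SmoothingAssumption Q) (hε : 0 < ε) (hε1 : ε ≤ 1)
    {t t' : ℝ} (ht : 0 < t) (ht' : 0 < t') (a : ℝ) :
    ∫ x in Ioc 0 (1 / ε), specKernel Q (latticeRound ε) (t, x) *
      specKernel Q (latticeRound ε) (t', x + a) =
      ∫ k, (2 * Real.pi * latticeRound ε k) ^ 2 *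
        Real.exp (-((t + t') * symbol Q (latticeRound ε k))) *
        Real.cos (2 * Real.pi * latticeRound ε k * a) := by
  have hρ := isSampling_latticeRound hε hε1
  set q : ℝ → ℝ := fun x => specKernel Q (latticeRound ε) (t, x) with hq
  have hqm : Measurable q := measurable_specKernel_slice Q hρ t
  have hqi : Integrable q (volume.restrict (Ioc 0 (1 / ε))) :=
    integrable_specKernel_period hQ hρ ht _
  rw [integral_period_gradMode hQ hρ ht' _ a hqm hqi, ← integral_neg]
  refine integral_congr_ae (Eventually.of_forall fun k => ?_)
  dsimp only
  obtain ⟨hcos, hsin⟩ := integral_period_mul_trig hQ hε hε1 ht ⌊k / ε⌋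
  set κ := latticeRound ε k with hκ
  rw [show ε * (⌊k / ε⌋ : ℝ) = κ from rfl] at hcos hsin
  have hic : Integrable (fun x => q x * Real.cos (2 * Real.pi * κ * x))
      (volume.restrict (Ioc 0 (1 / ε))) := by
    refine hqi.mono (hqi.1.mul (Continuous.aestronglyMeasurable (by fun_prop)))
      (Eventually.of_forall fun k => ?_)
    rw [norm_mul]
    exact mul_le_of_le_one_right (norm_nonneg _) (Real.abs_cos_le_one _)
  have his : Integrable (fun x => q x * Real.sin (2 * Real.pi * κ * x))
      (volume.restrict (Ioc 0 (1 / ε))) := by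
    refine hqi.mono (hqi.1.mul (Continuous.aestronglyMeasurable (by fun_prop)))
      (Eventually.of_forall fun k => ?_)
    rw [norm_mul]
    exact mul_le_of_le_one_right (norm_nonneg _) (Real.abs_sin_le_one _)
  have e : ∀ x, q x * gradMode Q t' (x + a) κ =
      2 * Real.pi * κ * Real.exp (-(t' * symbol Q κ)) * Real.cos (2 * Real.pi * κ * a) *
        (q x * Real.sin (2 * Real.pi * κ * x)) +
      2 * Real.pi * κ * Real.exp (-(t' * symbol Q κ)) * Real.sin (2 * Real.pi * κ * a) *
        (q x * Real.cos (2 * Real.pi * κ * x)) := by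
    intro x
    rw [gradMode, show 2 * Real.pi * κ * (x + a) =
      2 * Real.pi * κ * x + 2 * Real.pi * κ * a by ring, Real.sin_add]
    ring
  simp only [e]
  rw [integral_add (his.const_mul _) (hic.const_mul _), integral_const_mul,
    integral_const_mul, hcos, hsin,
    show -((t + t') * symbol Q κ) = -(t * symbol Q κ) + -(t' * symbol Q κ) by ring,
    Real.exp_add]
  ring

lemma periodic_specKernel (Q : Polynomial ℝ) (hε : 0 < ε) (t : ℝ) :
    Function.Periodic (fun x => specKernel Q (latticeRound ε) (t, x)) (1 / ε) := by
  intro x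
  have e : ∀ k, gradMode Q t (x + 1 / ε) (latticeRound ε k) =
      gradMode Q t x (latticeRound ε k) := by
    intro k
    unfold gradMode
    have : 2 * Real.pi * latticeRound ε k * (x + 1 / ε) =
        2 * Real.pi * latticeRound ε k * x + (⌊k / ε⌋ : ℝ) * (2 * Real.pi) := by
      unfold latticeRound
      field_simp
    rw [this, Real.sin_add_int_mul_two_pi]
  simp only [specKernel, e]

/-- The spatial derivative of the heat kernel on `ℝ × (𝕋 / ε)`. -/
def torusKernel (Q : Polynomial ℝ) (ε : Scale) (p : Micro ε) : ℝ :=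
  (periodic_specKernel Q ε.2.1 p.1).lift p.2

lemma torusKernel_coe (Q : Polynomial ℝ) (ε : Scale) (t x : ℝ) :
    torusKernel Q ε (t, (x : AddCircle (1 / (ε : ℝ)))) = specKernel Q (latticeRound ε) (t, x) :=
  rfl

/-- A measurable section of the projection `ℝ → 𝕋 / ε`. -/
def circleSection (ε : Scale) (y : AddCircle (1 / (ε : ℝ))) : ℝ :=
  AddCircle.measurableEquivIoc (1 / (ε : ℝ)) 0 y

lemma measurable_circleSection (ε : Scale) : Measurable (circleSection ε) :=
  measurable_subtype_coe.comp (AddCircle.measurableEquivIoc (1 / (ε : ℝ)) 0).measurable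

lemma coe_circleSection (ε : Scale) (y : AddCircle (1 / (ε : ℝ))) :
    (circleSection ε y : AddCircle (1 / (ε : ℝ))) = y :=
  (AddCircle.measurableEquivIoc (1 / (ε : ℝ)) 0).symm_apply_apply y

/-- Measurability on `ℝ × (𝕋 / ε)` can be checked upstairs. -/
lemma measurable_of_comp_coe (ε : Scale) {β : Type*} [MeasurableSpace β] {f : Micro ε → β}
    (hf : Measurable fun p : ℝ × ℝ => f (p.1, (p.2 : AddCircle (1 / (ε : ℝ))))) :
    Measurable f := by
  have h : Measurable fun p : Micro ε => (p.1, circleSection ε p.2) :=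
    measurable_fst.prodMk ((measurable_circleSection ε).comp measurable_snd)
  have e : f = fun p : Micro ε =>
      f (p.1, ((circleSection ε p.2 : ℝ) : AddCircle (1 / (ε : ℝ)))) := by
    funext p
    rw [coe_circleSection]
  rw [e]
  exact hf.comp h

lemma isSampling_scale (ε : Scale) : IsSampling (latticeRound ε) :=
  isSampling_latticeRound ε.2.1 ε.2.2.le

lemma measurable_torusKernel (Q : Polynomial ℝ) (ε : Scale) : Measurable (torusKernel Q ε) :=
  measurable_of_comp_coe ε (measurable_specKernel Q (isSampling_scale ε))

/-- On the circle the slices are bounded on a finite measure space, so integrability is immediate;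
the identity follows by shifting by `a` and lifting to one period. -/
lemma isSpectralKernel_torus (hQ : SmoothingAssumption Q) (ε : Scale) :
    IsSpectralKernel Q (latticeRound ε) (volume : Measure (AddCircle (1 / (ε : ℝ))))
      (fun x => (x : AddCircle (1 / (ε : ℝ)))) (torusKernel Q ε) where
  measurable := measurable_torusKernel Q ε
  apply_proj := torusKernel_coe Q ε
  surjective := QuotientAddGroup.mk_surjective
  sampling := isSampling_scale ε
  parseval := by
    intro t t' a b ht ht'
    obtain ⟨C, hC, hb⟩ := hQ.abs_specKernel_le
    have hbd : ∀ t, 0 < t → ∀ y, ‖torusKernel Q ε (t, y)‖ ≤ C * timeBound t := by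
      intro t ht y
      obtain ⟨x, rfl⟩ := QuotientAddGroup.mk_surjective y
      exact hb _ (isSampling_scale ε) (t, x) ht
    have hm : ∀ t (c : AddCircle (1 / (ε : ℝ))), Measurable fun x => torusKernel Q ε (t, x - c) :=
      fun t c => (measurable_torusKernel Q ε).comp
        (measurable_const.prodMk (measurable_id.sub_const c))
    refine ⟨?_, ?_⟩
    · refine Integrable.of_bound ((hm t _).mul (hm t' _)).aestronglyMeasurable
        (C * timeBound t * (C * timeBound t')) (Eventually.of_forall fun x => ?_)
      rw [norm_mul]
      exact mul_le_mul (hbd t ht _) (hbd t' ht' _) (norm_nonneg _)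
        (mul_nonneg hC.le (timeBound_nonneg ht))
    · rw [← integral_add_right_eq_self _ (a : AddCircle (1 / (ε : ℝ))),
        ← AddCircle.integral_preimage (1 / (ε : ℝ)) 0, zero_add,
        ← integral_period_mul_specKernel hQ ε.2.1 ε.2.2.le ht ht' (a - b)]
      refine integral_congr_ae (Eventually.of_forall fun x => ?_)
      dsimp only
      rw [add_sub_cancel_right, add_sub_assoc, ← AddCircle.coe_sub, ← AddCircle.coe_add,
        torusKernel_coe, torusKernel_coe]

end Torus

variable {Q : Polynomial ℝ}

instance (ε : Scale) : (volume : Measure (Micro ε)).IsAddLeftInvariant :=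
  inferInstanceAs ((volume : Measure ℝ).prod
    (volume : Measure (AddCircle (1 / (ε : ℝ))))).IsAddLeftInvariant

instance (ε : Scale) : (volume : Measure (AddCircle (1 / (ε : ℝ)))).IsNegInvariant :=
  Measure.IsAddHaarMeasure.isNegInvariant_of_regular _

instance (ε : Scale) : (volume : Measure (Micro ε)).IsNegInvariant where
  neg_eq_self := by
    have h := Measure.map_prod_map (volume : Measure ℝ)
      (volume : Measure (AddCircle (1 / (ε : ℝ)))) measurable_neg measurable_neg
    rw [Measure.map_neg_eq_self, Measure.map_neg_eq_self] at h
    exact h.symm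

/-! ### Integrability of the kernel on the torus -/

lemma le_abs_latticeRound {ε : ℝ} (hε : 0 < ε) {k : ℝ} (h : latticeRound ε k ≠ 0) :
    ε ≤ |latticeRound ε k| := by
  unfold latticeRound at *
  have h1 : ⌊k / ε⌋ ≠ 0 := fun h0 => h (by simp [h0])
  have h2 : (1 : ℝ) ≤ |(⌊k / ε⌋ : ℝ)| := by exact_mod_cast Int.one_le_abs h1
  rw [abs_mul, abs_of_pos hε]
  nlinarith

/-- The spectral gap: the zero mode has coefficient `0`, and every other lattice frequency `κ` has
`|κ| ≥ ε`. Hence the time integral `2π|κ| / S(κ)` is at most a constant over `ε (1 + κ²)`. The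
constant degenerates as `ε → 0`, but it serves only to justify integrals at fixed `ε`. -/
lemma integrable_abs_mul_exp_latticeRound (hQ : SmoothingAssumption Q) (ε : Scale) :
    Integrable (fun p : ℝ × ℝ => 2 * Real.pi * |latticeRound ε p.2| *
      Real.exp (-(p.1 * symbol Q (latticeRound ε p.2)))) ((volume.restrict (Ioi 0)).prod volume) := by
  have hρ := isSampling_scale ε
  set ρ : ℝ → ℝ := latticeRound ε with hρdef
  have hε := ε.2.1
  have hm : Measurable fun p : ℝ × ℝ => 2 * Real.pi * |ρ p.2| *
      Real.exp (-(p.1 * symbol Q (ρ p.2))) := by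
    have h1 := (continuous_symbol Q).measurable
    have h2 := hρ.measurable
    fun_prop
  have hk : ∀ k : ℝ, Integrable (fun t => 2 * Real.pi * |k| * Real.exp (-(t * symbol Q k)))
        (volume.restrict (Ioi 0)) ∧
      ∫ t in Ioi 0, 2 * Real.pi * |k| * Real.exp (-(t * symbol Q k)) =
        2 * Real.pi * |k| / symbol Q k := by
    intro k
    by_cases h0 : k = 0
    · subst h0; simp
    · have hp := hQ.symbol_pos h0
      have e : ∀ t, -(t * symbol Q k) = -symbol Q k * t := fun t => by ring
      simp only [e]
      refine ⟨Integrable.const_mul (exp_neg_integrableOn_Ioi 0 hp) _, ?_⟩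
      rw [integral_const_mul, integral_exp_mul_Ioi (neg_lt_zero.2 hp)]
      simp [div_eq_mul_inv]
  obtain ⟨c, hc, hlow⟩ := hQ.symbol_lower_bound
  rw [integrable_prod_iff' hm.aestronglyMeasurable]
  refine ⟨Eventually.of_forall fun k => (hk (ρ k)).1, ?_⟩
  refine (integrable_inv_one_add_sq.const_mul (3 * (2 * Real.pi / (c * ε)))).mono'
    hm.norm.stronglyMeasurable.integral_prod_left.aestronglyMeasurable
    (Eventually.of_forall fun k => ?_)
  have e : ∀ t, ‖2 * Real.pi * |ρ k| * Real.exp (-(t * symbol Q (ρ k)))‖ =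
      2 * Real.pi * |ρ k| * Real.exp (-(t * symbol Q (ρ k))) := fun t =>
    Real.norm_of_nonneg (by positivity)
  simp only [e]
  have hS := hQ.symbol_nonneg (ρ k)
  rw [(hk _).2, Real.norm_of_nonneg (by positivity)]
  have h1 : 2 * Real.pi * |ρ k| / symbol Q (ρ k) ≤ 2 * Real.pi / (c * ε) * (1 + ρ k ^ 2)⁻¹ := by
    by_cases h0 : ρ k = 0
    · simp only [h0, abs_zero, mul_zero, zero_div]
      positivity
    · have hp := hQ.symbol_pos h0
      have ha : (ε : ℝ) ≤ |ρ k| := le_abs_latticeRound hε h0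
      rw [← div_eq_mul_inv, div_div, div_le_div_iff₀ hp (by positivity), mul_assoc]
      refine mul_le_mul_of_nonneg_left ?_ (by positivity)
      calc |ρ k| * (c * ε * (1 + ρ k ^ 2)) ≤ |ρ k| * (c * |ρ k| * (1 + ρ k ^ 2)) := by gcongr
        _ = c * (ρ k ^ 2 * (1 + ρ k ^ 2)) := by rw [← sq_abs (ρ k)]; ring
        _ ≤ _ := hlow _
  calc _ ≤ _ := h1
    _ ≤ 2 * Real.pi / (c * ε) * (3 * (1 + k ^ 2)⁻¹) :=
      mul_le_mul_of_nonneg_left (hρ.inv_le k) (by positivity)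
    _ = _ := by ring

lemma integrable_torusKernel (hQ : SmoothingAssumption Q) (ε : Scale) :
    Integrable (torusKernel Q ε) := by
  have h := (integrable_abs_mul_exp_latticeRound hQ ε).integral_prod_left
  set g : ℝ → ℝ := fun t => ∫ k, 2 * Real.pi * |latticeRound ε k| *
      Real.exp (-(t * symbol Q (latticeRound ε k))) with hg
  have hgi : Integrable ((Ioi (0 : ℝ)).indicator g) :=
    (integrable_indicator_iff measurableSet_Ioi).2 h
  have h1 : Integrable (fun p : Micro ε => (Ioi (0 : ℝ)).indicator g p.1 * 1) :=
    hgi.mul_prod (integrable_const (1 : ℝ))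
  refine h1.mono' (measurable_torusKernel Q ε).aestronglyMeasurable
    (Eventually.of_forall fun ⟨t, y⟩ => ?_)
  obtain ⟨x, rfl⟩ := QuotientAddGroup.mk_surjective y
  change ‖specKernel Q (latticeRound ε) (t, x)‖ ≤ _
  rw [mul_one]
  dsimp only
  by_cases ht : 0 < t
  · rw [indicator_of_mem (mem_Ioi.2 ht), specKernel, if_pos ht, norm_neg]
    refine (norm_integral_le_integral_norm _).trans (integral_mono_of_nonneg
      (Eventually.of_forall fun _ => norm_nonneg _) ?_ (Eventually.of_forall fun k => ?_))
    · obtain ⟨C, hC, hb⟩ := hQ.abs_mul_exp_symbol_le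
      refine (integrable_inv_one_add_sq.const_mul (2 * Real.pi * (C * timeBound t * 3))).mono' ?_
        (Eventually.of_forall fun k => ?_)
      · have h1 := (continuous_symbol Q).measurable
        have h2 := (isSampling_scale ε).measurable
        exact Measurable.aestronglyMeasurable (by fun_prop)
      · rw [Real.norm_of_nonneg (by positivity)]
        have h2 := hb t (latticeRound ε k) ht
        have h3 := (isSampling_scale ε).inv_le k
        calc _ = 2 * Real.pi * (|latticeRound ε k| *
              Real.exp (-(t * symbol Q (latticeRound ε k)))) := by ring
          _ ≤ 2 * Real.pi * (C * timeBound t * (3 * (1 + k ^ 2)⁻¹)) := by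
            refine mul_le_mul_of_nonneg_left (h2.trans (mul_le_mul_of_nonneg_left h3
              (mul_nonneg hC.le (timeBound_nonneg ht)))) (by positivity)
          _ = _ := by ring
    · dsimp only [gradMode]
      rw [norm_mul, norm_mul, norm_mul, Real.norm_of_nonneg (by positivity : 0 ≤ 2 * Real.pi),
        Real.norm_of_nonneg (Real.exp_pos _).le]
      exact mul_le_of_le_one_right (by positivity) (Real.abs_sin_le_one _)
  · rw [specKernel_of_nonpos Q _ (not_lt.1 ht), norm_zero]
    refine indicator_nonneg (fun t _ => integral_nonneg fun k => by positivity) t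

/-! ### Identification of the Green's function on the torus -/

/-- The scaling map from macroscopic to microscopic space-time. -/
def macroToMicro (ε : Scale) (p : Macro) : Micro ε := (p.1 / (ε : ℝ) ^ 2, dilate ε p.2)

lemma dilate_coe (ε : Scale) (x : ℝ) :
    dilate ε (x : UnitAddCircle) = ((x / ε : ℝ) : AddCircle (1 / (ε : ℝ))) := by
  unfold dilate
  rw [AddCircle.equivAddCircle_apply_mk, inv_one, one_mul, mul_one_div]

lemma macroToMicro_sub (ε : Scale) (p q : Macro) :
    macroToMicro ε (p - q) = macroToMicro ε p - macroToMicro ε q := by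
  refine Prod.ext (sub_div p.1 q.1 ((ε : ℝ) ^ 2)) ?_
  exact map_sub (AddCircle.equivAddCircle 1 (1 / (ε : ℝ)) one_ne_zero
    (one_div_pos.2 ε.2.1).ne') p.2 q.2

/-- The substitution of `ε k` for `k` turns the Fourier series into `ε⁻¹` times a Riemann sum of
mesh `ε`. -/
lemma greenTorus_coe (hQ : SmoothingAssumption Q) (ε : Scale) {t : ℝ} (ht : 0 < t) (r : ℝ) :
    greenTorus Q ε t (r : UnitAddCircle) = (ε : ℝ)⁻¹ *
      ∫ k, Real.exp (-(t / (ε : ℝ) ^ 2 * symbol Q (latticeRound ε k))) *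
        Real.cos (2 * Real.pi * latticeRound ε k * (r / ε)) := by
  have hε := ε.2.1
  have ht' : 0 < t / (ε : ℝ) ^ 2 := by positivity
  have hsum := fun x => hasSum_latticeRound hε
    (g := fun k => Real.exp (-(t / (ε : ℝ) ^ 2 * symbol Q k)) * Real.cos (2 * Real.pi * k * x))
    (integrable_exp_symbol_mul_cos hQ (isSampling_scale ε) ht' x)
  have hexp : ∀ k : ℤ, Real.exp (-(t * ((ε : ℝ) ^ 2)⁻¹ * Q.eval (-(2 * Real.pi * ε * k)))) =
      Real.exp (-(t / (ε : ℝ) ^ 2 * symbol Q (ε * k))) := by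
    intro k
    rw [hQ.even, symbol, div_eq_mul_inv]
    ring_nf
  have hf : ∀ k : ℤ, (fourier k (r : UnitAddCircle) : ℂ) =
      Complex.exp (((2 * Real.pi * (ε * k) * (r / ε) : ℝ) : ℂ) * Complex.I) := by
    intro k
    rw [fourier_coe_apply]
    congr 1
    push_cast
    have : (ε : ℂ) ≠ 0 := by exact_mod_cast hε.ne'
    field_simp
  have hs : Summable fun k : ℤ =>
      (Real.exp (-(t * ((ε : ℝ) ^ 2)⁻¹ * Q.eval (-(2 * Real.pi * ε * k)))) : ℂ) *
      fourier k (r : UnitAddCircle) := by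
    refine Summable.of_norm ?_
    have h0 := ((hsum 0).summable).mul_left (ε : ℝ)⁻¹
    refine h0.congr fun k => ?_
    rw [norm_mul, hexp, hf, Complex.norm_exp_ofReal_mul_I, mul_one, Complex.norm_real,
      Real.norm_of_nonneg (Real.exp_pos _).le, mul_zero, Real.cos_zero, mul_one,
      inv_mul_cancel_left₀ hε.ne']
  rw [greenTorus, if_pos ht, Complex.re_tsum hs, ← (hsum (r / ε)).tsum_eq, ← tsum_mul_left]
  refine tsum_congr fun k => ?_
  rw [hexp, hf, Complex.re_ofReal_mul, Complex.exp_ofReal_mul_I_re, inv_mul_cancel_left₀ hε.ne']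

/-- One factor `ε⁻¹` is the mesh of the Riemann sum, the other the chain rule for `r ↦ (x + r) / ε`.
-/
lemma greenTorusDeriv_eq (hQ : SmoothingAssumption Q) (ε : Scale) (p : Macro) :
    greenTorusDeriv Q ε p = ((ε : ℝ) ^ 2)⁻¹ * torusKernel Q ε (macroToMicro ε p) := by
  obtain ⟨t, y⟩ := p
  obtain ⟨x, rfl⟩ := QuotientAddGroup.mk_surjective y
  have hε := ε.2.1
  change deriv (fun r : ℝ => greenTorus Q ε t ((x : UnitAddCircle) + (r : UnitAddCircle))) 0 =
    ((ε : ℝ) ^ 2)⁻¹ * torusKernel Q ε (t / (ε : ℝ) ^ 2, dilate ε (x : UnitAddCircle))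
  rw [dilate_coe, torusKernel_coe]
  simp only [← AddCircle.coe_add]
  by_cases ht : 0 < t
  · have ht' : 0 < t / (ε : ℝ) ^ 2 := by positivity
    simp only [greenTorus_coe hQ ε ht]
    have h1 := hasDerivAt_specHeat hQ (isSampling_scale ε) ht' ((x + 0) / ε)
    have h2 : HasDerivAt (fun r : ℝ => (x + r) / ε) (1 / (ε : ℝ)) 0 :=
      ((hasDerivAt_id (0 : ℝ)).const_add x).div_const (ε : ℝ)
    refine ((HasDerivAt.comp (0 : ℝ) h1 h2).const_mul (ε : ℝ)⁻¹).deriv.trans ?_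
    rw [add_zero]
    field_simp
  · have h0 : ¬ 0 < t / (ε : ℝ) ^ 2 := by
      rw [not_lt] at ht ⊢
      exact div_nonpos_of_nonpos_of_nonneg ht (by positivity)
    simp [greenTorus, ht, specKernel, h0]

/-! ### The scaling map -/

lemma measurableEmbedding_macroToMicro (ε : Scale) : MeasurableEmbedding (macroToMicro ε) := by
  have h0 : (ε : ℝ) ^ 2 ≠ 0 := (pow_pos ε.2.1 2).ne'
  exact ((Homeomorph.mulRight₀ ((ε : ℝ) ^ 2)⁻¹ (inv_ne_zero h0)).prodCongr
    (AddCircle.homeomorphAddCircle 1 (1 / (ε : ℝ)) one_ne_zero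
      (one_div_pos.2 ε.2.1).ne')).measurableEmbedding

lemma measurable_coe_circle (ε : Scale) :
    Measurable fun x : ℝ => (x : AddCircle (1 / (ε : ℝ))) :=
  (AddCircle.measurePreserving_mk (1 / (ε : ℝ)) 0).measurable

lemma measurable_dilate (ε : Scale) : Measurable (dilate ε) :=
  (AddCircle.homeomorphAddCircle 1 (1 / (ε : ℝ)) one_ne_zero
    (one_div_pos.2 ε.2.1).ne').measurable

lemma map_dilate (ε : Scale) :
    (volume : Measure UnitAddCircle).map (dilate ε) = ENNReal.ofReal ε • volume := by
  have hε := ε.2.1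
  have h1 := (AddCircle.measurePreserving_mk (1 : ℝ) 0)
  have h2 := (AddCircle.measurePreserving_mk (1 / (ε : ℝ)) 0)
  have hmul : Measurable fun x : ℝ => x * (ε : ℝ)⁻¹ := by fun_prop
  have e : (dilate ε) ∘ (fun x : ℝ => (x : UnitAddCircle)) =
      (fun x : ℝ => (x : AddCircle (1 / (ε : ℝ)))) ∘ fun x : ℝ => x * (ε : ℝ)⁻¹ := by
    funext x
    simp only [Function.comp, dilate_coe, div_eq_mul_inv]
  have hpre : (fun x : ℝ => x * (ε : ℝ)⁻¹) ⁻¹' Ioc 0 (0 + 1 / (ε : ℝ)) = Ioc 0 (0 + 1) := by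
    ext x
    simp only [mem_preimage, mem_Ioc, zero_add, one_div]
    constructor
    · rintro ⟨ha, hb⟩
      exact ⟨pos_of_mul_pos_left ha (by positivity), by
        simpa using (mul_le_mul_iff_of_pos_right (inv_pos.2 hε)).1 (by simpa using hb)⟩
    · rintro ⟨ha, hb⟩
      exact ⟨by positivity, mul_le_of_le_one_left (by positivity) hb⟩
  have h3 : (volume.restrict (Ioc 0 (0 + 1))).map (fun x : ℝ => x * (ε : ℝ)⁻¹) =
      ENNReal.ofReal ε • volume.restrict (Ioc 0 (0 + 1 / (ε : ℝ))) := by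
    rw [← hpre, ← Measure.restrict_map hmul measurableSet_Ioc,
      Real.map_volume_mul_right (inv_ne_zero hε.ne'), inv_inv, abs_of_pos hε,
      Measure.restrict_smul]
  rw [← h1.map_eq, Measure.map_map (measurable_dilate ε) h1.measurable, e,
    ← Measure.map_map h2.measurable hmul, h3, Measure.map_smul, h2.map_eq]

lemma map_macroToMicro (ε : Scale) :
    (volume : Measure Macro).map (macroToMicro ε) = ENNReal.ofReal ((ε : ℝ) ^ 3) • volume := by
  have hε := ε.2.1
  have hmul : Measurable fun x : ℝ => x / (ε : ℝ) ^ 2 := by fun_prop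
  have h := Measure.map_prod_map (volume : Measure ℝ) (volume : Measure UnitAddCircle)
    hmul (measurable_dilate ε)
  have h1 : (volume : Measure ℝ).map (fun x : ℝ => x / (ε : ℝ) ^ 2) =
      ENNReal.ofReal ((ε : ℝ) ^ 2) • volume := by
    simp only [div_eq_mul_inv]
    rw [Real.map_volume_mul_right (by positivity), inv_inv, abs_of_pos (by positivity)]
  rw [h1, map_dilate, Measure.prod_smul_left, Measure.prod_smul_right, smul_smul,
    ← ENNReal.ofReal_mul (by positivity), ← pow_succ] at h
  exact h.symm

/-- The free field is a microscopic convolution. -/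
lemma freeField_eq (hQ : SmoothingAssumption Q) (θ : ℝ × ℝ → ℝ) (ε : Scale)
    (η : Measure (Micro ε)) (z : Macro) :
    (Integrable (fun v => torusKernel Q ε (macroToMicro ε z - v) * microNoise θ ε η v) →
      Integrable fun y => greenTorusDeriv Q ε (z - y) * macroNoise θ ε η y) ∧
    √(ε : ℝ) * freeField Q θ ε η z =
      ∫ v, torusKernel Q ε (macroToMicro ε z - v) * microNoise θ ε η v := by
  have hε := ε.2.1
  set H : Micro ε → ℝ := fun v => torusKernel Q ε (macroToMicro ε z - v) * microNoise θ ε η v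
    with hH
  have e : ∀ y, greenTorusDeriv Q ε (z - y) * macroNoise θ ε η y =
      (((ε : ℝ) ^ 2)⁻¹ * (ε : ℝ) ^ (-(3 / 2) : ℝ)) * H (macroToMicro ε y) := by
    intro y
    rw [greenTorusDeriv_eq hQ, macroToMicro_sub, macroNoise, hH]
    simp only [macroToMicro]
    ring
  constructor
  · intro hi
    simp only [e]
    refine Integrable.const_mul ?_ _
    refine ((measurableEmbedding_macroToMicro ε).integrable_map_iff (g := H)).1 ?_
    rw [map_macroToMicro]
    exact hi.smul_measure ENNReal.ofReal_ne_top
  · have h1 := (measurableEmbedding_macroToMicro ε).integral_map (μ := volume) H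
    rw [map_macroToMicro, integral_smul_measure, ENNReal.toReal_ofReal (by positivity)] at h1
    rw [freeField]
    simp only [e]
    rw [integral_const_mul, ← h1, smul_eq_mul, ← mul_assoc, ← mul_assoc]
    -- The exponents balance: `1/2 - 2 - 3/2 + 3 = 0`, where `3` is the Jacobian of the parabolic
    -- scaling.
    have : √(ε : ℝ) * (((ε : ℝ) ^ 2)⁻¹ * (ε : ℝ) ^ (-(3 / 2) : ℝ)) * (ε : ℝ) ^ 3 = 1 := by
      rw [Real.sqrt_eq_rpow, ← Real.rpow_natCast, ← Real.rpow_natCast, ← Real.rpow_neg hε.le,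
        ← Real.rpow_add hε, ← Real.rpow_add hε, ← Real.rpow_add hε]
      norm_num
    rw [this, one_mul]

/-! ### Unfolding -/

lemma periodizedMollifier_coe (f : ℝ × ℝ → ℝ) (ε : Scale) (t x : ℝ) :
    periodizedMollifier f ε (t, (x : AddCircle (1 / (ε : ℝ)))) =
      ∑' k : ℤ, f (t, x + k / ε) := rfl

lemma measurable_periodizedMollifier {f : ℝ × ℝ → ℝ} (hf : Measurable f) (ε : Scale) :
    Measurable (periodizedMollifier f ε) := by
  refine measurable_of_comp_coe ε ?_
  simp only [periodizedMollifier_coe]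
  exact Measurable.tsum fun k => hf.comp (by fun_prop)

/-- A fundamental domain for the projection `ℝ² → ℝ × (𝕋 / ε)`. -/
def strip (ε : Scale) (x₀ : ℝ) : Set (ℝ × ℝ) := univ ×ˢ Ioc x₀ (x₀ + 1 / (ε : ℝ))

lemma measurableSet_strip (ε : Scale) (x₀ : ℝ) : MeasurableSet (strip ε x₀) :=
  MeasurableSet.univ.prod measurableSet_Ioc

lemma measurePreserving_strip (ε : Scale) (x₀ : ℝ) :
    MeasurePreserving (timeLift fun x : ℝ => (x : AddCircle (1 / (ε : ℝ))))
      (volume.restrict (strip ε x₀)) (volume : Measure (Micro ε)) := by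
  have h := (MeasurePreserving.id (volume : Measure ℝ)).prod
    (AddCircle.measurePreserving_mk (1 / (ε : ℝ)) x₀)
  have e : (volume : Measure ℝ).prod (volume.restrict (Ioc x₀ (x₀ + 1 / (ε : ℝ)))) =
      (volume : Measure (ℝ × ℝ)).restrict (strip ε x₀) := by
    rw [strip, Measure.volume_eq_prod, ← Measure.prod_restrict, Measure.restrict_univ]
  rw [e] at h
  exact h

lemma iUnion_strip (ε : Scale) : ⋃ k : ℤ, strip ε (k / ε) = univ := by
  have hε := ε.2.1
  refine eq_univ_of_forall fun p => ?_
  have := iUnion_Ioc_zsmul (one_div_pos.2 hε)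
  have h2 : p.2 ∈ ⋃ n : ℤ, Ioc (n • (1 / (ε : ℝ))) ((n + 1) • (1 / (ε : ℝ))) := by
    rw [this]; trivial
  obtain ⟨n, hn⟩ := mem_iUnion.1 h2
  refine mem_iUnion.2 ⟨n, mem_univ _, ?_⟩
  simp only [zsmul_eq_mul] at hn
  push_cast at hn
  refine ⟨by simpa [div_eq_mul_inv] using hn.1, ?_⟩
  have := hn.2
  rw [add_mul, one_mul, mul_one_div] at this
  exact this

lemma pairwise_disjoint_strip (ε : Scale) :
    Pairwise (Function.onFun Disjoint fun k : ℤ => strip ε (k / ε)) := by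
  have := pairwise_disjoint_Ioc_zsmul (1 / (ε : ℝ))
  intro i j hij
  have h := this hij
  simp only [Function.onFun, zsmul_eq_mul] at h
  push_cast at h
  simp only [mul_one_div, add_div] at h
  exact Set.disjoint_prod.2 (Or.inr h)

lemma setIntegral_strip {f : ℝ × ℝ → ℝ} (ε : Scale) (k : ℤ) :
    ∫ p in strip ε 0, f (p.1, p.2 + k / ε) = ∫ p in strip ε (k / ε), f p := by
  rw [← integral_indicator (measurableSet_strip ε _), ← integral_indicator
    (measurableSet_strip ε _),
    ← integral_add_right_eq_self ((strip ε (k / ε)).indicator f) ((0, k / ε) : ℝ × ℝ)]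
  refine integral_congr_ae (Eventually.of_forall fun p => ?_)
  have : p + (0, k / (ε : ℝ)) = (p.1, p.2 + k / ε) := by
    refine Prod.ext ?_ rfl
    simp
  dsimp only
  rw [this]
  simp only [indicator, strip, mem_prod, mem_univ, true_and, mem_Ioc]
  congr 1
  rw [eq_iff_iff]
  constructor <;> rintro ⟨h1, h2⟩ <;> constructor <;> linarith

lemma hasSum_setIntegral_strip {f : ℝ × ℝ → ℝ} (hf : Integrable f) (ε : Scale) :
    HasSum (fun k : ℤ => ∫ p in strip ε 0, f (p.1, p.2 + k / ε)) (∫ p, f p) := by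
  simp only [setIntegral_strip]
  have := hasSum_integral_iUnion (fun k : ℤ => measurableSet_strip ε (k / ε))
    (pairwise_disjoint_strip ε) (f := f) (μ := volume) hf.integrableOn
  rwa [iUnion_strip, setIntegral_univ] at this

/-- Translates of a fundamental strip tile the plane, so the sum of the `L¹` norms of the translates
over one strip is the `L¹` norm of `f`, and summation commutes with integration. -/
lemma integrable_periodizedMollifier {f : ℝ × ℝ → ℝ} (hfm : Measurable f) (hf : Integrable f)
    (ε : Scale) : Integrable (periodizedMollifier f ε) ∧
      ∫ p, periodizedMollifier f ε p = ∫ p, f p := by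
  have hmp := measurePreserving_strip ε 0
  have hFi : ∀ k : ℤ, Integrable (fun p : ℝ × ℝ => f (p.1, p.2 + k / ε))
      (volume.restrict (strip ε 0)) := by
    intro k
    have := hf.comp_add_right ((0, k / ε) : ℝ × ℝ)
    refine (this.congr (Eventually.of_forall fun p => ?_)).restrict
    simp only [Prod.add_def, add_zero]
  have hsum := (hasSum_setIntegral_strip hf.norm ε).summable
  have hm := measurable_periodizedMollifier hfm ε
  have h1 := hasSum_integral_of_summable_integral_norm hFi hsum
  have h2 := h1.unique (hasSum_setIntegral_strip hf ε)
  refine ⟨?_, ?_⟩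
  · rw [← hmp.map_eq, integrable_map_measure hm.aestronglyMeasurable hmp.measurable.aemeasurable]
    refine ⟨(hm.comp hmp.measurable).aestronglyMeasurable, ?_⟩
    rw [hasFiniteIntegral_iff_enorm]
    refine lt_of_le_of_lt (lintegral_mono (g := fun p : ℝ × ℝ =>
      ∑' k : ℤ, ‖f (p.1, p.2 + k / ε)‖ₑ) fun p => enorm_tsum_le_tsum_enorm) ?_
    rw [lintegral_tsum fun k => (hFi k).1.enorm]
    simp only [← ofReal_integral_norm_eq_lintegral_enorm (hFi _)]
    rw [← ENNReal.ofReal_tsum_of_nonneg (fun k => integral_nonneg fun _ => norm_nonneg _) hsum]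
    exact ENNReal.ofReal_lt_top
  · rw [← h2, ← hmp.map_eq, integral_map hmp.measurable.aemeasurable hm.aestronglyMeasurable]
    rfl

/-- Unfolding of an integral against the periodized mollifier. -/
lemma integral_mul_periodizedMollifier {θ : ℝ × ℝ → ℝ} (hθ : Measurable θ) (ε : Scale)
    {H : Micro ε → ℝ} (hH : Measurable H)
    (hi : Integrable fun a : ℝ × ℝ => H (timeLift (fun x : ℝ => (x : AddCircle (1 / (ε : ℝ)))) a) *
      θ a) :
    ∫ p, H p * periodizedMollifier θ ε p =
      ∫ a : ℝ × ℝ, H (timeLift (fun x : ℝ => (x : AddCircle (1 / (ε : ℝ)))) a) * θ a := by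
  have hm : Measurable fun a : ℝ × ℝ =>
      H (timeLift (fun x : ℝ => (x : AddCircle (1 / (ε : ℝ)))) a) * θ a :=
    (hH.comp (measurable_timeLift (measurable_coe_circle ε))).mul hθ
  rw [← (integrable_periodizedMollifier hm hi ε).2]
  refine integral_congr_ae (Eventually.of_forall fun ⟨t, y⟩ => ?_)
  obtain ⟨x, rfl⟩ := QuotientAddGroup.mk_surjective y
  change H (t, (x : AddCircle (1 / (ε : ℝ)))) * ∑' k : ℤ, θ (t, x + k / ε) = ∑' k : ℤ,
    H (t, ((x + k / ε : ℝ) : AddCircle (1 / (ε : ℝ)))) * θ (t, x + k / ε)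
  rw [← tsum_mul_left]
  refine tsum_congr fun k => ?_
  congr 3
  rw [AddCircle.coe_add, show (k / ε : ℝ) = k • (1 / (ε : ℝ)) by
    rw [zsmul_eq_mul, mul_one_div], AddCircle.coe_zsmul, AddCircle.coe_period, smul_zero, add_zero]

variable {θ : ℝ × ℝ → ℝ}

/-! ### Mollified kernels -/

/-- Mollification removes the singularity at time zero: the dominating functions have the same mass
at every `u`. The resulting sup bound is the one entering the exponential moments. -/
lemma MollifierAssumption.exists_liftConv_bound (hθ : MollifierAssumption θ) :
    ∃ M ≥ 0, ∀ (g : ℝ × ℝ → ℝ) (C : ℝ), 0 ≤ C → Measurable g → (∀ p, p.1 ≤ 0 → g p = 0) →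
      (∀ p, 0 < p.1 → |g p| ≤ C * timeBound p.1) → ∀ u,
      Integrable (fun a => g (u - a) * θ a) ∧ |liftConv (timeLift fun x => x) g θ u| ≤ C * M := by
  obtain ⟨D, M, hDi, hDM, hD0, hD⟩ := hθ.exists_dominating
  refine ⟨M, by rw [← hDM 0]; exact integral_nonneg (hD0 0), fun g C hC hg hg0 hgb u => ?_⟩
  have hb : ∀ a, ‖g (u - a) * θ a‖ ≤ C * D u.1 a := by
    intro a
    rw [norm_mul, Real.norm_eq_abs, Real.norm_eq_abs]
    rcases le_or_gt (u.1 - a.1) 0 with h | h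
    · rw [hg0 (u - a) h, abs_zero, zero_mul]
      exact mul_nonneg hC (hD0 _ _)
    · calc |g (u - a)| * |θ a| ≤ C * timeBound (u.1 - a.1) * |θ a| :=
            mul_le_mul_of_nonneg_right (hgb (u - a) h) (abs_nonneg _)
        _ = C * (timeBound (u.1 - a.1) * |θ a|) := by ring
        _ ≤ _ := mul_le_mul_of_nonneg_left (hD u.1 a h) hC
  have hm : Measurable fun a => g (u - a) * θ a :=
    (hg.comp (measurable_const.sub measurable_id)).mul hθ.measurable
  refine ⟨((hDi u.1).const_mul C).mono' hm.aestronglyMeasurable (Eventually.of_forall hb), ?_⟩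
  rw [← hDM u.1, ← integral_const_mul, ← Real.norm_eq_abs]
  exact norm_integral_le_of_norm_le ((hDi u.1).const_mul C) (Eventually.of_forall hb)

/-- The mollified kernel with frequencies sampled by `ρ`. -/
def specConv (Q : Polynomial ℝ) (ρ : ℝ → ℝ) (θ : ℝ × ℝ → ℝ) : ℝ × ℝ → ℝ :=
  liftConv (timeLift fun x => x) (specKernel Q ρ) θ

lemma measurable_specConv (hθ : MollifierAssumption θ) {ρ : ℝ → ℝ} (hρ : IsSampling ρ) :
    Measurable (specConv Q ρ θ) :=
  measurable_liftConv (measurable_timeLift measurable_id) (measurable_specKernel Q hρ)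
    hθ.measurable

lemma exists_abs_specConv_le (hQ : SmoothingAssumption Q) (hθ : MollifierAssumption θ) :
    ∃ B ≥ 0, ∀ ρ, IsSampling ρ → ∀ u, Integrable (fun a => specKernel Q ρ (u - a) * θ a) ∧
      |specConv Q ρ θ u| ≤ B := by
  obtain ⟨C, hC, h⟩ := hQ.abs_specKernel_le
  obtain ⟨M, hM, hb⟩ := hθ.exists_liftConv_bound
  exact ⟨C * M, by positivity, fun ρ hρ u => hb _ C hC.le (measurable_specKernel Q hρ)
    (fun p hp => specKernel_of_nonpos Q ρ hp) (h ρ hρ) u⟩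

lemma tendsto_specConv (hQ : SmoothingAssumption Q) (hθ : MollifierAssumption θ) {ρ : ℕ → ℝ → ℝ}
    (hρ : ∀ n, IsSampling (ρ n)) (hlim : ∀ k, Tendsto (fun n => ρ n k) atTop (𝓝 k)) (u : ℝ × ℝ) :
    Tendsto (fun n => specConv Q (ρ n) θ u) atTop (𝓝 (specConv Q (fun k => k) θ u)) := by
  obtain ⟨C, hC, h⟩ := hQ.abs_specKernel_le
  obtain ⟨D, M, hDi, hDM, hD0, hD⟩ := hθ.exists_dominating
  refine tendsto_integral_of_dominated_convergence (fun a => C * D u.1 a) (fun n => ?_)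
    ((hDi u.1).const_mul C) (fun n => Eventually.of_forall fun a => ?_)
    (Eventually.of_forall fun a => (tendsto_specKernel hQ hρ hlim _).mul_const _)
  · exact (((measurable_specKernel Q (hρ n)).comp (measurable_const.sub measurable_id)).mul
      hθ.measurable).aestronglyMeasurable
  · change ‖specKernel Q (ρ n) (u - a) * θ a‖ ≤ _
    rw [norm_mul, Real.norm_eq_abs, Real.norm_eq_abs]
    rcases le_or_gt (u.1 - a.1) 0 with h' | h'
    · rw [specKernel_of_nonpos Q _ (p := u - a) h', abs_zero, zero_mul]
      exact mul_nonneg hC.le (hD0 _ _)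
    · calc |specKernel Q (ρ n) (u - a)| * |θ a| ≤ C * timeBound (u.1 - a.1) * |θ a| :=
            mul_le_mul_of_nonneg_right (h _ (hρ n) (u - a) h') (abs_nonneg _)
        _ = C * (timeBound (u.1 - a.1) * |θ a|) := by ring
        _ ≤ _ := mul_le_mul_of_nonneg_left (hD u.1 a h') hC.le

/-- A bound for the `L²` norms of the mollified kernels, uniform in the sampling. -/
lemma exists_integral_specCov_le (hQ : SmoothingAssumption Q) (hθ : MollifierAssumption θ) :
    ∃ B ≥ 0, ∀ ρ, IsSampling ρ →
      ∫ p : (ℝ × ℝ) × (ℝ × ℝ), θ p.1 * θ p.2 * specCov Q ρ (p.1 - p.2) ≤ B := by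
  obtain ⟨C, hC, h⟩ := hQ.abs_specCov_le
  refine ⟨∫ p : (ℝ × ℝ) × (ℝ × ℝ), ‖θ p.1‖ * ‖θ p.2‖ * C,
    integral_nonneg fun p => by positivity, fun ρ hρ => ?_⟩
  refine (le_abs_self _).trans (norm_integral_le_of_norm_le
    (f := fun p : (ℝ × ℝ) × (ℝ × ℝ) => θ p.1 * θ p.2 * specCov Q ρ (p.1 - p.2))
    ((hθ.integrable.norm.mul_prod hθ.integrable.norm).mul_const _)
    (Eventually.of_forall fun p => ?_))
  rw [norm_mul, norm_mul]
  exact mul_le_mul_of_nonneg_left (h _ hρ _) (by positivity)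

/-! ### The mollified kernel on the torus -/

/-- The mollified kernel on `ℝ × (𝕋 / ε)`. -/
def torusConv (Q : Polynomial ℝ) (θ : ℝ × ℝ → ℝ) (ε : Scale) : Micro ε → ℝ :=
  liftConv (timeLift fun x : ℝ => (x : AddCircle (1 / (ε : ℝ)))) (torusKernel Q ε) θ

lemma torusConv_coe (Q : Polynomial ℝ) (θ : ℝ × ℝ → ℝ) (ε : Scale) (u : ℝ × ℝ) :
    torusConv Q θ ε (timeLift (fun x : ℝ => (x : AddCircle (1 / (ε : ℝ)))) u) =
      specConv Q (latticeRound ε) θ u := rfl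

lemma surjective_timeLift_coe (ε : Scale) :
    Function.Surjective (timeLift fun x : ℝ => (x : AddCircle (1 / (ε : ℝ)))) := by
  rintro ⟨t, y⟩
  obtain ⟨x, rfl⟩ := QuotientAddGroup.mk_surjective y
  exact ⟨(t, x), rfl⟩

lemma measurable_torusConv (hθ : MollifierAssumption θ) (ε : Scale) :
    Measurable (torusConv Q θ ε) :=
  measurable_liftConv (measurable_timeLift (measurable_coe_circle ε)) (measurable_torusKernel Q ε)
    hθ.measurable

lemma integrable_sq_torusConv (hQ : SmoothingAssumption Q) (hθ : MollifierAssumption θ)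
    (ε : Scale) : Integrable (fun u => torusConv Q θ ε u ^ 2) ∧
      ∫ u, torusConv Q θ ε u ^ 2 = ∫ p : (ℝ × ℝ) × (ℝ × ℝ),
        θ p.1 * θ p.2 * specCov Q (latticeRound ε) (p.1 - p.2) :=
  ⟨(integral_sq_liftConv (measurable_timeLift (measurable_coe_circle ε))
      (measurable_torusKernel Q ε) hθ.measurable
      ((isSpectralKernel_torus hQ ε).integrable_sq hQ (AddCircle.coe_zero _)) hθ.integrable).1,
    (isSpectralKernel_torus hQ ε).integral_sq_liftConv hQ (AddCircle.coe_zero _)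
      (measurable_coe_circle ε) hθ⟩

/-- Unfolding: convolving on the cylinder with the periodised mollifier is convolving with `θ` over
the whole plane through the projection. -/
lemma noiseKernel_torus (hQ : SmoothingAssumption Q) (hθ : MollifierAssumption θ) (ε : Scale)
    (w u : Micro ε) :
    noiseKernel volume (fun v => torusKernel Q ε (w - v)) (periodizedMollifier θ ε) u =
      torusConv Q θ ε (w - u) := by
  obtain ⟨B, hB, hb⟩ := exists_abs_specConv_le hQ hθ
  obtain ⟨x, hx⟩ := surjective_timeLift_coe ε (w - u)
  have hi : Integrable fun a : ℝ × ℝ => torusKernel Q ε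
      (w - u - timeLift (fun x : ℝ => (x : AddCircle (1 / (ε : ℝ)))) a) * θ a := by
    rw [← hx]
    exact (hb _ (isSampling_scale ε) x).1
  have h1 := integral_mul_periodizedMollifier hθ.measurable ε
    (H := fun v => torusKernel Q ε (w - u - v))
    ((measurable_torusKernel Q ε).comp (measurable_const.sub measurable_id)) hi
  rw [noiseKernel, torusConv, liftConv, ← h1,
    ← integral_sub_right_eq_self (fun v => torusKernel Q ε (w - u - v) *
      periodizedMollifier θ ε v) u]
  refine integral_congr_ae (Eventually.of_forall fun y => ?_)
  dsimp only
  rw [sub_sub_sub_cancel_right]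

lemma integrable_torusConv_sub (hQ : SmoothingAssumption Q) (hθ : MollifierAssumption θ)
    (ε : Scale) (w : Micro ε) : Integrable fun u => torusConv Q θ ε (w - u) := by
  have := integrable_noiseKernel (μ := (volume : Measure (Micro ε)))
    (f := fun v => torusKernel Q ε (w - v)) (τ := periodizedMollifier θ ε)
    ((measurable_torusKernel Q ε).comp (measurable_const.sub measurable_id))
    (measurable_periodizedMollifier hθ.measurable ε)
    ((integrable_torusKernel hQ ε).comp_sub_left w)
    (integrable_periodizedMollifier hθ.measurable hθ.integrable ε).1
  exact this.congr (Eventually.of_forall (noiseKernel_torus hQ hθ ε w))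

/-! ### Laws of compensated Poisson integrals -/

section Law

variable {Ω E : Type*} [MeasurableSpace Ω] [MeasurableSpace E] {Pr : Measure Ω}
  {η : Ω → Measure E} {μ : Measure E}

/-- The random variable `X` has the characteristic function of a compensated Poisson integral of
`k` and an exponential moment bounded by `B`. -/
structure HasPoissonLaw (μ : Measure E) (k : E → ℝ) (B : ℝ) (Pr : Measure Ω) (X : Ω → ℝ) :
    Prop where
  aemeasurable : AEMeasurable X Pr
  integrable_exp : Integrable (fun ω => Real.exp |X ω|) Pr
  integral_exp_le : ∫ ω, Real.exp |X ω| ∂Pr ≤ B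
  charFun_eq : ∀ l : ℝ, charFun (Pr.map X) l = Complex.exp (cumulant μ k (l * Complex.I))

lemma IsPoissonProcess.hasPoissonLaw [IsProbabilityMeasure Pr] [SFinite μ]
    (h : IsPoissonProcess η μ Pr) {k : E → ℝ}
    (hk : Measurable k) (hki : Integrable k μ) (hk2 : Integrable (fun x => k x ^ 2) μ) {C : ℝ}
    (hC : ∀ x, |k x| ≤ C) {X : Ω → ℝ} (hX : ∀ᵐ ω ∂Pr, X ω = compensated (η ω) μ k) :
    HasPoissonLaw μ k (2 * Real.exp (Real.exp C * ∫ x, k x ^ 2 ∂μ)) Pr X := by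
  have hexp := h.integral_exp_abs_compensated_le hk hki hk2 hC
  have he : (fun ω => Real.exp |X ω|) =ᵐ[Pr] fun ω => Real.exp |compensated (η ω) μ k| := by
    filter_upwards [hX] with ω hω
    rw [hω]
  refine ⟨(h.aestronglyMeasurable_compensated hk hki).aemeasurable.congr
    (hX.mono fun _ h => h.symm), hexp.1.congr he.symm, ?_, fun l => ?_⟩
  · rw [integral_congr_ae he]; exact hexp.2
  · rw [Measure.map_congr hX]
    exact h.charFun_compensated hk hki hC l

lemma HasPoissonLaw.integrable_map {k : E → ℝ} {B : ℝ} {X : Ω → ℝ}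
    (h : HasPoissonLaw μ k B Pr X) :
    Integrable (fun x => Real.exp |x|) (Pr.map X) ∧ ∫ x, Real.exp |x| ∂(Pr.map X) ≤ B := by
  have hm : Continuous fun x : ℝ => Real.exp |x| := by fun_prop
  rw [integrable_map_measure hm.aestronglyMeasurable h.aemeasurable,
    integral_map h.aemeasurable hm.aestronglyMeasurable]
  exact ⟨h.integrable_exp, h.integral_exp_le⟩

lemma HasPoissonLaw.integrable_comp [IsProbabilityMeasure Pr] {k : E → ℝ} {B : ℝ} {X : Ω → ℝ}
    (h : HasPoissonLaw μ k B Pr X) {g : ℝ → ℝ} (hg : Continuous g) {A : ℝ}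
    (hA : ∀ x, g x ^ 2 ≤ A * Real.exp |x|) : Integrable (fun ω => g (X ω)) Pr := by
  refine ((integrable_const (1 : ℝ)).add (h.integrable_exp.const_mul A)).mono'
    (hg.measurable.comp_aemeasurable h.aemeasurable).aestronglyMeasurable
    (Eventually.of_forall fun ω => ?_)
  rw [Real.norm_eq_abs]
  have := hA (X ω)
  rw [← sq_abs] at this
  simp only [Pi.add_apply]
  nlinarith [sq_nonneg (|g (X ω)| - 1)]

/-- Characteristic functions determine laws, so equality of the cumulant functionals suffices, even
across different probability spaces. -/
lemma HasPoissonLaw.integral_comp_eq [IsProbabilityMeasure Pr] {E' Ω' : Type*}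
    [MeasurableSpace E'] [MeasurableSpace Ω'] {Pr' : Measure Ω'} [IsProbabilityMeasure Pr']
    {μ' : Measure E'} {k : E → ℝ} {k' : E' → ℝ} {B B' : ℝ} {X : Ω → ℝ} {X' : Ω' → ℝ}
    (h : HasPoissonLaw μ k B Pr X) (h' : HasPoissonLaw μ' k' B' Pr' X')
    (hk : ∀ w, cumulant μ k w = cumulant μ' k' w) {g : ℝ → ℝ} (hg : Continuous g) :
    ∫ ω, g (X ω) ∂Pr = ∫ ω, g (X' ω) ∂Pr' := by
  have := Measure.isProbabilityMeasure_map h.aemeasurable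
  have := Measure.isProbabilityMeasure_map h'.aemeasurable
  have e : Pr.map X = Pr'.map X' := Measure.ext_of_charFun (by
    funext l
    rw [h.charFun_eq, h'.charFun_eq, hk])
  rw [← integral_map h.aemeasurable hg.aestronglyMeasurable,
    ← integral_map h'.aemeasurable hg.aestronglyMeasurable, e]

end Law

/-! ### Continuity and growth of the second derivative of the nonlinearity -/

lemma NonlinearityAssumption.continuous_deriv {F : ℝ → ℝ} (hF : NonlinearityAssumption F) :
    Continuous (iteratedDeriv 2 F) :=
  hF.contDiff.continuous_iteratedDeriv 2 le_rfl

/-- A polynomial bound of degree `M`, squared, is below a power `N ≥ 2M` of `1 + |x|`, and `y ^ N ≤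
N! exp y`. -/
lemma NonlinearityAssumption.exists_sq_le {F : ℝ → ℝ} (hF : NonlinearityAssumption F) :
    ∃ A, ∀ x, iteratedDeriv 2 F x ^ 2 ≤ A * Real.exp |x| := by
  obtain ⟨C, hC, M, hM, β, -, h, -⟩ := hF.growth
  set N := ⌈2 * M⌉₊ with hN
  refine ⟨C ^ 2 * (N.factorial * Real.exp 1), fun x => ?_⟩
  have h1 := h 2 le_rfl x
  have h0 : 1 ≤ 1 + |x| := by linarith [abs_nonneg x]
  have h0' : 0 < 1 + |x| := by linarith
  have h2 : ((1 + |x|) ^ M) ^ 2 ≤ N.factorial * Real.exp 1 * Real.exp |x| := by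
    calc ((1 + |x|) ^ M) ^ 2 = (1 + |x|) ^ (2 * M) := by
          rw [← Real.rpow_natCast, ← Real.rpow_mul h0'.le, mul_comm]; norm_num
      _ ≤ (1 + |x|) ^ (N : ℝ) := Real.rpow_le_rpow_of_exponent_le h0 (Nat.le_ceil _)
      _ = (1 + |x|) ^ N := Real.rpow_natCast _ _
      _ ≤ N.factorial * Real.exp (1 + |x|) := by
          have := Real.pow_div_factorial_le_exp (1 + |x|) h0'.le N
          rwa [div_le_iff₀ (by positivity), mul_comm] at this
      _ = _ := by rw [Real.exp_add]; ring
  calc iteratedDeriv 2 F x ^ 2 = |iteratedDeriv 2 F x| ^ 2 := (sq_abs _).symm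
    _ ≤ (C * (1 + |x|) ^ M) ^ 2 := by gcongr
    _ = C ^ 2 * ((1 + |x|) ^ M) ^ 2 := by ring
    _ ≤ C ^ 2 * (N.factorial * Real.exp 1 * Real.exp |x|) := by gcongr
    _ = _ := by ring

/-! ### The free field on the torus -/

section TorusField

variable {ε : Scale} {Ω : Type*} [MeasurableSpace Ω] {Pr : Measure Ω} [IsProbabilityMeasure Pr]
  {η : Ω → Measure (Micro ε)}

lemma IsPoissonProcess.ae_freeField (hQ : SmoothingAssumption Q) (hθ : MollifierAssumption θ)
    (h : IsPoissonProcess η volume Pr) (z : Macro) :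
    ∀ᵐ ω ∂Pr, Integrable (fun y => greenTorusDeriv Q ε (z - y) * macroNoise θ ε (η ω) y) ∧
      √(ε : ℝ) * freeField Q θ ε (η ω) z =
        compensated (η ω) volume fun u => torusConv Q θ ε (macroToMicro ε z - u) := by
  have hp := integrable_periodizedMollifier hθ.measurable hθ.integrable ε
  have := h.ae_integral_mul_noise (f := fun v => torusKernel Q ε (macroToMicro ε z - v))
    (τ := periodizedMollifier θ ε)
    ((measurable_torusKernel Q ε).comp (measurable_const.sub measurable_id))
    (measurable_periodizedMollifier hθ.measurable ε)
    ((integrable_torusKernel hQ ε).comp_sub_left _) hp.1 (hp.2.trans hθ.integral_eq_one)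
  filter_upwards [this] with ω hω
  obtain ⟨h1, h2⟩ := freeField_eq hQ θ ε (η ω) z
  refine ⟨h1 hω.1, h2.trans (hω.2.trans ?_)⟩
  congr 1
  funext u
  exact noiseKernel_torus hQ hθ ε _ u

/-- The bound is chosen before `ε`, since the sup and `L²` bounds are uniform over samplings. The
law is recorded with the unshifted kernel, because the cumulant is invariant under `u ↦ w - u`; this
is the source of independence of the base point. -/
lemma exists_hasPoissonLaw_freeField (hQ : SmoothingAssumption Q) (hθ : MollifierAssumption θ) :
    ∃ B, ∀ (ε : Scale) {Ω : Type*} [MeasurableSpace Ω] (Pr : Measure Ω) [IsProbabilityMeasure Pr]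
      (η : Ω → Measure (Micro ε)), IsPoissonProcess η volume Pr → ∀ z : Macro,
      HasPoissonLaw volume (torusConv Q θ ε) B Pr fun ω => √(ε : ℝ) * freeField Q θ ε (η ω) z := by
  obtain ⟨C, hC, hb⟩ := exists_abs_specConv_le hQ hθ
  obtain ⟨L, hL, hL2⟩ := exists_integral_specCov_le hQ hθ
  refine ⟨2 * Real.exp (Real.exp C * L), fun ε Ω _ Pr _ η h z => ?_⟩
  have hm := measurable_torusConv (Q := Q) hθ ε
  obtain ⟨h2, h2'⟩ := integrable_sq_torusConv hQ hθ ε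
  set w := macroToMicro ε z with hw
  have hbd : ∀ u, |torusConv Q θ ε (w - u)| ≤ C := by
    intro u
    obtain ⟨x, hx⟩ := surjective_timeLift_coe ε (w - u)
    rw [← hx, torusConv_coe]
    exact (hb _ (isSampling_scale ε) x).2
  have law := h.hasPoissonLaw (k := fun u => torusConv Q θ ε (w - u))
    (hm.comp (measurable_const.sub measurable_id)) (integrable_torusConv_sub hQ hθ ε w)
    (h2.comp_sub_left w) hbd ((h.ae_freeField hQ hθ z).mono fun _ h => h.2)
  refine ⟨law.aemeasurable, law.integrable_exp, law.integral_exp_le.trans ?_, fun l => ?_⟩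
  · rw [integral_sub_left_eq_self (fun u => torusConv Q θ ε u ^ 2) volume w, h2']
    gcongr
    exact hL2 _ (isSampling_scale ε)
  · rw [law.charFun_eq, cumulant, cumulant]
    congr 1
    exact integral_sub_left_eq_self (fun u => Complex.exp (l * Complex.I * torusConv Q θ ε u) - 1 -
      l * Complex.I * torusConv Q θ ε u) volume w

end TorusField

/-! ### Restriction of the kernel on the line to a set of times -/

/-- The kernel on the line restricted to the times in `I`. -/
def lineKernelOn (Q : Polynomial ℝ) (I : Set ℝ) : ℝ × ℝ → ℝ :=
  (I ×ˢ univ).indicator (specKernel Q fun k => k)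

/-- The mollification of the restricted kernel. -/
def lineConvOn (Q : Polynomial ℝ) (θ : ℝ × ℝ → ℝ) (I : Set ℝ) : ℝ × ℝ → ℝ :=
  liftConv (timeLift fun x => x) (lineKernelOn Q I) θ

lemma lineConvOn_univ : lineConvOn Q θ univ = specConv Q (fun k => k) θ := by
  unfold lineConvOn lineKernelOn specConv
  rw [univ_prod_univ, indicator_univ]

lemma measurable_lineKernelOn {I : Set ℝ} (hI : MeasurableSet I) :
    Measurable (lineKernelOn Q I) :=
  (measurable_specKernel Q IsSampling.id).indicator (hI.prod MeasurableSet.univ)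

lemma measurable_lineConvOn (hθ : MollifierAssumption θ) {I : Set ℝ} (hI : MeasurableSet I) :
    Measurable (lineConvOn Q θ I) :=
  measurable_liftConv (measurable_timeLift measurable_id) (measurable_lineKernelOn hI)
    hθ.measurable

lemma abs_lineKernelOn_le (I : Set ℝ) (p : ℝ × ℝ) :
    |lineKernelOn Q I p| ≤ |specKernel Q (fun k => k) p| :=
  norm_indicator_le_norm_self (specKernel Q fun k => k) p

lemma exists_abs_lineConvOn_le (hQ : SmoothingAssumption Q) (hθ : MollifierAssumption θ) :
    ∃ B ≥ 0, ∀ I, MeasurableSet I → ∀ u, Integrable (fun a => lineKernelOn Q I (u - a) * θ a) ∧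
      |lineConvOn Q θ I u| ≤ B := by
  obtain ⟨C, hC, h⟩ := hQ.abs_specKernel_le
  obtain ⟨M, hM, hb⟩ := hθ.exists_liftConv_bound
  refine ⟨C * M, by positivity, fun I hI u => hb _ C hC.le (measurable_lineKernelOn hI)
    (fun p hp => ?_) (fun p hp => (abs_lineKernelOn_le I p).trans (h _ IsSampling.id p hp)) u⟩
  have := abs_lineKernelOn_le (Q := Q) I p
  rw [specKernel_of_nonpos Q _ hp, abs_zero] at this
  exact abs_nonpos_iff.1 this

lemma lineConvOn_union (hQ : SmoothingAssumption Q) (hθ : MollifierAssumption θ) {I J : Set ℝ}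
    (hI : MeasurableSet I) (hJ : MeasurableSet J) (hd : Disjoint I J) (u : ℝ × ℝ) :
    lineConvOn Q θ (I ∪ J) u = lineConvOn Q θ I u + lineConvOn Q θ J u := by
  obtain ⟨B, hB, hb⟩ := exists_abs_lineConvOn_le hQ hθ
  unfold lineConvOn liftConv
  refine Eq.trans ?_ (integral_add (hb I hI u).1 (hb J hJ u).1)
  refine integral_congr_ae (Eventually.of_forall fun a => ?_)
  change lineKernelOn Q (I ∪ J) (u - a) * θ a =
    lineKernelOn Q I (u - a) * θ a + lineKernelOn Q J (u - a) * θ a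
  rw [← add_mul]
  congr 1
  unfold lineKernelOn
  rw [union_prod, indicator_union_of_disjoint (Set.disjoint_prod.2 (Or.inl hd))]

lemma integrable_sq_lineKernel (hQ : SmoothingAssumption Q) :
    Integrable fun p => specKernel Q (fun k => k) p ^ 2 :=
  (isSpectralKernel_line hQ).integrable_sq hQ rfl

lemma lineKernelOn_sq (I : Set ℝ) : (fun p => lineKernelOn Q I p ^ 2) =
    (I ×ˢ univ).indicator fun p => specKernel Q (fun k => k) p ^ 2 := by
  funext p
  unfold lineKernelOn
  by_cases h : p ∈ I ×ˢ (univ : Set ℝ)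
  · rw [indicator_of_mem h, indicator_of_mem h]
  · rw [indicator_of_notMem h, indicator_of_notMem h]
    norm_num

lemma integral_sq_lineConvOn_le (hQ : SmoothingAssumption Q) (hθ : MollifierAssumption θ)
    {I : Set ℝ} (hI : MeasurableSet I) :
    Integrable (fun u => lineConvOn Q θ I u ^ 2) ∧ ∫ u, lineConvOn Q θ I u ^ 2 ≤
      (∫ a, |θ a|) ^ 2 * ∫ p in I ×ˢ univ, specKernel Q (fun k => k) p ^ 2 := by
  have hI' : MeasurableSet (I ×ˢ (univ : Set ℝ)) := hI.prod MeasurableSet.univ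
  have hi : Integrable fun p => lineKernelOn Q I p ^ 2 := by
    rw [lineKernelOn_sq]
    exact (integrable_sq_lineKernel hQ).indicator hI'
  refine ⟨(integral_sq_liftConv (measurable_timeLift measurable_id) (measurable_lineKernelOn hI)
    hθ.measurable hi hθ.integrable).1, (integral_sq_liftConv_le (measurable_timeLift measurable_id)
      (measurable_lineKernelOn hI) hθ.measurable hi hθ.integrable).trans (le_of_eq ?_)⟩
  rw [lineKernelOn_sq, integral_indicator hI']

/-- A bound for the `L²` norm of the mollified kernel after time `T`. -/
def lineTail (Q : Polynomial ℝ) (θ : ℝ × ℝ → ℝ) (T : ℝ) : ℝ :=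
  (∫ a, |θ a|) ^ 2 * ∫ p in Ici T ×ˢ univ, specKernel Q (fun k => k) p ^ 2

lemma tendsto_lineTail (hQ : SmoothingAssumption Q) :
    Tendsto (lineTail Q θ) atTop (𝓝 0) := by
  have h : Tendsto (fun T : ℝ => ∫ p, (Ici T ×ˢ (univ : Set ℝ)).indicator
      (fun p => specKernel Q (fun k => k) p ^ 2) p) atTop (𝓝 (∫ _ : ℝ × ℝ, (0 : ℝ))) := by
    refine tendsto_integral_filter_of_dominated_convergence
      (fun p => specKernel Q (fun k => k) p ^ 2) (Eventually.of_forall fun T => ?_)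
      (Eventually.of_forall fun T => Eventually.of_forall fun p => ?_)
      (integrable_sq_lineKernel hQ) (Eventually.of_forall fun p => ?_)
    · exact ((integrable_sq_lineKernel hQ).indicator
        (measurableSet_Ici.prod MeasurableSet.univ)).1
    · refine (norm_indicator_le_norm_self _ _).trans (le_of_eq ?_)
      exact Real.norm_of_nonneg (sq_nonneg _)
    · refine tendsto_const_nhds.congr' ?_
      filter_upwards [eventually_gt_atTop p.1] with T hT
      rw [indicator_of_notMem]
      rintro ⟨h1, -⟩
      exact absurd (mem_Ici.1 h1) (not_le.2 hT)
  have := h.const_mul ((∫ a, |θ a|) ^ 2)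
  rw [integral_zero, mul_zero] at this
  refine this.congr fun T => ?_
  rw [integral_indicator (measurableSet_Ici.prod MeasurableSet.univ), lineTail]

lemma integral_sq_lineConvOn_le_lineTail (hQ : SmoothingAssumption Q)
    (hθ : MollifierAssumption θ) {I : Set ℝ} (hI : MeasurableSet I) {T : ℝ} (h : I ⊆ Ici T) :
    ∫ u, lineConvOn Q θ I u ^ 2 ≤ lineTail Q θ T :=
  (integral_sq_lineConvOn_le hQ hθ hI).2.trans (mul_le_mul_of_nonneg_left
    (setIntegral_mono_set (integrable_sq_lineKernel hQ).integrableOn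
      (Eventually.of_forall fun _ => sq_nonneg _)
      (LE.le.eventuallyLE (prod_mono_left h))) (sq_nonneg _))

/-- Up to a finite age `T` the factor `(1 + t)²` in the decay bound is harmless, `timeBound` is
integrable at zero, and `1 / (1 + x²)` is integrable in space. -/
lemma integrable_lineKernelOn_Iio (hQ : SmoothingAssumption Q) (T : ℝ) :
    Integrable (lineKernelOn Q (Iio T)) := by
  obtain ⟨C, hC, h⟩ := hQ.exists_abs_lineKernel_le
  have h1 : Integrable ((Ioo (0 : ℝ) T).indicator timeBound) := by
    rw [integrable_indicator_iff measurableSet_Ioo]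
    rcases le_or_gt T 0 with hT | hT
    · rw [Ioo_eq_empty (not_lt.2 hT)]
      exact integrableOn_empty
    · refine IntegrableOn.mono_set ?_ Ioo_subset_Ioc_self
      rw [← intervalIntegrable_iff_integrableOn_Ioc_of_le hT.le]
      exact intervalIntegrable_const.add (intervalIntegral.intervalIntegrable_rpow' (by norm_num))
  have h2 := (h1.const_mul (C * (1 + T) ^ 2)).mul_prod integrable_inv_one_add_sq
  refine h2.mono' (measurable_lineKernelOn measurableSet_Iio).aestronglyMeasurable
    (Eventually.of_forall fun ⟨t, x⟩ => ?_)
  rw [Real.norm_eq_abs]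
  dsimp only
  by_cases ht : t ∈ Ioo 0 T
  · rw [indicator_of_mem ht]
    refine ((abs_lineKernelOn_le _ _).trans (h t x ht.1)).trans ?_
    have := timeBound_nonneg ht.1
    have h3 : (1 + t) ^ 2 ≤ (1 + T) ^ 2 := by
      have := ht.1; have := ht.2; gcongr
    have h4 : C * (1 + t) ^ 2 * timeBound t ≤ C * (1 + T) ^ 2 * timeBound t :=
      mul_le_mul_of_nonneg_right (mul_le_mul_of_nonneg_left h3 hC.le) this
    exact mul_le_mul_of_nonneg_right h4 (by positivity)
  · rw [indicator_of_notMem ht, mul_zero, zero_mul]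
    refine le_of_eq (abs_eq_zero.2 ?_)
    rcases le_or_gt t 0 with h0 | h0
    · have := abs_lineKernelOn_le (Q := Q) (Iio T) (t, x)
      rw [specKernel_of_nonpos Q _ (p := (t, x)) h0, abs_zero] at this
      exact abs_nonpos_iff.1 this
    · refine indicator_of_notMem ?_ _
      rintro ⟨h1, -⟩
      exact ht ⟨h0, h1⟩

lemma noiseKernel_line (I : Set ℝ) (u : ℝ × ℝ) :
    noiseKernel volume (fun y => lineKernelOn Q I (-y)) θ u = lineConvOn Q θ I (-u) := by
  rw [noiseKernel, lineConvOn, liftConv, ← integral_sub_right_eq_self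
    (fun a => lineKernelOn Q I (-u - timeLift (fun x => x) a) * θ a) u]
  refine integral_congr_ae (Eventually.of_forall fun y => ?_)
  change _ = lineKernelOn Q I (-u - (y - u)) * θ (y - u)
  rw [show -u - (y - u) = -y by abel]

lemma integrable_lineConvOn_Iio (hQ : SmoothingAssumption Q) (hθ : MollifierAssumption θ)
    (T : ℝ) : Integrable fun u => lineConvOn Q θ (Iio T) (-u) := by
  have := integrable_noiseKernel (μ := (volume : Measure (ℝ × ℝ)))
    (f := fun y => lineKernelOn Q (Iio T) (-y)) (τ := θ)
    ((measurable_lineKernelOn measurableSet_Iio).comp measurable_neg) hθ.measurable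
    (integrable_lineKernelOn_Iio hQ T).comp_neg hθ.integrable
  exact this.congr (Eventually.of_forall (noiseKernel_line _))

/-! ### The truncated convolution -/

section LineField

variable {Ω : Type*} [MeasurableSpace Ω] {Pr : Measure Ω} [IsProbabilityMeasure Pr]
  {η : Ω → Measure (ℝ × ℝ)}

/-- Times in `(-T, 0)` correspond to ages in `(0, T)`; as the kernel vanishes at nonpositive ages,
the half-line `Iio T` describes the same truncation and is easier to decompose. -/
lemma indicator_convIntegrand (hQ : SmoothingAssumption Q) (θ : ℝ × ℝ → ℝ)
    (η : Measure (ℝ × ℝ)) (T : ℝ) :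
    (Ioo (-T) 0 ×ˢ univ).indicator (convIntegrand Q θ η) =
      fun y => lineKernelOn Q (Iio T) (-y) * ((∫ u, θ (y - u) ∂η) - 1) := by
  funext y
  by_cases h : y ∈ Ioo (-T) 0 ×ˢ (univ : Set ℝ)
  · rw [indicator_of_mem h, convIntegrand, greenLineDeriv_eq hQ, lineKernelOn,
      indicator_of_mem, wholeNoise]
    exact ⟨by have := h.1.1; simp only [Prod.fst_neg, mem_Iio]; linarith, mem_univ _⟩
  · rw [indicator_of_notMem h]
    have : lineKernelOn Q (Iio T) (-y) = 0 := by
      unfold lineKernelOn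
      by_cases h1 : -y ∈ Iio T ×ˢ (univ : Set ℝ)
      · rw [indicator_of_mem h1]
        refine specKernel_of_nonpos Q _ ?_
        by_contra h2
        refine h ⟨⟨?_, ?_⟩, mem_univ _⟩
        · have := h1.1
          simp only [Prod.fst_neg, mem_Iio] at this
          linarith
        · simp only [Prod.fst_neg, not_le] at h2
          linarith
      · exact indicator_of_notMem h1 _
    rw [this, zero_mul]

lemma IsPoissonProcess.ae_truncatedConv (hQ : SmoothingAssumption Q)
    (hθ : MollifierAssumption θ) (h : IsPoissonProcess η volume Pr) (T : ℝ) :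
    ∀ᵐ ω ∂Pr, IntegrableOn (convIntegrand Q θ (η ω)) (Ioo (-T) 0 ×ˢ univ) ∧
      truncatedConv Q θ T (η ω) =
        compensated (η ω) volume fun u => lineConvOn Q θ (Iio T) (-u) := by
  have := h.ae_integral_mul_noise (f := fun y => lineKernelOn Q (Iio T) (-y)) (τ := θ)
    ((measurable_lineKernelOn measurableSet_Iio).comp measurable_neg) hθ.measurable
    (integrable_lineKernelOn_Iio hQ T).comp_neg hθ.integrable hθ.integral_eq_one
  have hms : MeasurableSet (Ioo (-T) 0 ×ˢ (univ : Set ℝ)) :=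
    measurableSet_Ioo.prod MeasurableSet.univ
  filter_upwards [this] with ω hω
  rw [← integrable_indicator_iff hms, truncatedConv, ← integral_indicator hms,
    indicator_convIntegrand hQ]
  refine ⟨hω.1, hω.2.trans ?_⟩
  congr 1
  funext u
  exact noiseKernel_line _ u

/-- The law of the truncated convolution, with a bound uniform in the truncation. -/
lemma IsPoissonProcess.exists_hasPoissonLaw_truncatedConv (hQ : SmoothingAssumption Q)
    (hθ : MollifierAssumption θ) (h : IsPoissonProcess η volume Pr) :
    ∃ B, ∀ T, HasPoissonLaw volume (lineConvOn Q θ (Iio T)) B Pr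
      fun ω => truncatedConv Q θ T (η ω) := by
  obtain ⟨C, hC, hb⟩ := exists_abs_lineConvOn_le hQ hθ
  set L := (∫ a, |θ a|) ^ 2 * ∫ p, specKernel Q (fun k => k) p ^ 2 with hL
  refine ⟨2 * Real.exp (Real.exp C * L), fun T => ?_⟩
  have hm := measurable_lineConvOn (Q := Q) hθ (measurableSet_Iio (a := T))
  obtain ⟨h2, h2'⟩ := integral_sq_lineConvOn_le hQ hθ (measurableSet_Iio (a := T))
  have law := h.hasPoissonLaw (k := fun u => lineConvOn Q θ (Iio T) (-u))
    (hm.comp measurable_neg) (integrable_lineConvOn_Iio hQ hθ T) h2.comp_neg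
    (fun u => (hb _ measurableSet_Iio (-u)).2) ((h.ae_truncatedConv hQ hθ T).mono fun _ h => h.2)
  refine ⟨law.aemeasurable, law.integrable_exp, law.integral_exp_le.trans ?_, fun l => ?_⟩
  · rw [integral_neg_eq_self (fun u => lineConvOn Q θ (Iio T) u ^ 2) volume]
    gcongr
    refine h2'.trans (mul_le_mul_of_nonneg_left ?_ (sq_nonneg _))
    exact setIntegral_le_integral (integrable_sq_lineKernel hQ)
      (Eventually.of_forall fun _ => sq_nonneg _)
  · rw [law.charFun_eq, cumulant, cumulant]
    congr 1
    exact integral_neg_eq_self (fun u => Complex.exp (l * Complex.I * lineConvOn Q θ (Iio T) u) -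
      1 - l * Complex.I * lineConvOn Q θ (Iio T) u) volume

/-- By linearity the increment is a compensated integral whose kernel uses only ages in `[S, T)`.
Its sup norm is bounded independently of `S` and `T`, and its squared `L²` norm is at most the tail
after `S`. -/
lemma IsPoissonProcess.exists_integral_sq_truncatedConv_sub_le (hQ : SmoothingAssumption Q)
    (hθ : MollifierAssumption θ) (h : IsPoissonProcess η volume Pr) :
    ∃ C, ∀ S T : ℝ, S ≤ T →
      Integrable (fun ω => (truncatedConv Q θ T (η ω) - truncatedConv Q θ S (η ω)) ^ 2) Pr ∧
      ∫ ω, (truncatedConv Q θ T (η ω) - truncatedConv Q θ S (η ω)) ^ 2 ∂Pr ≤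
        2 * Real.exp (Real.exp C * lineTail Q θ S) - 2 := by
  obtain ⟨C, hC, hb⟩ := exists_abs_lineConvOn_le hQ hθ
  refine ⟨C, fun S T hST => ?_⟩
  have hI : MeasurableSet (Ico S T) := measurableSet_Ico
  have hm := measurable_lineConvOn (Q := Q) hθ hI
  obtain ⟨h2, -⟩ := integral_sq_lineConvOn_le hQ hθ hI
  have hadd : ∀ u, lineConvOn Q θ (Iio T) u =
      lineConvOn Q θ (Iio S) u + lineConvOn Q θ (Ico S T) u := by
    intro u
    rw [← lineConvOn_union hQ hθ measurableSet_Iio hI, Iio_union_Ico_eq_Iio hST]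
    exact Set.disjoint_left.2 fun x h1 h2 => absurd h1 (not_lt.2 h2.1)
  have hsub : (fun u => lineConvOn Q θ (Ico S T) (-u)) = fun u =>
      lineConvOn Q θ (Iio T) (-u) - lineConvOn Q θ (Iio S) (-u) := by
    funext u
    rw [hadd]; ring
  have hki : Integrable fun u => lineConvOn Q θ (Ico S T) (-u) := by
    rw [hsub]
    exact (integrable_lineConvOn_Iio hQ hθ T).sub (integrable_lineConvOn_Iio hQ hθ S)
  obtain ⟨h3, h4⟩ := h.integral_sq_compensated_le (hm.comp measurable_neg) hki h2.comp_neg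
    (fun u => (hb _ hI (-u)).2)
  have hmI : ∀ T, Measurable fun u => lineConvOn Q θ (Iio T) (-u) := fun T =>
    (measurable_lineConvOn hθ measurableSet_Iio).comp measurable_neg
  have e : (fun ω => (truncatedConv Q θ T (η ω) - truncatedConv Q θ S (η ω)) ^ 2) =ᵐ[Pr]
      fun ω => compensated (η ω) volume (fun u => lineConvOn Q θ (Ico S T) (-u)) ^ 2 := by
    filter_upwards [h.ae_truncatedConv hQ hθ T, h.ae_truncatedConv hQ hθ S,
      h.ae_integrable (hmI T) (integrable_lineConvOn_Iio hQ hθ T),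
      h.ae_integrable (hmI S) (integrable_lineConvOn_Iio hQ hθ S)] with ω hT hS hT' hS'
    rw [hT.2, hS.2, compensated, compensated, compensated, hsub, integral_sub hT' hS',
      integral_sub (integrable_lineConvOn_Iio hQ hθ T) (integrable_lineConvOn_Iio hQ hθ S)]
    ring
  refine ⟨h3.congr e.symm, ?_⟩
  rw [integral_congr_ae e]
  refine h4.trans ?_
  have h5 : ∫ u, lineConvOn Q θ (Ico S T) (-u) ^ 2 ≤ lineTail Q θ S := by
    rw [integral_neg_eq_self (fun u => lineConvOn Q θ (Ico S T) u ^ 2) volume]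
    exact integral_sq_lineConvOn_le_lineTail hQ hθ hI fun x hx => hx.1
  gcongr
  exact h5

end LineField

/-! ### Convergence of cumulants -/

/-- The integrand is at most a constant times `k²`, uniformly under the sup bound. Letting the
majorant `g n` vary with `n` means that convergence of its integrals can replace a common dominating
function. -/
lemma tendsto_cumulant {E : Type*} [MeasurableSpace E] {μ : Measure E} {k : ℕ → E → ℝ}
    {k₀ : E → ℝ} {g : ℕ → E → ℝ} {g₀ : E → ℝ} {C : ℝ} (hk : ∀ n, Measurable (k n))
    (hC : ∀ n x, |k n x| ≤ C) (hlim : ∀ x, Tendsto (fun n => k n x) atTop (𝓝 (k₀ x)))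
    (hkg : ∀ n x, k n x ^ 2 ≤ g n x) (hgi : ∀ n, Integrable (g n) μ) (hgi₀ : Integrable g₀ μ)
    (hglim : ∀ x, Tendsto (fun n => g n x) atTop (𝓝 (g₀ x)))
    (hgint : Tendsto (fun n => ∫ x, g n x ∂μ) atTop (𝓝 (∫ x, g₀ x ∂μ))) (w : ℂ) :
    Tendsto (fun n => cumulant μ (k n) w) atTop (𝓝 (cumulant μ k₀ w)) := by
  set c := ‖w‖ ^ 2 * Real.exp (‖w‖ * C) with hc
  have hc0 : 0 ≤ c := by positivity
  have hcont : Continuous fun x : ℝ => Complex.exp (w * x) - 1 - w * x := by fun_prop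
  refine tendsto_integral_of_tendsto_bound (g := fun n x => c * g n x) (g₀ := fun x => c * g₀ x)
    (fun n => (hcont.measurable.comp (hk n)).aestronglyMeasurable)
    (fun n => (hgi n).const_mul c) (hgi₀.const_mul c)
    (fun n => Eventually.of_forall fun x => (norm_cumulant_integrand_le (hC n x) w).trans
      (mul_le_mul_of_nonneg_left (hkg n x) hc0))
    (Eventually.of_forall fun x => (hcont.tendsto _).comp (hlim x))
    (Eventually.of_forall fun x => (hglim x).const_mul c) ?_
  simp only [integral_const_mul]
  exact hgint.const_mul c

/-! ### The convolution on the line -/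

lemma tendsto_lineConvOn_Iio (hQ : SmoothingAssumption Q) (hθ : MollifierAssumption θ)
    {T : ℕ → ℝ} (hT : Tendsto T atTop atTop) (u : ℝ × ℝ) :
    Tendsto (fun n => lineConvOn Q θ (Iio (T n)) u) atTop (𝓝 (specConv Q (fun k => k) θ u)) := by
  obtain ⟨B, hB, hb⟩ := exists_abs_lineConvOn_le hQ hθ
  have hu := (hb univ MeasurableSet.univ u).1
  rw [← lineConvOn_univ]
  refine tendsto_integral_of_dominated_convergence (fun a => ‖lineKernelOn Q univ (u - a) * θ a‖)
    (fun n => (hb _ measurableSet_Iio u).1.1) hu.norm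
    (fun n => Eventually.of_forall fun a => ?_) (Eventually.of_forall fun a => ?_)
  · change ‖lineKernelOn Q (Iio (T n)) (u - a) * θ a‖ ≤ _
    rw [norm_mul, norm_mul]
    refine mul_le_mul_of_nonneg_right ((abs_lineKernelOn_le _ _).trans (le_of_eq ?_))
      (norm_nonneg _)
    rw [lineKernelOn, univ_prod_univ, indicator_univ]
    rfl
  · refine Tendsto.mul_const _ (tendsto_const_nhds.congr' ?_)
    filter_upwards [hT.eventually_gt_atTop (u - timeLift (fun x => x) a).1] with n hn
    unfold lineKernelOn
    rw [indicator_of_mem, indicator_of_mem]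
    · exact ⟨hn, mem_univ _⟩
    · exact ⟨mem_univ _, mem_univ _⟩

/-- The truncated kernel is the full kernel minus a tail with vanishing `L²` norm, so its square is
at most twice the sum of the two squares, and the integrals of this majorant converge. -/
lemma tendsto_cumulant_lineConvOn (hQ : SmoothingAssumption Q) (hθ : MollifierAssumption θ)
    {T : ℕ → ℝ} (hT : Tendsto T atTop atTop) (w : ℂ) :
    Tendsto (fun n => cumulant volume (lineConvOn Q θ (Iio (T n))) w) atTop
      (𝓝 (cumulant volume (specConv Q (fun k => k) θ) w)) := by
  obtain ⟨B, hB, hb⟩ := exists_abs_lineConvOn_le hQ hθ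
  set K := specConv Q (fun k => k) θ with hK
  have hK2 : Integrable fun u => K u ^ 2 := by
    rw [hK, ← lineConvOn_univ]
    exact (integral_sq_lineConvOn_le hQ hθ MeasurableSet.univ).1
  have hadd : ∀ n u, K u = lineConvOn Q θ (Iio (T n)) u + lineConvOn Q θ (Ici (T n)) u := by
    intro n u
    rw [hK, ← lineConvOn_univ, ← lineConvOn_union hQ hθ measurableSet_Iio measurableSet_Ici,
      Iio_union_Ici]
    exact Set.disjoint_left.2 fun x h1 h2 => (not_lt.2 (mem_Ici.1 h2)) h1
  have hi : ∀ n, Integrable fun u => lineConvOn Q θ (Ici (T n)) u ^ 2 := fun n =>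
    (integral_sq_lineConvOn_le hQ hθ measurableSet_Ici).1
  refine tendsto_cumulant (g := fun n u => 2 * K u ^ 2 + 2 * lineConvOn Q θ (Ici (T n)) u ^ 2)
    (g₀ := fun u => 2 * K u ^ 2) (C := B)
    (fun n => measurable_lineConvOn hθ measurableSet_Iio)
    (fun n u => (hb _ measurableSet_Iio u).2) (tendsto_lineConvOn_Iio hQ hθ hT)
    (fun n u => ?_) (fun n => (hK2.const_mul 2).add ((hi n).const_mul 2)) (hK2.const_mul 2)
    (fun u => ?_) ?_ w
  · rw [hadd n u]
    nlinarith [sq_nonneg (lineConvOn Q θ (Iio (T n)) u + 2 * lineConvOn Q θ (Ici (T n)) u)]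
  · have h1 : Tendsto (fun n => lineConvOn Q θ (Ici (T n)) u) atTop (𝓝 0) := by
      have := (tendsto_lineConvOn_Iio hQ hθ hT u).const_sub (K u)
      rw [sub_self] at this
      refine this.congr fun n => ?_
      rw [hadd n u]; ring
    have := ((h1.pow 2).const_mul 2).const_add (2 * K u ^ 2)
    simpa using this
  · have h1 : Tendsto (fun n => ∫ u, lineConvOn Q θ (Ici (T n)) u ^ 2) atTop (𝓝 0) :=
      squeeze_zero (fun n => integral_nonneg fun _ => sq_nonneg _)
        (fun n => integral_sq_lineConvOn_le_lineTail hQ hθ measurableSet_Ici le_rfl)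
        ((tendsto_lineTail hQ).comp hT)
    have h2 := (h1.const_mul 2).const_add (∫ u, 2 * K u ^ 2)
    rw [mul_zero, add_zero] at h2
    refine h2.congr fun n => ?_
    rw [integral_add (hK2.const_mul 2) ((hi n).const_mul 2), integral_const_mul 2 (fun u =>
      lineConvOn Q θ (Ici (T n)) u ^ 2)]

lemma eLpNorm_two_le {Ω : Type*} [MeasurableSpace Ω] {Pr : Measure Ω} {f : Ω → ℝ} {b : ℝ}
    (hf : Integrable (fun ω => f ω ^ 2) Pr)
    (hb : ∫ ω, f ω ^ 2 ∂Pr ≤ b) : eLpNorm f 2 Pr ≤ ENNReal.ofReal (√b) := by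
  rw [eLpNorm_eq_lintegral_rpow_enorm_toReal (by norm_num) (by norm_num)]
  have e : ∫⁻ ω, ‖f ω‖ₑ ^ (2 : ℝ≥0∞).toReal ∂Pr = ENNReal.ofReal (∫ ω, f ω ^ 2 ∂Pr) := by
    rw [ofReal_integral_eq_lintegral_ofReal hf (Eventually.of_forall fun _ => sq_nonneg _)]
    refine lintegral_congr fun ω => ?_
    rw [← ofReal_norm, ENNReal.ofReal_rpow_of_nonneg (norm_nonneg _) (by simp)]
    simp
  have hb0 : 0 ≤ b := (integral_nonneg fun _ => sq_nonneg _).trans hb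
  rw [e, Real.sqrt_eq_rpow, ← ENNReal.ofReal_rpow_of_nonneg hb0 (by norm_num)]
  simp only [ENNReal.toReal_ofNat]
  exact ENNReal.rpow_le_rpow (ENNReal.ofReal_le_ofReal hb) (by norm_num)

section LineField

variable {Ω : Type*} [MeasurableSpace Ω] {Pr : Measure Ω} [IsProbabilityMeasure Pr]
  {η : Ω → Measure (ℝ × ℝ)}

lemma HasPoissonLaw.memLp {E : Type*} [MeasurableSpace E] {μ : Measure E} {k : E → ℝ} {B : ℝ}
    {X : Ω → ℝ} (h : HasPoissonLaw μ k B Pr X) : MemLp X 2 Pr := by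
  rw [memLp_two_iff_integrable_sq h.aemeasurable.aestronglyMeasurable]
  -- The constant is `24 = 4!`, from `|x|⁴ / 4! ≤ exp |x|`.
  refine h.integrable_comp (g := fun x => x ^ 2) (by fun_prop) (A := 24) fun x => ?_
  have := Real.pow_div_factorial_le_exp |x| (abs_nonneg x) 4
  have e : |x| ^ 4 = x ^ 4 := by rw [← abs_pow]; exact abs_of_nonneg (by positivity)
  rw [e, div_le_iff₀ (by positivity)] at this
  norm_num [Nat.factorial] at this
  nlinarith

/-- Completeness of `L²`: the increment bound is a continuous function of the tail that vanishes
with it, hence tends to `0`. -/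
lemma IsPoissonProcess.exists_isConvAtZero (hQ : SmoothingAssumption Q)
    (hθ : MollifierAssumption θ) (h : IsPoissonProcess η volume Pr) :
    ∃ X : Ω → ℝ, IsConvAtZero Q θ Pr η X := by
  obtain ⟨B, hB⟩ := h.exists_hasPoissonLaw_truncatedConv hQ hθ
  obtain ⟨C, hC⟩ := h.exists_integral_sq_truncatedConv_sub_le hQ hθ
  have hmem : ∀ T, MemLp (fun ω => truncatedConv Q θ T (η ω)) 2 Pr := fun T => (hB T).memLp
  set b : ℝ → ℝ := fun S => √(2 * Real.exp (Real.exp C * lineTail Q θ S) - 2) with hb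
  have hb0 : Tendsto b atTop (𝓝 0) := by
    have hc : Continuous fun r : ℝ => √(2 * Real.exp (Real.exp C * r) - 2) := by fun_prop
    have := (hc.tendsto 0).comp (tendsto_lineTail (θ := θ) hQ)
    simp only [mul_zero, Real.exp_zero, mul_one, sub_self, Real.sqrt_zero] at this
    exact this
  have hcau : CauchySeq fun T : ℝ => (hmem T).toLp := by
    refine cauchySeq_of_le_tendsto_0' b (fun S T hST => ?_) hb0
    rw [dist_comm, dist_edist, Lp.edist_toLp_toLp]
    refine ENNReal.toReal_le_of_le_ofReal (Real.sqrt_nonneg _) ?_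
    exact eLpNorm_two_le (hC S T hST).1 (hC S T hST).2
  obtain ⟨Y, hY⟩ := cauchySeq_tendsto_of_complete hcau
  refine ⟨Y, Lp.memLp Y, ?_⟩
  have := (Lp.tendsto_Lp_iff_tendsto_eLpNorm'' (fun T : ℝ => fun ω => truncatedConv Q θ T (η ω))
    hmem Y (Lp.memLp Y)).1 (by rwa [Lp.toLp_coeFn])
  exact this

/-- Along a sequence of truncations converging almost surely, Fatou carries over the exponential
moment and bounded convergence the characteristic function, whose limit is known from the cumulants.
The argument applies to every version of the limit. -/
lemma IsConvAtZero.exists_hasPoissonLaw (hQ : SmoothingAssumption Q)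
    (hθ : MollifierAssumption θ) (h : IsPoissonProcess η volume Pr) {X : Ω → ℝ}
    (hX : IsConvAtZero Q θ Pr η X) :
    ∃ B, HasPoissonLaw volume (specConv Q (fun k => k) θ) B Pr X := by
  obtain ⟨B, hB⟩ := h.exists_hasPoissonLaw_truncatedConv hQ hθ
  have hXm := hX.memLp.1.aemeasurable
  have hmeas := tendstoInMeasure_of_tendsto_eLpNorm two_ne_zero
    (fun T => (hB T).aemeasurable.aestronglyMeasurable) hX.memLp.1 hX.tendsto
  obtain ⟨T, hT, hae⟩ := hmeas.exists_seq_tendsto_ae'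
  have hB0 : 0 ≤ B := (integral_nonneg fun _ => (Real.exp_pos _).le).trans (hB 0).integral_exp_le
  have hlint : ∫⁻ ω, ENNReal.ofReal (Real.exp |X ω|) ∂Pr ≤ ENNReal.ofReal B := by
    have hm : ∀ n, AEMeasurable (fun ω =>
        ENNReal.ofReal (Real.exp |truncatedConv Q θ (T n) (η ω)|)) Pr := fun n =>
      (hB (T n)).integrable_exp.1.aemeasurable.ennreal_ofReal
    have hl : ∀ᵐ ω ∂Pr, ENNReal.ofReal (Real.exp |X ω|) =
        liminf (fun n => ENNReal.ofReal (Real.exp |truncatedConv Q θ (T n) (η ω)|)) atTop := by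
      filter_upwards [hae] with ω hω
      have hc : Continuous fun x : ℝ => ENNReal.ofReal (Real.exp |x|) :=
        ENNReal.continuous_ofReal.comp (by fun_prop)
      exact (((hc.tendsto _).comp hω).liminf_eq).symm
    rw [lintegral_congr_ae hl]
    refine (lintegral_liminf_le' hm).trans ?_
    refine liminf_le_of_le (by isBoundedDefault) fun c hc => ?_
    obtain ⟨n, hn⟩ := hc.exists
    refine hn.trans ?_
    rw [← ofReal_integral_eq_lintegral_ofReal (hB (T n)).integrable_exp
      (Eventually.of_forall fun _ => (Real.exp_pos _).le)]
    exact ENNReal.ofReal_le_ofReal (hB (T n)).integral_exp_le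
  have hcm : AEStronglyMeasurable (fun ω => Real.exp |X ω|) Pr :=
    ((by fun_prop : Continuous fun x : ℝ => Real.exp |x|).measurable.comp_aemeasurable
      hXm).aestronglyMeasurable
  have hint : Integrable (fun ω => Real.exp |X ω|) Pr := by
    refine ⟨hcm, ?_⟩
    rw [hasFiniteIntegral_iff_ofReal (Eventually.of_forall fun _ => (Real.exp_pos _).le)]
    exact hlint.trans_lt ENNReal.ofReal_lt_top
  refine ⟨B, hXm, hint, ?_, fun l => ?_⟩
  · rw [← ofReal_integral_eq_lintegral_ofReal hint
      (Eventually.of_forall fun _ => (Real.exp_pos _).le)] at hlint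
    exact (ENNReal.ofReal_le_ofReal_iff hB0).1 hlint
  · have hc : Continuous fun x : ℝ => Complex.exp (l * x * Complex.I) := by fun_prop
    have hcf : ∀ {Y : Ω → ℝ}, AEMeasurable Y Pr →
        charFun (Pr.map Y) l = ∫ ω, Complex.exp (l * Y ω * Complex.I) ∂Pr := by
      intro Y hY
      rw [charFun_apply_real, integral_map hY hc.aestronglyMeasurable]
    have h1 : Tendsto (fun n => ∫ ω, Complex.exp
        (l * truncatedConv Q θ (T n) (η ω) * Complex.I) ∂Pr) atTop
        (𝓝 (∫ ω, Complex.exp (l * X ω * Complex.I) ∂Pr)) := by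
      refine tendsto_integral_of_dominated_convergence (fun _ => (1 : ℝ)) (fun n =>
        (hc.measurable.comp_aemeasurable (hB (T n)).aemeasurable).aestronglyMeasurable)
        (integrable_const _) (fun n => Eventually.of_forall fun ω => ?_) ?_
      · rw [← Complex.ofReal_mul, Complex.norm_exp_ofReal_mul_I]
      · filter_upwards [hae] with ω hω
        exact (hc.tendsto _).comp hω
    have h2 := (Complex.continuous_exp.tendsto _).comp
      (tendsto_cumulant_lineConvOn hQ hθ hT (l * Complex.I))
    rw [hcf hXm]
    refine tendsto_nhds_unique h1 (h2.congr fun n => ?_)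
    rw [Function.comp, ← (hB (T n)).charFun_eq, hcf (hB (T n)).aemeasurable]

end LineField

/-! ### Convergence of the torus to the line -/

/-- Since `φ 0 = 0`, an integral over the cylinder is one over the whole plane of the kernel cut off
to a fundamental strip. All scales then live on the same space, as the limit theorems require. -/
lemma integral_torusConv (Q : Polynomial ℝ) (hθ : MollifierAssumption θ) (ε : Scale) (x₀ : ℝ)
    {V : Type*} [NormedAddCommGroup V] [NormedSpace ℝ V] {φ : ℝ → V}
    (hφ : Continuous φ) (hφ0 : φ 0 = 0) :
    ∫ u, φ (torusConv Q θ ε u) =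
      ∫ u, φ ((strip ε x₀).indicator (specConv Q (latticeRound ε) θ) u) := by
  have hmp := measurePreserving_strip ε x₀
  have hm : AEStronglyMeasurable (fun u => φ (torusConv Q θ ε u)) volume :=
    hφ.comp_aestronglyMeasurable (measurable_torusConv hθ ε).aestronglyMeasurable
  rw [← hmp.map_eq] at hm ⊢
  rw [integral_map hmp.measurable.aemeasurable hm, ← integral_indicator (measurableSet_strip ε x₀)]
  refine integral_congr_ae (Eventually.of_forall fun u => ?_)
  dsimp only
  by_cases hu : u ∈ strip ε x₀
  · rw [indicator_of_mem hu, indicator_of_mem hu, torusConv_coe]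
  · rw [indicator_of_notMem hu, indicator_of_notMem hu, hφ0]

lemma integrable_sq_specConv (hQ : SmoothingAssumption Q) (hθ : MollifierAssumption θ) :
    Integrable (fun u => specConv Q (fun k => k) θ u ^ 2) ∧
      ∫ u, specConv Q (fun k => k) θ u ^ 2 = ∫ p : (ℝ × ℝ) × (ℝ × ℝ),
        θ p.1 * θ p.2 * specCov Q (fun k => k) (p.1 - p.2) := by
  refine ⟨?_, (isSpectralKernel_line hQ).integral_sq_liftConv hQ rfl measurable_id hθ⟩
  rw [← lineConvOn_univ]
  exact (integral_sq_lineConvOn_le hQ hθ MeasurableSet.univ).1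

lemma tendsto_latticeRound {ε : ℕ → Scale} (hε : Tendsto (fun n => (ε n : ℝ)) atTop (𝓝 0))
    (k : ℝ) : Tendsto (fun n => latticeRound (ε n) k) atTop (𝓝 k) := by
  rw [tendsto_iff_norm_sub_tendsto_zero]
  exact squeeze_zero (fun _ => norm_nonneg _) (fun n => abs_latticeRound_sub_le (ε n).2.1 k) hε

lemma eventually_mem_strip {ε : ℕ → Scale} (hε : Tendsto (fun n => (ε n : ℝ)) atTop (𝓝 0))
    (u : ℝ × ℝ) : ∀ᶠ n in atTop, u ∈ strip (ε n) (-(1 / (2 * (ε n : ℝ)))) := by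
  have h : Tendsto (fun n => (ε n : ℝ) * (2 * |u.2|)) atTop (𝓝 0) := by
    simpa using hε.mul_const (2 * |u.2|)
  filter_upwards [h.eventually_lt_const one_pos] with n hn
  have hpos := (ε n).2.1
  have h1 : |u.2| < 1 / (2 * (ε n : ℝ)) := by
    rw [lt_div_iff₀ (by positivity)]
    linarith
  have h2 := abs_lt.1 h1
  refine ⟨mem_univ _, h2.1, ?_⟩
  have e : 1 / (ε n : ℝ) = 2 * (1 / (2 * (ε n : ℝ))) := by field_simp
  rw [e]
  linarith [h2.2]

/-- The cut-off kernels converge pointwise, and the integrals of their squares converge by the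
covariance formula, so the squares themselves serve as Pratt majorants. No spatial decay of the
torus kernels uniform in `ε` is used. -/
lemma tendsto_cumulant_torusConv (hQ : SmoothingAssumption Q) (hθ : MollifierAssumption θ)
    {ε : ℕ → Scale} (hε : Tendsto (fun n => (ε n : ℝ)) atTop (𝓝 0)) (w : ℂ) :
    Tendsto (fun n => cumulant volume (torusConv Q θ (ε n)) w) atTop
      (𝓝 (cumulant volume (specConv Q (fun k => k) θ) w)) := by
  obtain ⟨B, hB, hb⟩ := exists_abs_specConv_le hQ hθ
  have hρ : ∀ n, IsSampling (latticeRound (ε n)) := fun n => isSampling_scale (ε n)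
  -- Centring the period at the origin makes every fixed point eventually belong to the strip.
  set x₀ : ℕ → ℝ := fun n => -(1 / (2 * (ε n : ℝ))) with hx₀
  set k : ℕ → ℝ × ℝ → ℝ := fun n =>
    (strip (ε n) (x₀ n)).indicator (specConv Q (latticeRound (ε n)) θ) with hk
  have hkm : ∀ n, Measurable (k n) := fun n =>
    (measurable_specConv hθ (hρ n)).indicator (measurableSet_strip _ _)
  have hlim : ∀ u, Tendsto (fun n => k n u) atTop (𝓝 (specConv Q (fun k => k) θ u)) := by
    intro u
    refine (tendsto_specConv hQ hθ hρ (tendsto_latticeRound hε) u).congr' ?_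
    filter_upwards [eventually_mem_strip hε u] with n hn
    rw [hk]
    dsimp only
    rw [indicator_of_mem hn]
  have hcum : ∀ n, cumulant volume (torusConv Q θ (ε n)) w = cumulant volume (k n) w := fun n =>
    integral_torusConv Q hθ (ε n) (x₀ n) (φ := fun x : ℝ => Complex.exp (w * x) - 1 - w * x)
      (by fun_prop) (by simp)
  have hsq : ∀ n, ∫ u, torusConv Q θ (ε n) u ^ 2 = ∫ u, k n u ^ 2 := fun n =>
    integral_torusConv Q hθ (ε n) (x₀ n) (φ := fun x : ℝ => x ^ 2) (by fun_prop) (by simp)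
  have hki : ∀ n, Integrable fun u => k n u ^ 2 := by
    intro n
    have hmp := measurePreserving_strip (ε n) (x₀ n)
    have h1 := (hmp.integrable_comp
      ((measurable_torusConv (Q := Q) hθ (ε n)).pow_const 2).aestronglyMeasurable).2
      (integrable_sq_torusConv hQ hθ (ε n)).1
    have h2 := (integrable_indicator_iff (measurableSet_strip (ε n) (x₀ n))).2 h1
    refine h2.congr (Eventually.of_forall fun u => ?_)
    by_cases hu : u ∈ strip (ε n) (x₀ n)
    · simp only [hk, indicator_of_mem hu, Function.comp, torusConv_coe]
    · simp only [hk, indicator_of_notMem hu]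
      norm_num
  simp only [hcum]
  refine tendsto_cumulant (g := fun n u => k n u ^ 2)
    (g₀ := fun u => specConv Q (fun k => k) θ u ^ 2) hkm (C := B) (fun n u => ?_) hlim
    (fun n u => le_rfl) hki (integrable_sq_specConv hQ hθ).1 (fun u => (hlim u).pow 2) ?_ w
  · exact (norm_indicator_le_norm_self (specConv Q (latticeRound (ε n)) θ) u).trans
      (hb _ (hρ n) u).2
  · simp only [← hsq, (integrable_sq_torusConv hQ hθ _).2, (integrable_sq_specConv hQ hθ).2]
    exact tendsto_integral_specCov hQ hρ (tendsto_latticeRound hε) hθ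

end KPZCoupling

end

/-! ### Assembly of the theorem -/

theorem mainTheorem5
    (Q : Polynomial ℝ) (hQ : KPZCoupling.SmoothingAssumption Q)
    (F : ℝ → ℝ) (hF : KPZCoupling.NonlinearityAssumption F)
    (θ : ℝ × ℝ → ℝ) (hθ : KPZCoupling.MollifierAssumption θ)
    -- for each scale `ε ∈ (0, 1)`, a Poisson point process on `ℝ × (𝕋 / ε)`
    {Ωε : KPZCoupling.Scale → Type*} [∀ ε, MeasurableSpace (Ωε ε)]
    (Prε : ∀ ε, Measure (Ωε ε)) [∀ ε, IsProbabilityMeasure (Prε ε)]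
    (ηε : ∀ ε, Ωε ε → Measure (KPZCoupling.Micro ε))
    (hηε : ∀ ε, KPZCoupling.IsPoissonProcess (ηε ε) volume (Prε ε))
    -- a Poisson point process on `ℝ²`
    {Ω : Type*} [MeasurableSpace Ω] (Pr : Measure Ω) [IsProbabilityMeasure Pr]
    (η : Ω → Measure (ℝ × ℝ)) (hη : KPZCoupling.IsPoissonProcess η volume Pr) :
    -- the noises, the free field and `a_ε` are well defined, and `a_ε` does not depend on the point
    (∀ (ε : KPZCoupling.Scale) (p : KPZCoupling.Micro ε), ∀ᵐ ω ∂Prε ε,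
      Integrable (fun u => KPZCoupling.periodizedMollifier θ ε (p - u)) (ηε ε ω)) ∧
    (∀ (ε : KPZCoupling.Scale) (z : KPZCoupling.Macro), ∀ᵐ ω ∂Prε ε, Integrable (fun y =>
      KPZCoupling.greenTorusDeriv Q ε (z - y) * KPZCoupling.macroNoise θ ε (ηε ε ω) y)) ∧
    (∀ (ε : KPZCoupling.Scale) (z : KPZCoupling.Macro), Integrable (fun ω =>
      iteratedDeriv 2 F (√(ε : ℝ) * KPZCoupling.freeField Q θ ε (ηε ε ω) z)) (Prε ε)) ∧
    (∀ (ε : KPZCoupling.Scale) (z : KPZCoupling.Macro), KPZCoupling.couplingEps Q F θ ε (Prε ε) (ηε ε) z =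
      KPZCoupling.couplingEps Q F θ ε (Prε ε) (ηε ε) 0) ∧
    -- `(P' ∗ ξ̄)(0)` is well defined
    (∀ p, ∀ᵐ ω ∂Pr, Integrable (fun u => θ (p - u)) (η ω)) ∧
    (∀ T : ℝ, ∀ᵐ ω ∂Pr, IntegrableOn (KPZCoupling.convIntegrand Q θ (η ω)) (Ioo (-T) 0 ×ˢ univ)) ∧
    (∃ X : Ω → ℝ, KPZCoupling.IsConvAtZero Q θ Pr η X) ∧
    -- `a_ε → a = ½ E F''((P' ∗ ξ̄)(0))`
    ∀ X : Ω → ℝ, KPZCoupling.IsConvAtZero Q θ Pr η X →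
      Integrable (fun ω => iteratedDeriv 2 F (X ω)) Pr ∧
      Tendsto (fun ε : KPZCoupling.Scale => KPZCoupling.couplingEps Q F θ ε (Prε ε) (ηε ε) 0)
        (comap (fun ε : KPZCoupling.Scale => (ε : ℝ)) (𝓝 0))
        (𝓝 (1 / 2 * ∫ ω, iteratedDeriv 2 F (X ω) ∂Pr)) := by
  have hc := hF.continuous_deriv
  obtain ⟨A, hA⟩ := hF.exists_sq_le
  obtain ⟨B, hB⟩ := KPZCoupling.exists_hasPoissonLaw_freeField hQ hθ
  have law := fun ε z => hB ε (Prε ε) (ηε ε) (hηε ε) z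
  refine ⟨fun ε p => ?_, fun ε z => ?_, fun ε z => (law ε z).integrable_comp hc hA, fun ε z => ?_,
    fun p => ?_, fun T => ?_, hη.exists_isConvAtZero hQ hθ, fun X hX => ?_⟩
  · exact (hηε ε).ae_integrable
      ((KPZCoupling.measurable_periodizedMollifier hθ.measurable ε).comp
        (measurable_const.sub measurable_id))
      ((KPZCoupling.integrable_periodizedMollifier hθ.measurable hθ.integrable ε).1.comp_sub_left p)
  · exact ((hηε ε).ae_freeField hQ hθ z).mono fun _ h => h.1
  · unfold KPZCoupling.couplingEps
    -- The laws at `z` and at `0` are recorded with the same kernel, so their cumulants agree by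
    -- definition.
    rw [(law ε z).integral_comp_eq (law ε 0) (fun _ => rfl) hc]
  · exact hη.ae_integrable (hθ.measurable.comp (measurable_const.sub measurable_id))
      (hθ.integrable.comp_sub_left p)
  · exact (hη.ae_truncatedConv hQ hθ T).mono fun _ h => h.1
  · obtain ⟨B₀, law₀⟩ := hX.exists_hasPoissonLaw hQ hθ hη
    -- The filter of scales tending to zero is countably generated, so sequences suffice, as the
    -- limit theorems above are sequential.
    refine ⟨law₀.integrable_comp hc hA, tendsto_of_seq_tendsto fun ε hε => ?_⟩
    have hε' : Tendsto (fun n => (ε n : ℝ)) atTop (𝓝 0) := tendsto_comap_iff.1 hε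
    have := Measure.isProbabilityMeasure_map law₀.aemeasurable
    have := fun n => Measure.isProbabilityMeasure_map (law (ε n) 0).aemeasurable
    have key := KPZCoupling.tendsto_integral_of_tendsto_charFun
      (ν := fun n => (Prε (ε n)).map fun ω =>
        √(ε n : ℝ) * KPZCoupling.freeField Q θ (ε n) (ηε (ε n) ω) 0)
      (ν₀ := Pr.map X) (fun l => by
        simp only [(law _ 0).charFun_eq, law₀.charFun_eq]
        exact (Complex.continuous_exp.tendsto _).comp
          (KPZCoupling.tendsto_cumulant_torusConv hQ hθ hε' (l * Complex.I)))
      (fun n => (law (ε n) 0).integrable_map.1) (fun n => (law (ε n) 0).integrable_map.2)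
      law₀.integrable_map.1 hc hA
    rw [integral_map law₀.aemeasurable hc.aestronglyMeasurable] at key
    refine (key.const_mul (1 / 2)).congr fun n => ?_
    rw [integral_map (law (ε n) 0).aemeasurable hc.aestronglyMeasurable]
    rfl
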